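/- **Setting.** Let $\Omega\subset\mathbb R^2$ be a bounded open set with $\operatorname{int}\overline\Omega=\Omega$, crossed by a fracture $\Gamma$: a simple polygonal arc running inside $\Omega$ with its two end points $\partial\Gamma$ on $\partial\Omega$, such that $\Omega_B:=\Omega\setminus\overline\Gamma=\Omega_{B,1}\cup\Omega_{B,2}$ with $\Omega_{B,1},\Omega_{B,2}$ open and disjoint and $\Gamma\subset\partial\Omega_{B,1}\cap\partial\Omega_{B,2}$; put $\partial\Omega_B=\partial\Omega\setminus\overline\Gamma$. Let $K:\Omega_B\to\mathbb R^{2\times2}$ be symmetric and measurable (e.g. piecewise constant) with $0<K_1\le K(x)z\cdot z\le K_2$ for a.e. $x$ and all $|z|=1$. Let $\kappa_\Gamma^*,\kappa_\Gamma^n,\ell_\Gamma:\Gamma\to\mathbb R$ be measurable (e.g. piecewise constant) and bounded above and below a.e. by positive constants, let $\xi\in(\tfrac12,1]$, and set $K_\Gamma=\kappa_\Gamma^*\ell_\Gamma$, $\eta_\Gamma=\ell_\Gamma/\kappa_\Gamma^n$, $\alpha_\Gamma=\eta_\Gamma(\tfrac\xi2-\tfrac14)$. The sources are $f\in L^2(\Omega_B)$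 and $f_\Gamma\in L^2(\Gamma)$; the boundary data are zero. **Mesh.** Let $\mathcal T_u$ be a finite conforming mesh of $\overline\Omega$ by polygons (straight angles at vertices are allowed) with pairwise disjoint interiors, such that $\overline\Gamma$ is a union of edges; these edges form $\mathcal F_h^\Gamma$. The edges not on $\Gamma$ form $\mathcal F_u$, and those of them not on $\partial\Omega_B$ form $\mathcal F_u^0$. Each polygon $S(\nu)$ is cut into triangles by joining an interior point $\nu$ to all its vertices; all these triangles form $\mathcal T_h$, and the new edges form $\mathcal F_p$. For $\rho_S>0$, Assumption (A) says: every $S(\nu)\in\mathcal T_u$ is star-shaped with respect to a ball centred at $\nu$ of radius at least $\rho_S\operatorname{diam}S(\nu)$. Nothing is assumed about the lengths of edges. For an edge shared by $\tau_1,\tau_2\in\mathcal T_h$ with unit normal $n$ pointing from $\tau_1$ to $\tau_2$ (on $\Gamma$: from $\Omega_{B,1}$ to $\Omega_{B,2}$), set $[q]=q_1-q_2$, $\{q\}=\tfrac12(q_1+q_2)$, $[v\cdot n]=v_1\cdot n-v_2\cdot n$ and $\{v\cdot n\}=\tfrac12(v_1+v_2)\cdot n$, where the index $i$ denotes the trace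 from $\tau_i$. **Scheme.** For $k\ge0$ let $$S_h=\{q:\ q|_\tau\in P^k(\tau)\ \forall\tau\in\mathcal T_h,\ [q]|_e=0\ \forall e\in\mathcal F_u^0,\ q|_{\partial\Omega_B}=0\},$$ $$V_h=\{v:\ v|_\tau\in P^k(\tau)^2\ \forall\tau\in\mathcal T_h,\ [v\cdot n]|_e=0\ \forall e\in\mathcal F_p\},$$ $$W_h=\{q_\Gamma\in H^1_0(\Gamma):\ q_\Gamma|_e\in P^k(e)\ \forall e\in\mathcal F_h^\Gamma\},$$ $$b_h(v,q)=-\sum_{e\in\mathcal F_p}\langle v\cdot n,[q]\rangle_e+\sum_{\tau\in\mathcal T_h}(v,\nabla q)_\tau,$$ $$b_h^*(q,v)=\sum_{e\in\mathcal F_u^0}\langle q,[v\cdot n]\rangle_e-\sum_{\tau\in\mathcal T_h}(q,\nabla\cdot v)_\tau+\sum_{e\in\mathcal F_h^\Gamma}\big(\langle[q],\{v\cdot n\}\rangle_e+\langle\{q\},[v\cdot n]\rangle_e\big).$$ The discrete problem is: find $(u_h,p_h,p_{\Gamma,h})\in V_h\times S_h\times W_h$ such that for all $(v,q,q_\Gamma)\in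 V_h\times S_h\times W_h$ $$(K^{-1}u_h,v)_{\Omega_B}+b_h^*(p_h,v)=0,$$ $$-b_h(u_h,q)+\sum_{e\in\mathcal F_h^\Gamma}\langle\tfrac1{\alpha_\Gamma}(\{p_h\}-p_{\Gamma,h}),\{q\}\rangle_e+\sum_{e\in\mathcal F_h^\Gamma}\langle\tfrac1{\eta_\Gamma}[p_h],[q]\rangle_e=(f,q)_{\Omega_B},$$ $$\langle K_\Gamma\nabla_tp_{\Gamma,h},\nabla_tq_\Gamma\rangle_\Gamma-\sum_{e\in\mathcal F_h^\Gamma}\langle\tfrac1{\alpha_\Gamma}(\{p_h\}-p_{\Gamma,h}),q_\Gamma\rangle_e=\langle\ell_\Gamma f_\Gamma,q_\Gamma\rangle_\Gamma,$$ where $\nabla_t$ is the derivative with respect to arc length along $\Gamma$. **Theorem 3.1 (stability).** Given $\Omega$, $\Gamma$, the coefficients, $k\ge0$ and $\rho_S>0$, there is a constant $C>0$, depending only on these and not on the mesh or on $f,f_\Gamma$, such that for every such mesh satisfying Assumption (A) with $\rho_S$ and for all $f\in L^2(\Omega_B)$, $f_\Gamma\in L^2(\Gamma)$, the discrete problem has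 a unique solution $(u_h,p_h,p_{\Gamma,h})\in V_h\times S_h\times W_h$, and $$\|K^{-1/2}u_h\|_{0,\Omega_B}^2+\|p_h\|_{0,\Omega_B}^2+\sum_{e\in\mathcal F_h^\Gamma}\|\eta_\Gamma^{-1/2}[p_h]\|_{0,e}^2+\|K_\Gamma^{1/2}\nabla_tp_{\Gamma,h}\|_{0,\Gamma}^2+\sum_{e\in\mathcal F_h^\Gamma}\|\alpha_\Gamma^{-1/2}(\{p_h\}-p_{\Gamma,h})\|_{0,e}^2\le C\big(\|f\|_{0,\Omega_B}^2+\|\ell_\Gamma f_\Gamma\|_{0,\Gamma}^2\big).$$ -/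

import Mathlib

open Set MeasureTheory
open scoped Matrix

noncomputable section

namespace FracturedFlow

/-- The Euclidean plane. -/
abbrev Plane : Type := EuclideanSpace ℝ (Fin 2)

/-! ### Geometry of the porous medium and of the fracture -/

/-- A fracture: a simple (non-closed) polygonal curve, parametrized by arc length on `[0, len]`. -/
structure Fracture where
  len : ℝ
  len_pos : 0 < len
  γ : ℝ → Plane
  injOn : InjOn γ (Icc 0 len)
  polygonal : ∃ (n : ℕ) (s : ℕ → ℝ), Monotone s ∧ s 0 = 0 ∧ s n = len ∧
    ∀ i < n, ∃ d : Plane, ‖d‖ = 1 ∧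
      ∀ t ∈ Icc (s i) (s (i + 1)), γ t = γ (s i) + (t - s i) • d

/-- The open fracture `Γ` (without its two end points). -/
def Fracture.relInterior (F : Fracture) : Set Plane := F.γ '' Ioo 0 F.len

/-- The closed fracture, that is `Γ` together with `∂Γ = {γ 0, γ len}`. -/
def Fracture.carrier (F : Fracture) : Set Plane := F.γ '' Icc 0 F.len

/-- The region `Ω`, crossed by the fracture `Γ`, which runs inside `Ω` from boundary to boundary
and is the interface between the two bulk subdomains `Ω₁`, `Ω₂` into which it cuts `Ω`.
The normal of `Γ` points from `Ω₁` to `Ω₂`. -/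
structure Geometry where
  Ω : Set Plane
  Ω₁ : Set Plane
  Ω₂ : Set Plane
  F : Fracture
  isBounded : Bornology.IsBounded Ω
  isOpen₁ : IsOpen Ω₁
  isOpen₂ : IsOpen Ω₂
  disjoint : Disjoint Ω₁ Ω₂
  bulk_eq : Ω \ F.carrier = Ω₁ ∪ Ω₂
  /-- `Ω` is open and lies on one side of its boundary (there are no slits). -/
  regular : interior (closure Ω) = Ω
  fracture_inside : F.relInterior ⊆ Ω
  start_mem : F.γ 0 ∈ frontier Ω
  end_mem : F.γ F.len ∈ frontier Ω
  isInterface : F.relInterior ⊆ frontier Ω₁ ∩ frontier Ω₂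

/-- The bulk region `Ω_B = Ω \ closure Γ`. -/
def Geometry.bulk (G : Geometry) : Set Plane := G.Ω \ G.F.carrier

/-- Lebesgue measure on the arc-length parameter interval of the fracture. -/
def Fracture.paramMeasure (F : Fracture) : Measure ℝ := volume.restrict (Icc 0 F.len)

/-- The coefficients of the model: symmetric uniformly elliptic bulk permeability `K`, tangential
and normal permeabilities `κt`, `κn` and thickness `ℓ` of the fracture, and model parameter `ξ`.
Functions on `Γ` are given as functions of the point of the plane; only their values on `Γ` are
used. Piecewise constant coefficients (with positive values on `Γ`) are the special case of
interest. -/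
structure Coefficients (G : Geometry) where
  K : Plane → Matrix (Fin 2) (Fin 2) ℝ
  K₁ : ℝ
  K₂ : ℝ
  K₁_pos : 0 < K₁
  K_meas : ∀ i j, AEMeasurable (fun x => K x i j) (volume.restrict G.bulk)
  K_symm : ∀ᵐ x ∂(volume.restrict G.bulk), (K x).IsSymm
  K_bounds : ∀ᵐ x ∂(volume.restrict G.bulk), ∀ z : Fin 2 → ℝ, z ⬝ᵥ z = 1 →
    K₁ ≤ (K x *ᵥ z) ⬝ᵥ z ∧ (K x *ᵥ z) ⬝ᵥ z ≤ K₂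
  κt : Plane → ℝ
  κn : Plane → ℝ
  ℓ : Plane → ℝ
  κt_meas : AEMeasurable (fun s => κt (G.F.γ s)) G.F.paramMeasure
  κn_meas : AEMeasurable (fun s => κn (G.F.γ s)) G.F.paramMeasure
  ℓ_meas : AEMeasurable (fun s => ℓ (G.F.γ s)) G.F.paramMeasure
  κt_bounds : ∃ c₁ c₂ : ℝ, 0 < c₁ ∧
    ∀ᵐ s ∂G.F.paramMeasure, c₁ ≤ κt (G.F.γ s) ∧ κt (G.F.γ s) ≤ c₂
  κn_bounds : ∃ c₁ c₂ : ℝ, 0 < c₁ ∧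
    ∀ᵐ s ∂G.F.paramMeasure, c₁ ≤ κn (G.F.γ s) ∧ κn (G.F.γ s) ≤ c₂
  ℓ_bounds : ∃ c₁ c₂ : ℝ, 0 < c₁ ∧
    ∀ᵐ s ∂G.F.paramMeasure, c₁ ≤ ℓ (G.F.γ s) ∧ ℓ (G.F.γ s) ≤ c₂
  ξ : ℝ
  ξ_gt : 1 / 2 < ξ
  ξ_le : ξ ≤ 1

namespace Coefficients

variable {G : Geometry} (c : Coefficients G)

/-- `K_Γ = κ*_Γ ℓ_Γ`. -/
def KΓ (x : Plane) : ℝ := c.κt x * c.ℓ x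

/-- `η_Γ = ℓ_Γ / κⁿ_Γ`. -/
def η (x : Plane) : ℝ := c.ℓ x / c.κn x

/-- `α_Γ = η_Γ (ξ / 2 - 1 / 4)`. -/
def α (x : Plane) : ℝ := c.η x * (c.ξ / 2 - 1 / 4)

end Coefficients

/-! ### Polygonal meshes and their simplicial submeshes -/

/-- The determinant `det (v, w)`. -/
def cross (v w : Plane) : ℝ := v 0 * w 1 - v 1 * w 0

/-- The unit normal of the oriented segment from `a` to `b` that points to its right. -/
def rightNormal (a b : Plane) : Plane := ‖b - a‖⁻¹ • !₂[(b - a) 1, -((b - a) 0)]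

/-- The integral of `g` over the segment from `a` to `b` with respect to arc length. -/
def edgeIntegral (a b : Plane) (g : Plane → ℝ) : ℝ :=
  dist a b * ∫ t in (0 : ℝ)..1, g (AffineMap.lineMap a b t)

/-- A primal element `S(ν)`: a polygon with `nv + 3` vertices, listed counterclockwise
(cyclically, straight angles are allowed), which is cut into nondegenerate triangles with
disjoint interiors by connecting the point `ν = center` to all its vertices. -/
structure PrimalElement where
  nv : ℕ
  vert : Fin (nv + 3) → Plane
  center : Plane
  pos : ∀ i, 0 < cross (vert i - center) (vert (i + 1) - center)
  fan : Pairwise fun i j =>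
    Disjoint (interior (convexHull ℝ {center, vert i, vert (i + 1)}))
      (interior (convexHull ℝ {center, vert j, vert (j + 1)}))

/-- The closed polygon. -/
def PrimalElement.carrier (S : PrimalElement) : Set Plane :=
  ⋃ i, convexHull ℝ {S.center, S.vert i, S.vert (i + 1)}

/-- A polygonal mesh of `Ω` that is fitted to the fracture. -/
structure Mesh (G : Geometry) where
  N : ℕ
  elt : Fin N → PrimalElement
  cover : ⋃ j, (elt j).carrier = closure G.Ω
  disjoint : Pairwise fun j j' =>
    Disjoint (interior (elt j).carrier) (interior (elt j').carrier)
  /-- Two edges of elements coincide or meet at most in common end points. -/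
  conforming : ∀ (j j' : Fin N) (i : Fin ((elt j).nv + 3)) (i' : Fin ((elt j').nv + 3)),
    segment ℝ ((elt j).vert i) ((elt j).vert (i + 1)) =
      segment ℝ ((elt j').vert i') ((elt j').vert (i' + 1)) ∨
    segment ℝ ((elt j).vert i) ((elt j).vert (i + 1)) ∩
      segment ℝ ((elt j').vert i') ((elt j').vert (i' + 1)) ⊆
      {(elt j).vert i, (elt j).vert (i + 1)} ∩ {(elt j').vert i', (elt j').vert (i' + 1)}
  /-- The closed fracture is a union of edges of elements. -/
  fitted : ∀ x ∈ G.F.carrier, ∃ (j : Fin N) (i : Fin ((elt j).nv + 3)),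
    x ∈ segment ℝ ((elt j).vert i) ((elt j).vert (i + 1)) ∧
    segment ℝ ((elt j).vert i) ((elt j).vert (i + 1)) ⊆ G.F.carrier

namespace Mesh

variable {G : Geometry} (M : Mesh G)

/-- Assumption (A): every element `S(ν)` is star-shaped with respect to (each point of) a ball
around `ν` of radius at least `ρ` times the diameter of the element. -/
def AssumptionA (ρ : ℝ) : Prop :=
  ∀ j, ∃ r : ℝ, ρ * Metric.diam (M.elt j).carrier ≤ r ∧
    ∀ y ∈ Metric.closedBall (M.elt j).center r, StarConvex ℝ y (M.elt j).carrier

/-- The triangles of `T_h`: the triangle `⟨j, i⟩` has the vertices `ν`, `v i`, `v (i + 1)` of the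
`j`-th element. The same type indexes the edges in `F_p`: the edge `⟨j, i⟩` joins `ν` to `v i` and
lies between the triangles `⟨j, i - 1⟩` and `⟨j, i⟩`. -/
abbrev Tri : Type := Σ j : Fin M.N, Fin ((M.elt j).nv + 3)

/-- The interior point `ν` of the element containing `τ`. -/
def ν (τ : M.Tri) : Plane := (M.elt τ.1).center

/-- The first vertex of the outer edge of `τ`. -/
def va (τ : M.Tri) : Plane := (M.elt τ.1).vert τ.2

/-- The second vertex of the outer edge of `τ`. -/
def vb (τ : M.Tri) : Plane := (M.elt τ.1).vert (τ.2 + 1)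

/-- The triangle preceding `τ` (counterclockwise around `ν`) in the same element. -/
def prev (τ : M.Tri) : M.Tri := ⟨τ.1, τ.2 - 1⟩

/-- The closed triangle. -/
def triangle (τ : M.Tri) : Set Plane := convexHull ℝ {M.ν τ, M.va τ, M.vb τ}

/-- The edge of the primal element that is a side of `τ`. -/
def outerEdge (τ : M.Tri) : Set Plane := segment ℝ (M.va τ) (M.vb τ)

/-- The integral over the triangle `τ`. -/
def triIntegral (τ : M.Tri) (g : Plane → ℝ) : ℝ := ∫ x in M.triangle τ, g x

/-- The integral over the outer edge of `τ`. -/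
def outerIntegral (τ : M.Tri) (g : Plane → ℝ) : ℝ := edgeIntegral (M.va τ) (M.vb τ) g

/-- The unit normal of the outer edge of `τ` pointing out of `τ`. -/
def outerNormal (τ : M.Tri) : Plane := rightNormal (M.va τ) (M.vb τ)

/-- The unit normal of the edge of `F_p` from `ν` to `v i`, pointing from the triangle
`M.prev ⟨j, i⟩` to the triangle `⟨j, i⟩`. -/
def spokeNormal (τ : M.Tri) : Plane := rightNormal (M.va τ) (M.ν τ)

open Classical in
/-- The edges in `F_u⁰` (interior edges of the primal mesh not on `Γ`), each given once as the pair
`(τ₁, τ₂)` of the two triangles having it as an edge. Its normal points from `τ₁` to `τ₂`; the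
choice made here is that it points to the element with the larger number. -/
def interiorEdges : Finset (M.Tri × M.Tri) :=
  Finset.univ.filter fun e => e.1.1 < e.2.1 ∧ M.outerEdge e.1 = M.outerEdge e.2 ∧
    ¬ M.outerEdge e.1 ⊆ G.F.carrier

open Classical in
/-- The edges in `F_h^Γ`, each given once as the pair `(τ₁, τ₂)` of the two triangles having it as
an edge, `τ₁` on the side of `Ω₁` and `τ₂` on the side of `Ω₂`. -/
def fractureEdges : Finset (M.Tri × M.Tri) :=
  Finset.univ.filter fun e => M.outerEdge e.1 = M.outerEdge e.2 ∧
    M.outerEdge e.1 ⊆ G.F.carrier ∧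
    interior (M.elt e.1.1).carrier ⊆ G.Ω₁ ∧ interior (M.elt e.2.1).carrier ⊆ G.Ω₂

/-! ### Broken polynomials, jumps and averages -/

/-- The value of the polynomial `P` at the point `x`. -/
def _root_.FracturedFlow.ev (P : MvPolynomial (Fin 2) ℝ) (x : Plane) : ℝ :=
  MvPolynomial.eval (fun i => x i) P

/-- Piecewise polynomial functions on `T_h`; `q τ` is the polynomial `q|_τ`. -/
abbrev Scalar : Type := M.Tri → MvPolynomial (Fin 2) ℝ

/-- Piecewise polynomial vector fields on `T_h`. -/
abbrev Vector : Type := M.Tri → Fin 2 → MvPolynomial (Fin 2) ℝ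

variable {M}

/-- The value `v|_τ (x)`. -/
def vec (v : M.Vector) (τ : M.Tri) (x : Plane) : Fin 2 → ℝ := fun i => ev (v τ i) x

/-- The value `(v|_τ · n)(x)`. -/
def dotN (v : M.Vector) (τ : M.Tri) (n : Plane) (x : Plane) : ℝ := ∑ i, ev (v τ i) x * n i

/-- The value `(∇ (q|_τ))(x)`. -/
def grad (q : M.Scalar) (τ : M.Tri) (x : Plane) : Fin 2 → ℝ :=
  fun i => ev (MvPolynomial.pderiv i (q τ)) x

/-- The value `(∇ · (v|_τ))(x)`. -/
def dvg (v : M.Vector) (τ : M.Tri) (x : Plane) : ℝ := ∑ i, ev (MvPolynomial.pderiv i (v τ i)) x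

/-- The jump `[q]` across an edge between the triangles `e.1` and `e.2`. -/
def jump (q : M.Scalar) (e : M.Tri × M.Tri) (x : Plane) : ℝ := ev (q e.1) x - ev (q e.2) x

/-- The average `{q}`. -/
def avg (q : M.Scalar) (e : M.Tri × M.Tri) (x : Plane) : ℝ := (ev (q e.1) x + ev (q e.2) x) / 2

/-- The jump `[v · n]` across the common outer edge of `e.1` and `e.2`, with `n` pointing from
`e.1` to `e.2`. -/
def jumpN (v : M.Vector) (e : M.Tri × M.Tri) (x : Plane) : ℝ :=
  dotN v e.1 (M.outerNormal e.1) x - dotN v e.2 (M.outerNormal e.1) x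

/-- The average `{v · n}` on the common outer edge of `e.1` and `e.2`. -/
def avgN (v : M.Vector) (e : M.Tri × M.Tri) (x : Plane) : ℝ :=
  (dotN v e.1 (M.outerNormal e.1) x + dotN v e.2 (M.outerNormal e.1) x) / 2

variable (M)

/-! ### The discrete spaces -/

/-- The pressure space `S_h`. The edges on `∂Ω_B` are the outer edges contained in `∂Ω`. -/
def Sh (k : ℕ) : Set M.Scalar :=
  {q | (∀ τ, (q τ).totalDegree ≤ k) ∧
    (∀ e ∈ M.interiorEdges, ∀ x ∈ M.outerEdge e.1, jump q e x = 0) ∧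
    ∀ τ, M.outerEdge τ ⊆ frontier G.Ω → ∀ x ∈ M.outerEdge τ, ev (q τ) x = 0}

/-- The velocity space `V_h`: `[v · n] = 0` on all edges in `F_p`. -/
def Vh (k : ℕ) : Set M.Vector :=
  {v | (∀ τ i, (v τ i).totalDegree ≤ k) ∧
    ∀ τ, ∀ x ∈ segment ℝ (M.ν τ) (M.va τ),
      dotN v (M.prev τ) (M.spokeNormal τ) x - dotN v τ (M.spokeNormal τ) x = 0}

/-- `φ ∈ H¹₀(0, L)`: `φ` is the primitive on `[0, L]`, vanishing at both end points, of a
square integrable function. -/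
def _root_.FracturedFlow.MemH10 (L : ℝ) (φ : ℝ → ℝ) : Prop :=
  ∃ g : ℝ → ℝ, MemLp g 2 (volume.restrict (Icc 0 L)) ∧
    (∀ s ∈ Icc 0 L, φ s = ∫ r in (0 : ℝ)..s, g r) ∧ φ L = 0

/-- The fracture pressure space `W_h`. Functions on the closed fracture are extended by zero to
the plane, so that equality in `W_h` is equality of functions on the fracture. Membership in
`H¹₀(Γ)` is with respect to arc length. -/
def Wh (k : ℕ) : Set (Plane → ℝ) :=
  {q | (∀ x ∉ G.F.carrier, q x = 0) ∧ MemH10 G.F.len (fun s => q (G.F.γ s)) ∧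
    ∀ e ∈ M.fractureEdges, ∃ P : MvPolynomial (Fin 2) ℝ, P.totalDegree ≤ k ∧
      ∀ x ∈ M.outerEdge e.1, q x = ev P x}

/-- The tangential gradient on `Γ` at the point `γ s`: the derivative with respect to arc length. -/
def _root_.FracturedFlow.Fracture.tgrad (F : Fracture) (q : Plane → ℝ) (s : ℝ) : ℝ :=
  deriv (fun r => q (F.γ r)) s

/-- The integral over `Γ` with respect to arc length, the integrand being given as a function of the
arc length parameter. -/
def _root_.FracturedFlow.Fracture.integral (F : Fracture) (g : ℝ → ℝ) : ℝ :=
  ∫ s in (0 : ℝ)..F.len, g s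

variable {M}

/-! ### The discrete problem -/

/-- The bilinear form `(K⁻¹ u, v)_{Ω_B}`. -/
def mass (c : Coefficients G) (u v : M.Vector) : ℝ :=
  ∑ τ, M.triIntegral τ fun x => ((c.K x)⁻¹ *ᵥ vec u τ x) ⬝ᵥ vec v τ x

/-- The bilinear form `b_h(v, q) = - ∑_{F_p} ⟨v · n, [q]⟩ + ∑_τ (v, ∇ q)_τ`. -/
def bForm (v : M.Vector) (q : M.Scalar) : ℝ :=
  -(∑ τ : M.Tri, edgeIntegral (M.ν τ) (M.va τ) fun x =>
      dotN v τ (M.spokeNormal τ) x * jump q (M.prev τ, τ) x) +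
    ∑ τ, M.triIntegral τ fun x => vec v τ x ⬝ᵥ grad q τ x

/-- The bilinear form `b_h^*(q, v)`; on `e ∈ F_u⁰` the function `q ∈ S_h` is single-valued. -/
def bStarForm (q : M.Scalar) (v : M.Vector) : ℝ :=
  (∑ e ∈ M.interiorEdges, M.outerIntegral e.1 fun x => ev (q e.1) x * jumpN v e x) -
    (∑ τ, M.triIntegral τ fun x => ev (q τ) x * dvg v τ x) +
    (∑ e ∈ M.fractureEdges, M.outerIntegral e.1 fun x => jump q e x * avgN v e x) +
    ∑ e ∈ M.fractureEdges, M.outerIntegral e.1 fun x => avg q e x * jumpN v e x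

/-- `(u, p, pΓ) ∈ V_h × S_h × W_h` solves the coupled discrete system with data `f`, `fΓ`. -/
structure IsSolution (M : Mesh G) (c : Coefficients G) (k : ℕ) (f fΓ : Plane → ℝ)
    (u : M.Vector) (p : M.Scalar) (pΓ : Plane → ℝ) : Prop where
  u_mem : u ∈ M.Vh k
  p_mem : p ∈ M.Sh k
  pΓ_mem : pΓ ∈ M.Wh k
  darcy : ∀ v ∈ M.Vh k, mass c u v + bStarForm p v = 0
  conservation : ∀ q ∈ M.Sh k,
    -bForm u q +
      (∑ e ∈ M.fractureEdges, M.outerIntegral e.1 fun x =>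
        1 / c.α x * (avg p e x - pΓ x) * avg q e x) +
      (∑ e ∈ M.fractureEdges, M.outerIntegral e.1 fun x => 1 / c.η x * jump p e x * jump q e x) =
    ∑ τ, M.triIntegral τ fun x => f x * ev (q τ) x
  fracture : ∀ qΓ ∈ M.Wh k,
    (G.F.integral fun s => c.KΓ (G.F.γ s) * G.F.tgrad pΓ s * G.F.tgrad qΓ s) -
      (∑ e ∈ M.fractureEdges, M.outerIntegral e.1 fun x =>
        1 / c.α x * (avg p e x - pΓ x) * qΓ x) =
    G.F.integral fun s => c.ℓ (G.F.γ s) * fΓ (G.F.γ s) * qΓ (G.F.γ s)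

/-- The left-hand side of the stability estimate:
`‖K^{-1/2} u‖² + ‖p‖² + ∑ ‖η^{-1/2} [p]‖² + ‖K_Γ^{1/2} ∇_t pΓ‖² + ∑ ‖α^{-1/2} ({p} - pΓ)‖²`. -/
def energy (c : Coefficients G) (u : M.Vector) (p : M.Scalar) (pΓ : Plane → ℝ) : ℝ :=
  mass c u u +
    (∑ τ, M.triIntegral τ fun x => ev (p τ) x ^ 2) +
    (∑ e ∈ M.fractureEdges, M.outerIntegral e.1 fun x => (c.η x)⁻¹ * jump p e x ^ 2) +
    (G.F.integral fun s => c.KΓ (G.F.γ s) * G.F.tgrad pΓ s ^ 2) +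
    ∑ e ∈ M.fractureEdges, M.outerIntegral e.1 fun x => (c.α x)⁻¹ * (avg p e x - pΓ x) ^ 2

end Mesh

end FracturedFlow

end

noncomputable section

namespace FracturedFlow

/-! ### Planar linear algebra -/

/-! Adding the three equations, the second with `bForm` replaced by `bStarForm`, gives one bilinear
form (`form`) on `V_h × S_h × W_h`. The replacement is legitimate because the divergence theorem on
every triangle makes the two forms adjoint on `V_h × S_h` (`bForm_eq_bStarForm`). On the diagonal
the coupling terms then cancel, and every term of the energy except `‖p_h‖²` remains. So everything
rests on one discrete Poincaré inequality, bounding `‖p_h‖²` by the remaining terms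
(`exists_poincare`). With it, Young's inequality gives stability, and triviality of the kernel in
finite dimension gives unique solvability.

The inequality has a local half. The Darcy equation tested with a field supported in one element `S`
of diameter `h` bounds `b_h(v, p)²` by the energy of `u` on `S` times `‖v‖²`. Two families of fields
suffice. The field `s (∂_a p) a + t (∂_b p) b`, with barycentric coordinates `s`, `t` and the sides
`a`, `b` at `ν`, is tangential on the spokes and reproduces a weighted Dirichlet form of `p` in
reference coordinates, whatever the shape of the triangle (`sum_refGrad_le`). Piecewise constant
fields with prescribed outer fluxes of total zero control the differences of the edge means of `p`
(`sum_mean_sq_le`). A Poincaré inequality on polynomials over one fixed reference triangle turns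
this into bounds for `p - m`, with `m` a constant on each element, in `L²` of the element and of its
edges (`exists_local_bound`). Assumption (A) enters through the fact that an edge of length `|e|`
has its triangle of height at least `ρ h`, so that twice the area is at least `ρ h |e|`
(`mul_diam_mul_norm_le`). Weighting by areas makes short edges harmless.

The global half uses the position field, whose divergence is `2`. The divergence theorem writes the
`L²` norm of `m` as a sum of edge integrals of `m² x·n`. Replacing `m²` by `p²` costs local terms
and half of the left-hand side. The integrals of `p² x·n` cancel on interior edges and vanish on the
boundary; only `2 [p] {p} x·n` on the fracture survives. Finally `{p}` is controlled by `{p} - p_Γ`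
and by `p_Γ`, which its tangential gradient bounds uniformly. -/

theorem cross_add_left (u v w : Plane) : cross (u + v) w = cross u w + cross v w := by
  simp [cross]; ring

theorem cross_add_right (u v w : Plane) : cross u (v + w) = cross u v + cross u w := by
  simp [cross]; ring

theorem cross_smul_left (r : ℝ) (v w : Plane) : cross (r • v) w = r * cross v w := by
  simp [cross]; ring

theorem cross_smul_right (r : ℝ) (v w : Plane) : cross v (r • w) = r * cross v w := by
  simp [cross]; ring

theorem cross_self (v : Plane) : cross v v = 0 := by simp [cross]; ring

theorem cross_comm (v w : Plane) : cross v w = -cross w v := by simp [cross]; ring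

theorem cross_sub_right (u v w : Plane) : cross u (v - w) = cross u v - cross u w := by
  simp [cross]; ring

theorem cross_sub_left (u v w : Plane) : cross (u - v) w = cross u w - cross v w := by
  simp [cross]; ring

theorem continuous_cross_left (w : Plane) : Continuous fun v => cross v w := by
  unfold cross; fun_prop

theorem continuous_cross_right (v : Plane) : Continuous fun w => cross v w := by
  unfold cross; fun_prop

/-- Cramer's rule; it turns quotients of determinants into barycentric coordinates. -/
theorem cross_smul_eq (a b v : Plane) : cross a b • v = cross v b • a + cross a v • b := by
  ext i; fin_cases i <;> simp [cross] <;> ring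

theorem norm_sq_eq (v : Plane) : ‖v‖ ^ 2 = v 0 ^ 2 + v 1 ^ 2 := by
  simp [EuclideanSpace.norm_sq_eq, Fin.sum_univ_two]

/-! ### Affine parametrization of triangles -/

/-- The closed reference triangle. -/
def refTri : Set (ℝ × ℝ) := {z | 0 ≤ z.1 ∧ 0 ≤ z.2 ∧ z.1 + z.2 ≤ 1}

/-- The affine map sending `(s, t)` to `o + s a + t b`. -/
def aff (o a b : Plane) (z : ℝ × ℝ) : Plane := o + z.1 • a + z.2 • b

theorem continuous_aff (o a b : Plane) : Continuous (aff o a b) := by unfold aff; fun_prop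

theorem isClosed_refTri : IsClosed refTri := by
  unfold refTri
  exact (isClosed_le continuous_const continuous_fst).inter
    ((isClosed_le continuous_const continuous_snd).inter
      (isClosed_le (continuous_fst.add continuous_snd) continuous_const))

theorem isCompact_refTri : IsCompact refTri := by
  apply IsCompact.of_isClosed_subset (isCompact_Icc (a := ((0 : ℝ), (0 : ℝ))) (b := (1, 1)))
    isClosed_refTri
  rintro ⟨s, t⟩ ⟨h1, h2, h3⟩
  simp only at h1 h2 h3
  exact ⟨⟨h1, h2⟩, ⟨by simp only; linarith, by simp only; linarith⟩⟩

theorem measurableSet_refTri : MeasurableSet refTri := isClosed_refTri.measurableSet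

theorem triangle_eq_image (o p q : Plane) :
    convexHull ℝ {o, p, q} = aff o (p - o) (q - o) '' refTri := by
  rw [convexHull_insert (by simp), convexHull_pair]
  ext x
  simp only [convexJoin_singleton_left, mem_iUnion, mem_image, exists_prop]
  constructor
  · rintro ⟨y, ⟨s, t, hs, ht, hst, rfl⟩, c, d, hc, hd, hcd, rfl⟩
    refine ⟨(d * s, d * t), ⟨by simp only; positivity, by simp only; positivity, ?_⟩, ?_⟩
    · simp only; rw [← mul_add, hst]; linarith
    · obtain rfl : c = 1 - d := by linarith
      obtain rfl : s = 1 - t := by linarith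
      ext i; simp [aff]; ring
  · rintro ⟨⟨s, t⟩, ⟨h1, h2, h3⟩, rfl⟩
    simp only at h1 h2 h3
    rcases (add_nonneg h1 h2).eq_or_lt with h | h
    · obtain rfl : s = 0 := by linarith
      obtain rfl : t = 0 := by linarith
      exact ⟨p, left_mem_segment _ _ _, by simpa [aff] using left_mem_segment ℝ o p⟩
    · refine ⟨(s / (s + t)) • p + (t / (s + t)) • q, ⟨_, _, by positivity, by positivity,
        by field_simp, rfl⟩, 1 - (s + t), s + t, by linarith, h.le, by ring, ?_⟩
      ext i; simp [aff]; field_simp; ring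

theorem cross_aff_left (o a b : Plane) (z : ℝ × ℝ) :
    cross (aff o a b z - o) b = z.1 * cross a b := by
  simp [cross, aff]; ring

theorem cross_aff_right (o a b : Plane) (z : ℝ × ℝ) :
    cross a (aff o a b z - o) = z.2 * cross a b := by
  simp [cross, aff]; ring

theorem aff_bary {o a b : Plane} (h : cross a b ≠ 0) (x : Plane) :
    aff o a b (cross (x - o) b / cross a b, cross a (x - o) / cross a b) = x := by
  have h2 : (cross (x - o) b / cross a b) • a + (cross a (x - o) / cross a b) • b = x - o := by
    rw [div_eq_inv_mul, div_eq_inv_mul, ← smul_smul, ← smul_smul, ← smul_add, ← cross_smul_eq,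
      smul_smul, inv_mul_cancel₀ h, one_smul]
  rw [aff, add_assoc, h2, add_sub_cancel]

theorem mem_triangle_iff {o p q : Plane} (h : 0 < cross (p - o) (q - o)) (x : Plane) :
    x ∈ convexHull ℝ {o, p, q} ↔ 0 ≤ cross (x - o) (q - o) ∧ 0 ≤ cross (p - o) (x - o) ∧
      cross (x - o) (q - o) + cross (p - o) (x - o) ≤ cross (p - o) (q - o) := by
  rw [triangle_eq_image]
  constructor
  · rintro ⟨z, ⟨h1, h2, h3⟩, rfl⟩
    rw [cross_aff_left, cross_aff_right]
    refine ⟨by positivity, by positivity, by nlinarith⟩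
  · rintro ⟨h1, h2, h3⟩
    refine ⟨_, ⟨?_, ?_, ?_⟩, aff_bary h.ne' x⟩
    · exact div_nonneg h1 h.le
    · exact div_nonneg h2 h.le
    · simp only; rw [← add_div, div_le_one h]; exact h3

theorem mem_interior_triangle {o p q : Plane} (h : 0 < cross (p - o) (q - o)) {x : Plane}
    (h1 : 0 < cross (x - o) (q - o)) (h2 : 0 < cross (p - o) (x - o))
    (h3 : cross (x - o) (q - o) + cross (p - o) (x - o) < cross (p - o) (q - o)) :
    x ∈ interior (convexHull ℝ {o, p, q}) := by
  rw [mem_interior]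
  refine ⟨{x | 0 < cross (x - o) (q - o) ∧ 0 < cross (p - o) (x - o) ∧
      cross (x - o) (q - o) + cross (p - o) (x - o) < cross (p - o) (q - o)}, ?_, ?_, ⟨h1, h2, h3⟩⟩
  · rintro y ⟨h1, h2, h3⟩
    exact (mem_triangle_iff h y).2 ⟨h1.le, h2.le, h3.le⟩
  · have c1 : Continuous fun x => cross (x - o) (q - o) :=
      (continuous_cross_left _).comp (by fun_prop)
    have c2 : Continuous fun x => cross (p - o) (x - o) :=
      (continuous_cross_right _).comp (by fun_prop)
    exact (isOpen_lt continuous_const c1).inter ((isOpen_lt continuous_const c2).inter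
      (isOpen_lt (c1.add c2) continuous_const))

/-! ### Change of variables on triangles -/

/-- The plane in Cartesian coordinates. -/
def planeEquiv : Plane ≃ᵐ ℝ × ℝ :=
  (MeasurableEquiv.toLp 2 (Fin 2 → ℝ)).symm.trans MeasurableEquiv.finTwoArrow

theorem planeEquiv_apply (x : Plane) : planeEquiv x = (x 0, x 1) := rfl

theorem measurePreserving_planeEquiv : MeasurePreserving planeEquiv volume volume :=
  (volume_preserving_finTwoArrow ℝ).comp (EuclideanSpace.volume_preserving_symm_measurableEquiv_toLp (Fin 2))

/-- The linear map with columns `a` and `b`. -/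
def colMap (a b : Plane) : Plane →L[ℝ] Plane :=
  (EuclideanSpace.proj (0 : Fin 2)).smulRight a + (EuclideanSpace.proj (1 : Fin 2)).smulRight b

theorem colMap_apply (a b x : Plane) : colMap a b x = x 0 • a + x 1 • b := by
  simp [colMap]

theorem det_colMap (a b : Plane) : (colMap a b).det = cross a b := by
  rw [ContinuousLinearMap.det, ← LinearMap.det_toMatrix (EuclideanSpace.basisFun (Fin 2) ℝ).toBasis,
    Matrix.det_fin_two]
  simp [LinearMap.toMatrix_apply, colMap, cross]
  ring

theorem aff_eq_colMap (o a b : Plane) (x : Plane) :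
    aff o a b (planeEquiv x) = o + colMap a b x := by
  rw [planeEquiv_apply, colMap_apply, aff, add_assoc]

theorem aff_injective {o a b : Plane} (h : cross a b ≠ 0) : Function.Injective (aff o a b) := by
  intro z w hzw
  have h1 := cross_aff_left o a b z
  have h2 := cross_aff_right o a b z
  rw [hzw, cross_aff_left] at h1
  rw [hzw, cross_aff_right] at h2
  exact Prod.ext (mul_right_cancel₀ h h1).symm (mul_right_cancel₀ h h2).symm

theorem setIntegral_triangle {o p q : Plane} (h : 0 < cross (p - o) (q - o)) (g : Plane → ℝ) :
    ∫ x in convexHull ℝ {o, p, q}, g x =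
      cross (p - o) (q - o) * ∫ z in refTri, g (aff o (p - o) (q - o) z) := by
  set a := p - o
  set b := q - o
  -- The determinant formula needs a map from the plane to itself, so the Jacobian is taken there;
  -- afterwards the measure preserving `planeEquiv` moves the domain to `ℝ × ℝ`.
  have himg : convexHull ℝ {o, p, q} = (fun x => o + colMap a b x) '' (planeEquiv ⁻¹' refTri) := by
    rw [triangle_eq_image]
    ext x; constructor
    · rintro ⟨z, hz, rfl⟩
      exact ⟨planeEquiv.symm z, by simpa using hz, by simp only [← aff_eq_colMap]; simp [a, b]⟩
    · rintro ⟨z, hz, rfl⟩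
      exact ⟨planeEquiv z, hz, aff_eq_colMap _ _ _ _⟩
  have hinj : InjOn (fun x => o + colMap a b x) (planeEquiv ⁻¹' refTri) := by
    intro x _ y _ hxy
    simp only [← aff_eq_colMap] at hxy
    exact planeEquiv.injective (aff_injective h.ne' hxy)
  rw [himg, integral_image_eq_integral_abs_det_fderiv_smul volume
    (planeEquiv.measurable measurableSet_refTri)
    (fun x _ => ((colMap a b).hasFDerivAt.const_add o).hasFDerivWithinAt) hinj,
    det_colMap, abs_of_pos h]
  simp only [smul_eq_mul]
  rw [integral_const_mul, ← measurePreserving_planeEquiv.setIntegral_preimage_emb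
    planeEquiv.measurableEmbedding]
  simp only [aff_eq_colMap]

theorem integral_refTri (f : ℝ × ℝ → ℝ) (hf : Continuous f) :
    ∫ z in refTri, f z = ∫ t in (0 : ℝ)..1, ∫ s in (0 : ℝ)..(1 - t), f (s, t) := by
  rw [← integral_indicator measurableSet_refTri, Measure.volume_eq_prod, integral_prod_symm]
  · rw [intervalIntegral.integral_of_le zero_le_one, ← integral_Icc_eq_integral_Ioc,
      ← integral_indicator measurableSet_Icc]
    congr 1
    ext t
    by_cases ht : t ∈ Icc (0 : ℝ) 1
    · rw [indicator_of_mem ht, intervalIntegral.integral_of_le (by linarith [ht.2]),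
        ← integral_Icc_eq_integral_Ioc, ← integral_indicator measurableSet_Icc]
      congr 1
      ext s
      by_cases hs : s ∈ Icc 0 (1 - t)
      · rw [indicator_of_mem hs, indicator_of_mem]
        exact ⟨hs.1, ht.1, by simp only; linarith [hs.2]⟩
      · rw [indicator_of_notMem hs, indicator_of_notMem]
        rintro ⟨h1, h2, h3⟩
        exact hs ⟨h1, by simp only at h3; linarith⟩
    · rw [indicator_of_notMem ht]
      have : ∀ s : ℝ, refTri.indicator f (s, t) = 0 := by
        intro s
        rw [indicator_of_notMem]
        rintro ⟨h1, h2, h3⟩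
        simp only at h1 h2 h3
        exact ht ⟨h2, by linarith⟩
      simp [this]
  · rw [← Measure.volume_eq_prod, integrable_indicator_iff measurableSet_refTri]
    exact hf.continuousOn.integrableOn_compact isCompact_refTri

/-- Symmetry of the reference triangle, which reduces derivatives in the second variable to
derivatives in the first. -/
theorem refTri_swap (f : ℝ × ℝ → ℝ) : ∫ z in refTri, f z.swap = ∫ z in refTri, f z := by
  have : refTri = Prod.swap ⁻¹' refTri := by
    ext ⟨s, t⟩; simp only [refTri, mem_ofPred_eq, mem_preimage, Prod.swap, add_comm t s]; tauto
  nth_rewrite 1 [this]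
  exact Measure.measurePreserving_swap.setIntegral_preimage_emb
    MeasurableEquiv.prodComm.measurableEmbedding f refTri

/-! ### The divergence theorem on triangles -/

theorem integral_refTri_deriv_fst {f f' : ℝ × ℝ → ℝ} (hf' : Continuous f')
    (h : ∀ s t, HasDerivAt (fun s => f (s, t)) (f' (s, t)) s) :
    ∫ z in refTri, f' z = ∫ t in (0 : ℝ)..1, (f (1 - t, t) - f (0, t)) := by
  rw [integral_refTri f' hf']
  congr 1
  ext t
  exact intervalIntegral.integral_eq_sub_of_hasDerivAt (fun s _ => h s t)
    ((hf'.comp (by fun_prop : Continuous fun s : ℝ => (s, t))).intervalIntegrable _ _)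

theorem integral_refTri_deriv_snd {f f' : ℝ × ℝ → ℝ} (hf' : Continuous f')
    (h : ∀ s t, HasDerivAt (fun t => f (s, t)) (f' (s, t)) t) :
    ∫ z in refTri, f' z = ∫ t in (0 : ℝ)..1, (f (t, 1 - t) - f (t, 0)) := by
  rw [← refTri_swap]
  exact integral_refTri_deriv_fst (f := fun z => f z.swap) (f' := fun z => f' z.swap)
    (hf'.comp continuous_swap) fun s t => h t s

/-- The flux of the field `(F₀, F₁)` across the segment from `p` to `q`, from left to right. -/
def flux (F₀ F₁ : Plane → ℝ) (p q : Plane) : ℝ :=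
  ∫ t in (0 : ℝ)..1, (F₀ (AffineMap.lineMap p q t) * (q - p) 1 -
    F₁ (AffineMap.lineMap p q t) * (q - p) 0)

/-- The divergence of the field `(F₀, F₁)`. -/
def divField (F₀ F₁ : Plane → ℝ) (x : Plane) : ℝ :=
  fderiv ℝ F₀ x (EuclideanSpace.single 0 1) + fderiv ℝ F₁ x (EuclideanSpace.single 1 1)

theorem plane_eq_single (v : Plane) :
    v = v 0 • EuclideanSpace.single 0 1 + v 1 • EuclideanSpace.single 1 1 := by
  ext i; fin_cases i <;> simp

/-- Piola's identity: `det(a, b) div F = ∂_a det(F, b) + ∂_b det(a, F)`. Each term is a partial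
derivative in reference coordinates, so the divergence theorem reduces to the fundamental theorem of
calculus on slices. -/
theorem cross_mul_divField (F₀ F₁ : Plane → ℝ) (x a b : Plane) :
    cross a b * divField F₀ F₁ x =
      (fderiv ℝ F₀ x a * b 1 - fderiv ℝ F₁ x a * b 0) +
      (a 0 * fderiv ℝ F₁ x b - a 1 * fderiv ℝ F₀ x b) := by
  rw [plane_eq_single a, plane_eq_single b]
  simp only [map_add, map_smul, smul_eq_mul, divField, cross]
  simp
  ring

theorem continuous_flux_integrand {F₀ F₁ : Plane → ℝ} (h₀ : Continuous F₀) (h₁ : Continuous F₁)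
    (p q : Plane) : Continuous fun t : ℝ => (F₀ (AffineMap.lineMap p q t) * (q - p) 1 -
    F₁ (AffineMap.lineMap p q t) * (q - p) 0) := by
  have : Continuous fun t : ℝ => (AffineMap.lineMap p q t : Plane) := by
    simp only [AffineMap.lineMap_apply]; fun_prop
  fun_prop

theorem integral_divField_triangle {F₀ F₁ : Plane → ℝ} (h₀ : ContDiff ℝ 1 F₀)
    (h₁ : ContDiff ℝ 1 F₁) {o p q : Plane} (h : 0 < cross (p - o) (q - o)) :
    ∫ x in convexHull ℝ {o, p, q}, divField F₀ F₁ x =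
      flux F₀ F₁ p q + flux F₀ F₁ o p - flux F₀ F₁ o q := by
  rw [setIntegral_triangle h, ← integral_const_mul]
  have ca := continuous_aff o (p - o) (q - o)
  have c0 := h₀.continuous_fderiv (by norm_num)
  have c1 := h₁.continuous_fderiv (by norm_num)
  have d0 : ∀ x, HasFDerivAt F₀ (fderiv ℝ F₀ x) x :=
    fun x => (h₀.differentiable (by norm_num) x).hasFDerivAt
  have d1 : ∀ x, HasFDerivAt F₁ (fderiv ℝ F₁ x) x :=
    fun x => (h₁.differentiable (by norm_num) x).hasFDerivAt
  have ds : ∀ s t : ℝ, HasDerivAt (fun s => aff o (p - o) (q - o) (s, t)) (p - o) s := by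
    intro s t
    simpa [aff] using (((hasDerivAt_id s).smul_const (p - o)).const_add o).add_const (t • (q - o))
  have dt : ∀ s t : ℝ, HasDerivAt (fun t => aff o (p - o) (q - o) (s, t)) (q - o) t := by
    intro s t
    simpa [aff] using ((hasDerivAt_id t).smul_const (q - o)).const_add (o + s • (p - o))
  simp only [cross_mul_divField]
  rw [integral_add]
  · rw [integral_refTri_deriv_fst (f := fun z => F₀ (aff o (p - o) (q - o) z) * (q - o) 1 -
      F₁ (aff o (p - o) (q - o) z) * (q - o) 0)]
    · rw [integral_refTri_deriv_snd (f := fun z => (p - o) 0 * F₁ (aff o (p - o) (q - o) z) -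
        (p - o) 1 * F₀ (aff o (p - o) (q - o) z))]
      · have e1 : ∀ t : ℝ, aff o (p - o) (q - o) (1 - t, t) = AffineMap.lineMap p q t := by
          intro t; ext i; simp [aff, AffineMap.lineMap_apply]; ring
        have e2 : ∀ t : ℝ, aff o (p - o) (q - o) (0, t) = AffineMap.lineMap o q t := by
          intro t; ext i; simp [aff, AffineMap.lineMap_apply]; ring
        have e3 : ∀ t : ℝ, aff o (p - o) (q - o) (t, 0) = AffineMap.lineMap o p t := by
          intro t; ext i; simp [aff, AffineMap.lineMap_apply]; ring
        have e4 : ∀ t : ℝ, aff o (p - o) (q - o) (t, 1 - t) = AffineMap.lineMap p q (1 - t) := by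
          intro t; rw [← e1]; simp
        simp only [e1, e2, e3, e4]
        have key := continuous_flux_integrand h₀.continuous h₁.continuous
        have cl : ∀ u v : Plane, Continuous fun t : ℝ => (AffineMap.lineMap u v t : Plane) := by
          intro u v; simp only [AffineMap.lineMap_apply]; fun_prop
        have k0 := h₀.continuous
        have k1 := h₁.continuous
        have c3 := cl p q
        have c4 := cl o p
        rw [intervalIntegral.integral_sub, intervalIntegral.integral_sub
          (f := fun t => (p - o) 0 * F₁ (AffineMap.lineMap p q (1 - t)) -
            (p - o) 1 * F₀ (AffineMap.lineMap p q (1 - t))),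
          intervalIntegral.integral_comp_sub_left (fun t => (p - o) 0 * F₁ (AffineMap.lineMap p q t)
            - (p - o) 1 * F₀ (AffineMap.lineMap p q t))]
        · simp only [sub_self, sub_zero, flux]
          -- Both slice integrations leave a term on the side from `p` to `q`. They add up to the
          -- flux through it because `q - p = (q - o) - (p - o)`.
          have : ∀ t : ℝ, F₀ (AffineMap.lineMap p q t) * (q - p) 1 -
              F₁ (AffineMap.lineMap p q t) * (q - p) 0 =
              (F₀ (AffineMap.lineMap p q t) * (q - o) 1 -
              F₁ (AffineMap.lineMap p q t) * (q - o) 0) +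
              ((p - o) 0 * F₁ (AffineMap.lineMap p q t)
                - (p - o) 1 * F₀ (AffineMap.lineMap p q t)) := by
            intro t; simp; ring
          simp only [this]
          rw [intervalIntegral.integral_add]
          · have e5 : ∀ t : ℝ, (p - o) 0 * F₁ (AffineMap.lineMap o p t)
                - (p - o) 1 * F₀ (AffineMap.lineMap o p t) =
                - (F₀ (AffineMap.lineMap o p t) * (p - o) 1 -
                F₁ (AffineMap.lineMap o p t) * (p - o) 0) := by intro t; ring
            simp only [e5, intervalIntegral.integral_neg]
            ring
          · apply Continuous.intervalIntegrable; fun_prop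
          · apply Continuous.intervalIntegrable; fun_prop
        · apply Continuous.intervalIntegrable
          have : Continuous fun t : ℝ => (AffineMap.lineMap p q (1 - t) : Plane) :=
            c3.comp (by fun_prop)
          fun_prop
        · apply Continuous.intervalIntegrable; fun_prop
        · apply Continuous.intervalIntegrable; fun_prop
        · exact (key o q).intervalIntegrable _ _
      · fun_prop
      · intro s t
        have a0 := (d0 (aff o (p - o) (q - o) (s, t))).comp_hasDerivAt t (dt s t)
        have a1 := (d1 (aff o (p - o) (q - o) (s, t))).comp_hasDerivAt t (dt s t)
        exact (a1.const_mul _).sub (a0.const_mul _)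
    · fun_prop
    · intro s t
      have a0 := (d0 (aff o (p - o) (q - o) (s, t))).comp_hasDerivAt s (ds s t)
      have a1 := (d1 (aff o (p - o) (q - o) (s, t))).comp_hasDerivAt s (ds s t)
      exact (a0.mul_const _).sub (a1.mul_const _)
  · apply ContinuousOn.integrableOn_compact isCompact_refTri
    apply Continuous.continuousOn; fun_prop
  · apply ContinuousOn.integrableOn_compact isCompact_refTri
    apply Continuous.continuousOn; fun_prop

/-! ### Segments -/

theorem eq_or_swap_of_segment_eq {E : Type*} [AddCommGroup E] [Module ℝ E] {a b c d : E}
    (h : segment ℝ a b = segment ℝ c d) : (a = c ∧ b = d) ∨ (a = d ∧ b = c) := by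
  by_cases hcd : c = d
  · subst hcd
    rw [segment_same] at h
    have ha : a ∈ ({c} : Set E) := h ▸ left_mem_segment ℝ a b
    have hb : b ∈ ({c} : Set E) := h ▸ right_mem_segment ℝ a b
    exact Or.inl ⟨ha, hb⟩
  have ha : a ∈ segment ℝ c d := h ▸ left_mem_segment ℝ a b
  have hb : b ∈ segment ℝ c d := h ▸ right_mem_segment ℝ a b
  have hc : c ∈ segment ℝ a b := h ▸ left_mem_segment ℝ c d
  have hd : d ∈ segment ℝ a b := h ▸ right_mem_segment ℝ c d
  rw [segment_eq_image_lineMap] at ha hb hc hd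
  obtain ⟨α, ⟨α0, α1⟩, rfl⟩ := ha
  obtain ⟨β, ⟨β0, β1⟩, rfl⟩ := hb
  obtain ⟨u, ⟨u0, u1⟩, hu⟩ := hc
  obtain ⟨v, ⟨v0, v1⟩, hv⟩ := hd
  have inj := AffineMap.lineMap_injective ℝ hcd
  -- Measured along the segment from `c` to `d`, the numbers `0` and `1` both lie between `α` and
  -- `β`, which themselves lie in `[0, 1]`; hence `α` and `β` are `0` and `1` in some order.
  have hu' : α + u * (β - α) = 0 := by
    apply inj
    rw [AffineMap.lineMap_apply_zero]
    refine Eq.trans ?_ hu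
    simp only [AffineMap.lineMap_apply_module]
    module
  have hv' : α + v * (β - α) = 1 := by
    apply inj
    rw [AffineMap.lineMap_apply_one]
    refine Eq.trans ?_ hv
    simp only [AffineMap.lineMap_apply_module]
    module
  rcases le_total α β with hab | hab
  · left
    have : α = 0 := by nlinarith
    have : β = 1 := by nlinarith
    subst_vars; simp
  · right
    have : β = 0 := by nlinarith
    have : α = 1 := by nlinarith
    subst_vars; simp

/-! ### Primal elements -/

namespace PrimalElement

variable (S : PrimalElement)

/-- The triangle of `S` with outer edge number `i`. -/
def tri (i : Fin (S.nv + 3)) : Set Plane := convexHull ℝ {S.center, S.vert i, S.vert (i + 1)}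

theorem isCompact_tri (i : Fin (S.nv + 3)) : IsCompact (S.tri i) :=
  (Set.toFinite _).isCompact_convexHull (𝕜 := ℝ)

theorem isCompact_carrier : IsCompact S.carrier := isCompact_iUnion S.isCompact_tri

theorem tri_subset_carrier (i : Fin (S.nv + 3)) : S.tri i ⊆ S.carrier := subset_iUnion S.tri i

theorem center_mem_tri (i : Fin (S.nv + 3)) : S.center ∈ S.tri i :=
  subset_convexHull ℝ _ (by simp)

theorem edge_subset_tri (i : Fin (S.nv + 3)) :
    segment ℝ (S.vert i) (S.vert (i + 1)) ⊆ S.tri i :=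
  (convex_convexHull ℝ _).segment_subset (subset_convexHull ℝ _ (by simp))
    (subset_convexHull ℝ _ (by simp))

theorem interior_tri_nonempty (i : Fin (S.nv + 3)) : (interior (S.tri i)).Nonempty := by
  have h := S.pos i
  set J := cross (S.vert i - S.center) (S.vert (i + 1) - S.center)
  refine ⟨aff S.center (S.vert i - S.center) (S.vert (i + 1) - S.center) (1 / 3, 1 / 3),
    mem_interior_triangle h ?_ ?_ ?_⟩
  all_goals
    try rw [cross_aff_left]
    try rw [cross_aff_right]
    simp only
    linarith

theorem tri_subset_closure_interior (i : Fin (S.nv + 3)) :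
    S.tri i ⊆ closure (interior (S.tri i)) := by
  have hc : Convex ℝ (S.tri i) := convex_convexHull ℝ _
  rw [hc.closure_interior_eq_closure_of_nonempty_interior (S.interior_tri_nonempty i)]
  exact subset_closure

theorem carrier_subset_closure_interior : S.carrier ⊆ closure (interior S.carrier) := by
  intro x hx
  obtain ⟨i, hi⟩ := mem_iUnion.1 hx
  exact closure_mono (interior_mono (S.tri_subset_carrier i)) (S.tri_subset_closure_interior i hi)

/-- The open cone with apex at the centre that is spanned by the edge number `i`. -/
def cone (i : Fin (S.nv + 3)) : Set Plane :=
  {x | 0 < cross (x - S.center) (S.vert (i + 1) - S.center) ∧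
    0 < cross (S.vert i - S.center) (x - S.center)}

theorem isOpen_cone (i : Fin (S.nv + 3)) : IsOpen (S.cone i) := by
  have c1 : Continuous fun x => cross (x - S.center) (S.vert (i + 1) - S.center) :=
    (continuous_cross_left _).comp (continuous_id.sub continuous_const)
  have c2 : Continuous fun x => cross (S.vert i - S.center) (x - S.center) :=
    (continuous_cross_right _).comp (continuous_id.sub continuous_const)
  exact (isOpen_lt continuous_const c1).inter (isOpen_lt continuous_const c2)

/-- The fan condition separates triangles only; shrinking towards the centre extends it to cones. An
interior point of triangle `i'` in cone `i` stays interior to triangle `i'` under shrinking and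
finally enters the interior of triangle `i`. -/
theorem notMem_tri_of_mem_cone {i i' : Fin (S.nv + 3)} (h : i ≠ i') {x : Plane}
    (hx : x ∈ S.cone i) : x ∉ S.tri i' := by
  intro hx'
  obtain ⟨y, ⟨hy1, hy2⟩, hy'⟩ := mem_closure_iff.1 (S.tri_subset_closure_interior i' hx') _
    (S.isOpen_cone i) hx
  have hJ := S.pos i
  set J := cross (S.vert i - S.center) (S.vert (i + 1) - S.center)
  set A := cross (y - S.center) (S.vert (i + 1) - S.center)
  set B := cross (S.vert i - S.center) (y - S.center)
  -- The factor must push the third barycentric inequality below `J` and stay below `1` to remain in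
  -- an open segment.
  obtain ⟨s, hs0, hs1, hs⟩ : ∃ s : ℝ, 0 < s ∧ s < 1 ∧ s * (A + B) < J := by
    refine ⟨min (1 / 2) (J / (2 * (A + B))), by positivity, by
      linarith [min_le_left (1 / 2) (J / (2 * (A + B)))], ?_⟩
    calc min (1 / 2) (J / (2 * (A + B))) * (A + B) ≤ J / (2 * (A + B)) * (A + B) := by
          gcongr; exact min_le_right _ _
      _ = J / 2 := by field_simp
      _ < J := by linarith
  have hz : S.center + s • (y - S.center) ∈ interior (S.tri i') := by
    apply (convex_convexHull ℝ _).openSegment_self_interior_subset_interior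
      (S.center_mem_tri i') hy'
    exact ⟨1 - s, s, by linarith, hs0, by ring, by module⟩
  have hz' : S.center + s • (y - S.center) ∈ interior (S.tri i) := by
    apply mem_interior_triangle hJ
    · rw [add_sub_cancel_left, cross_smul_left]; positivity
    · rw [add_sub_cancel_left, cross_smul_right]; positivity
    · rw [add_sub_cancel_left, cross_smul_right, cross_smul_left, ← mul_add]; exact hs
  exact disjoint_left.1 (S.fan h) hz' hz

theorem vert_ne (i : Fin (S.nv + 3)) : S.vert i ≠ S.vert (i + 1) := by
  intro h
  have := S.pos i
  rw [h, cross_self] at this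
  exact lt_irrefl _ this

theorem mem_cone_of_mem_openSegment {i : Fin (S.nv + 3)} {x : Plane}
    (hx : x ∈ openSegment ℝ (S.vert i) (S.vert (i + 1))) : x ∈ S.cone i := by
  obtain ⟨u, v, hu, hv, huv, rfl⟩ := hx
  have hJ := S.pos i
  have e : u • S.vert i + v • S.vert (i + 1) - S.center =
      u • (S.vert i - S.center) + v • (S.vert (i + 1) - S.center) := by
    obtain rfl : u = 1 - v := by linarith
    module
  constructor
  · rw [e, cross_add_left, cross_smul_left, cross_smul_left, cross_self]
    simp only [mul_zero, add_zero]; positivity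
  · rw [e, cross_add_right, cross_smul_right, cross_smul_right, cross_self]
    simp only [mul_zero, zero_add]; positivity

theorem cross_edge_of_mem_segment {i : Fin (S.nv + 3)} {x : Plane}
    (hx : x ∈ segment ℝ (S.vert i) (S.vert (i + 1))) :
    cross (x - S.center) (S.vert (i + 1) - S.center) +
      cross (S.vert i - S.center) (x - S.center) =
      cross (S.vert i - S.center) (S.vert (i + 1) - S.center) := by
  obtain ⟨u, v, hu, hv, huv, rfl⟩ := hx
  obtain rfl : u = 1 - v := by linarith
  simp [cross]; ring

/-- Moving the point slightly outwards from the centre keeps it in cone `i`, hence outside all other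
triangles, while it leaves triangle `i` through the outer edge. -/
theorem notMem_interior_of_mem_openSegment {i : Fin (S.nv + 3)} {x : Plane}
    (hx : x ∈ openSegment ℝ (S.vert i) (S.vert (i + 1))) : x ∉ interior S.carrier := by
  intro hx'
  obtain ⟨hx1, hx2⟩ := S.mem_cone_of_mem_openSegment hx
  have hJ := S.pos i
  have hsum := S.cross_edge_of_mem_segment (openSegment_subset_segment _ _ _ hx)
  have hc : Filter.Tendsto (fun s : ℝ => S.center + s • (x - S.center))
      (nhdsWithin 1 (Ioi 1)) (nhds x) := by
    have : Continuous fun s : ℝ => S.center + s • (x - S.center) := by fun_prop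
    have h2 := this.tendsto 1
    simp only [one_smul, add_sub_cancel] at h2
    exact h2.mono_left nhdsWithin_le_nhds
  obtain ⟨s, hs, hs1⟩ : ∃ s : ℝ, S.center + s • (x - S.center) ∈ interior S.carrier ∧ 1 < s :=
    ((hc.eventually (isOpen_interior.mem_nhds hx')).and
    self_mem_nhdsWithin).exists
  have hs0 : 0 < s := by linarith
  obtain ⟨i', hi'⟩ := mem_iUnion.1 (interior_subset hs)
  have hcone : S.center + s • (x - S.center) ∈ S.cone i := by
    constructor
    · rw [add_sub_cancel_left, cross_smul_left]; positivity
    · rw [add_sub_cancel_left, cross_smul_right]; positivity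
  by_cases h : i = i'
  · subst h
    obtain ⟨-, -, h3⟩ := (mem_triangle_iff hJ _).1 hi'
    rw [add_sub_cancel_left, cross_smul_right, cross_smul_left, ← mul_add, hsum] at h3
    nlinarith
  · exact S.notMem_tri_of_mem_cone h hcone hi'

/-- `S` is star-shaped with respect to the closed ball of radius `r` around the centre. -/
def StarBall (r : ℝ) : Prop :=
  ∀ y ∈ Metric.closedBall S.center r, StarConvex ℝ y S.carrier

variable {S}

/-- With `w` and `θ` fixed, letting `y` run through the open ball sweeps out a whole neighbourhood
inside the element. -/
theorem StarBall.mem_interior {r : ℝ} (hS : S.StarBall r) {y w : Plane}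
    (hy : y ∈ Metric.ball S.center r) (hw : w ∈ S.carrier) {θ : ℝ} (h0 : 0 < θ) (h1 : θ ≤ 1) :
    θ • y + (1 - θ) • w ∈ interior S.carrier := by
  have hopen : IsOpen ((fun z => θ⁻¹ • (z - (1 - θ) • w)) ⁻¹' Metric.ball S.center r) :=
    Metric.isOpen_ball.preimage (by fun_prop)
  rw [_root_.mem_interior]
  refine ⟨_, ?_, hopen, ?_⟩
  · intro z hz
    have := hS _ (Metric.ball_subset_closedBall hz) hw h0.le (by linarith : 0 ≤ 1 - θ) (by ring)
    rw [smul_smul, mul_inv_cancel₀ h0.ne', one_smul, sub_add_cancel] at this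
    exact this
  · simp only [mem_preimage, add_sub_cancel_right, smul_smul, inv_mul_cancel₀ h0.ne', one_smul]
    exact hy

/-- Every point lies on a segment from the centre to an outer edge, and all of that segment except
its outer end is interior. So the topological boundary lies on the edges. -/
theorem StarBall.mem_interior_or_mem_edge {r : ℝ} (hr : 0 < r) (hS : S.StarBall r) {x : Plane}
    (hx : x ∈ S.carrier) :
    x ∈ interior S.carrier ∨ ∃ i, x ∈ segment ℝ (S.vert i) (S.vert (i + 1)) := by
  obtain ⟨i, hi⟩ := mem_iUnion.1 hx
  rw [convexHull_insert (by simp), convexHull_pair, convexJoin_singleton_left] at hi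
  simp only [mem_iUnion, exists_prop] at hi
  obtain ⟨w, hw, c, d, hc, hd, hcd, rfl⟩ := hi
  rcases hc.eq_or_lt with rfl | hc
  · right
    obtain rfl : d = 1 := by linarith
    exact ⟨i, by simpa using hw⟩
  · left
    obtain rfl : d = 1 - c := by linarith
    exact hS.mem_interior (Metric.mem_ball_self hr)
      (S.tri_subset_carrier i (S.edge_subset_tri i hw)) hc (by linarith)

theorem StarBall.starConvex_interior {r : ℝ} (hr : 0 < r) (hS : S.StarBall r) :
    StarConvex ℝ S.center (interior S.carrier) := by
  intro w hw c d hc hd hcd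
  rcases hc.eq_or_lt with rfl | hc
  · obtain rfl : d = 1 := by linarith
    simpa using hw
  · obtain rfl : d = 1 - c := by linarith
    exact hS.mem_interior (Metric.mem_ball_self hr) (interior_subset hw) hc (by linarith)

theorem StarBall.isPreconnected_interior {r : ℝ} (hr : 0 < r) (hS : S.StarBall r) :
    IsPreconnected (interior S.carrier) := by
  apply IsConnected.isPreconnected
  apply IsPathConnected.isConnected
  apply (hS.starConvex_interior hr).isPathConnected
  apply (hS.starConvex_interior hr).mem
  exact (S.interior_tri_nonempty 0).mono (interior_mono (S.tri_subset_carrier 0))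

theorem cross_rightNormal {a b : Plane} (h : a ≠ b) :
    cross (rightNormal a b) (b - a) = ‖b - a‖ := by
  have h1 : ‖b - a‖ ≠ 0 := norm_ne_zero_iff.2 (sub_ne_zero.2 h.symm)
  have h2 := norm_sq_eq (b - a)
  rw [rightNormal, cross_smul_left]
  simp only [cross] at h2 ⊢
  simp only [Matrix.cons_val_zero, Matrix.cons_val_one]
  field_simp
  rw [h2]
  ring

theorem norm_rightNormal {a b : Plane} (h : a ≠ b) : ‖rightNormal a b‖ = 1 := by
  have h1 : ‖b - a‖ ≠ 0 := norm_ne_zero_iff.2 (sub_ne_zero.2 h.symm)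
  have h2 := norm_sq_eq (b - a)
  have : ‖rightNormal a b‖ ^ 2 = 1 := by
    rw [norm_sq_eq]
    simp [rightNormal] at h2 ⊢
    field_simp
    rw [h2]; ring
  nlinarith [norm_nonneg (rightNormal a b)]

/-- The centre has distance at least `r` from the line of every edge, and that distance is `J / ‖b -
a‖`. Otherwise the ball contains a point `y` strictly beyond the edge. The midpoint `x` of the edge
then lies strictly between `y` and a point of the triangle, so it would be interior to the element.
-/
theorem StarBall.mul_norm_edge_le {r : ℝ} (hS : S.StarBall r)
    (i : Fin (S.nv + 3)) : r * ‖S.vert (i + 1) - S.vert i‖ ≤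
      cross (S.vert i - S.center) (S.vert (i + 1) - S.center) := by
  by_contra! hlt
  have hJ := S.pos i
  set a := S.vert i
  set b := S.vert (i + 1)
  set J := cross (a - S.center) (b - S.center)
  have hab : a ≠ b := S.vert_ne i
  have hL : 0 < ‖b - a‖ := norm_pos_iff.2 (sub_ne_zero.2 hab.symm)
  -- The distance `q` exceeds the height of the triangle, so `y` is beyond the edge, and is below
  -- `r`, so `y` stays in the ball.
  obtain ⟨q, hq1, hq2⟩ : ∃ q, J / ‖b - a‖ < q ∧ q < r := exists_between (by rwa [div_lt_iff₀ hL])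
  have hq0 : 0 < q := (by positivity : 0 < J / ‖b - a‖).trans hq1
  rw [div_lt_iff₀ hL] at hq1
  set y := S.center + q • rightNormal a b with hy
  have hyball : y ∈ Metric.ball S.center r := by
    simp [hy, norm_smul, norm_rightNormal hab, abs_of_pos hq0, hq2]
  set x := (1 / 2 : ℝ) • a + (1 / 2 : ℝ) • b with hxdef
  have hx : x ∈ openSegment ℝ a b := ⟨1 / 2, 1 / 2, by norm_num, by norm_num, by norm_num, rfl⟩
  obtain ⟨hx1, hx2⟩ := S.mem_cone_of_mem_openSegment hx
  have hsum : cross (x - S.center) (b - S.center) + cross (a - S.center) (x - S.center) = J :=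
    S.cross_edge_of_mem_segment (openSegment_subset_segment _ _ _ hx)
  have hsum' : ∀ z, cross (z - S.center) (b - S.center) + cross (a - S.center) (z - S.center) =
      cross (z - S.center) (b - a) := by intro z; simp [cross]; ring
  have hc : Filter.Tendsto (fun δ : ℝ => x + δ • (x - y)) (nhdsWithin 0 (Ioi 0)) (nhds x) := by
    have : Continuous fun δ : ℝ => x + δ • (x - y) := by fun_prop
    have h2 := this.tendsto 0
    simp only [zero_smul, add_zero] at h2
    exact h2.mono_left nhdsWithin_le_nhds
  obtain ⟨δ, hδ, hδ0⟩ : ∃ δ : ℝ, x + δ • (x - y) ∈ S.cone i ∧ 0 < δ :=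
    ((hc.eventually ((S.isOpen_cone i).mem_nhds ⟨hx1, hx2⟩)).and
    self_mem_nhdsWithin).exists
  have hw : x + δ • (x - y) ∈ S.tri i := by
    refine (mem_triangle_iff hJ _).2 ⟨hδ.1.le, hδ.2.le, ?_⟩
    change cross (x + δ • (x - y) - S.center) (b - S.center) +
      cross (a - S.center) (x + δ • (x - y) - S.center) ≤ J
    have e : x + δ • (x - y) - S.center =
      (1 + δ) • (x - S.center) - (δ * q) • rightNormal a b := by rw [hy]; module
    rw [hsum', e, cross_sub_left, cross_smul_left, cross_smul_left, cross_rightNormal hab,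
      ← hsum', hsum]
    nlinarith
  have h1δ : 0 < 1 + δ := by linarith
  apply S.notMem_interior_of_mem_openSegment hx
  -- The weight comes from `(1 + δ) x = δ y + (x + δ (x - y))`.
  have := hS.mem_interior hyball (S.tri_subset_carrier i hw) (θ := δ / (1 + δ)) (by positivity)
    (by rw [div_le_one h1δ]; linarith)
  convert this using 1
  have e : 1 - δ / (1 + δ) = 1 / (1 + δ) := by field_simp; ring
  rw [e]
  have : x = (1 / (1 + δ)) • ((1 + δ) • x) := by
    rw [smul_smul]; field_simp; simp
  nth_rewrite 1 [this]
  rw [div_eq_mul_one_div δ, mul_comm δ, ← smul_smul, ← smul_add]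
  congr 1
  module

theorem diam_pos (S : PrimalElement) : 0 < Metric.diam S.carrier := by
  have h := Metric.dist_le_diam_of_mem S.isCompact_carrier.isBounded
    (S.tri_subset_carrier 0 (S.edge_subset_tri 0 (left_mem_segment _ _ _)))
    (S.tri_subset_carrier 0 (S.edge_subset_tri 0 (right_mem_segment _ _ _)))
  exact (dist_pos.2 (S.vert_ne 0)).trans_le h

end PrimalElement

/-! ### Incidence of edges, elements and bulk subdomains. -/

theorem Fracture.carrier_diff_subset (F : Fracture) :
    F.carrier \ F.relInterior ⊆ {F.γ 0, F.γ F.len} := by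
  rintro _ ⟨⟨s, hs, rfl⟩, h⟩
  rcases hs.1.eq_or_lt with rfl | h0
  · simp
  rcases hs.2.eq_or_lt with rfl | h1
  · simp
  exact absurd ⟨s, ⟨h0, h1⟩, rfl⟩ h

theorem Geometry.isOpen_Ω (G : Geometry) : IsOpen G.Ω := G.regular ▸ isOpen_interior

namespace Mesh

variable {G : Geometry} (M : Mesh G)

/-- All elements of the mesh are star-shaped with respect to balls around their centres. -/
def IsStar : Prop := ∀ j, ∃ r, 0 < r ∧ (M.elt j).StarBall r

variable {M}

theorem AssumptionA.isStar {ρ : ℝ} (hρ : 0 < ρ) (h : M.AssumptionA ρ) : M.IsStar := by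
  intro j
  obtain ⟨r, hr, hs⟩ := h j
  exact ⟨r, (mul_pos hρ (M.elt j).diam_pos).trans_le hr, hs⟩

theorem AssumptionA.mul_diam_mul_norm_le {ρ : ℝ} (h : M.AssumptionA ρ) (τ : M.Tri) :
    ρ * Metric.diam (M.elt τ.1).carrier * ‖M.vb τ - M.va τ‖ ≤
      cross (M.va τ - M.ν τ) (M.vb τ - M.ν τ) := by
  obtain ⟨r, hr, hs⟩ := h τ.1
  have : (M.elt τ.1).StarBall r := hs
  exact (mul_le_mul_of_nonneg_right hr (norm_nonneg _)).trans (this.mul_norm_edge_le τ.2)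

theorem cross_pos (τ : M.Tri) : 0 < cross (M.va τ - M.ν τ) (M.vb τ - M.ν τ) :=
  (M.elt τ.1).pos τ.2

theorem va_ne_vb (τ : M.Tri) : M.va τ ≠ M.vb τ := (M.elt τ.1).vert_ne τ.2

theorem triangle_subset_carrier (τ : M.Tri) : M.triangle τ ⊆ (M.elt τ.1).carrier :=
  (M.elt τ.1).tri_subset_carrier τ.2

theorem outerEdge_subset_triangle (τ : M.Tri) : M.outerEdge τ ⊆ M.triangle τ :=
  (M.elt τ.1).edge_subset_tri τ.2

theorem outerEdge_subset_carrier (τ : M.Tri) : M.outerEdge τ ⊆ (M.elt τ.1).carrier :=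
  (outerEdge_subset_triangle τ).trans (triangle_subset_carrier τ)

theorem carrier_subset_closure (j : Fin M.N) : (M.elt j).carrier ⊆ closure G.Ω := by
  rw [← M.cover]; exact subset_iUnion (fun j => (M.elt j).carrier) j

theorem triangle_subset_closure (τ : M.Tri) : M.triangle τ ⊆ closure G.Ω :=
  (triangle_subset_carrier τ).trans (carrier_subset_closure _)

theorem interior_carrier_subset (j : Fin M.N) : interior (M.elt j).carrier ⊆ G.Ω := by
  have h := interior_mono (carrier_subset_closure (M := M) j)
  rwa [G.regular] at h

/-- The outer edge without its end points. -/
def openEdge (M : Mesh G) (τ : M.Tri) : Set Plane := openSegment ℝ (M.va τ) (M.vb τ)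

theorem openEdge_subset (τ : M.Tri) : M.openEdge τ ⊆ M.outerEdge τ :=
  openSegment_subset_segment _ _ _

theorem outerEdge_subset_closure_openEdge (τ : M.Tri) :
    M.outerEdge τ ⊆ closure (M.openEdge τ) := segment_subset_closure_openSegment

theorem openEdge_infinite (τ : M.Tri) : (M.openEdge τ).Infinite := by
  rw [openEdge, openSegment_eq_image_lineMap]
  exact (Ioo_infinite zero_lt_one).image (AffineMap.lineMap_injective ℝ (va_ne_vb τ)).injOn

theorem ne_of_mem_openEdge {τ : M.Tri} {x : Plane} (hx : x ∈ M.openEdge τ) :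
    x ≠ M.va τ ∧ x ≠ M.vb τ := by
  constructor
  · rintro rfl; exact va_ne_vb τ (left_mem_openSegment_iff.1 hx)
  · rintro rfl; exact va_ne_vb τ (right_mem_openSegment_iff.1 hx)

/-- An element is the closure of its interior, so disjointness of interiors keeps the interior of
one element away from all of another. -/
theorem eq_of_mem_interior {j j' : Fin M.N} {x : Plane} (hx : x ∈ (M.elt j).carrier)
    (hx' : x ∈ interior (M.elt j').carrier) : j = j' := by
  by_contra h
  obtain ⟨y, hy, hy'⟩ := mem_closure_iff.1 ((M.elt j).carrier_subset_closure_interior hx) _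
    isOpen_interior hx'
  exact disjoint_left.1 (M.disjoint h) hy' hy

theorem notMem_interior_of_mem_openEdge {τ : M.Tri} {x : Plane} (hx : x ∈ M.openEdge τ)
    (j : Fin M.N) : x ∉ interior (M.elt j).carrier := by
  intro h
  obtain rfl := eq_of_mem_interior (outerEdge_subset_carrier τ (openEdge_subset τ hx)) h
  exact (M.elt τ.1).notMem_interior_of_mem_openSegment hx h

theorem notMem_interior_of_mem_outerEdge {τ : M.Tri} {x : Plane} (hx : x ∈ M.outerEdge τ)
    (j : Fin M.N) : x ∉ interior (M.elt j).carrier := by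
  intro h
  obtain ⟨y, hy, hy'⟩ := mem_closure_iff.1 (outerEdge_subset_closure_openEdge τ hx) _
    isOpen_interior h
  exact notMem_interior_of_mem_openEdge hy' j hy

/-- The point is interior to no element, so in the element `j` it lies on some edge. Conformity
makes that edge equal to the given one, because the point is not an end point. -/
theorem exists_outerEdge_of_mem_openEdge (hM : M.IsStar) {τ : M.Tri} {x : Plane}
    (hx : x ∈ M.openEdge τ) {j : Fin M.N} (hj : x ∈ (M.elt j).carrier) :
    ∃ τ' : M.Tri, τ'.1 = j ∧ M.outerEdge τ' = M.outerEdge τ := by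
  obtain ⟨r, hr, hs⟩ := hM j
  rcases hs.mem_interior_or_mem_edge hr hj with h | ⟨i, hi⟩
  · exact absurd h (notMem_interior_of_mem_openEdge hx j)
  · refine ⟨⟨j, i⟩, rfl, ?_⟩
    rcases M.conforming j τ.1 i τ.2 with h | h
    · exact h
    · have := (h ⟨hi, openEdge_subset τ hx⟩).2
      rcases this with h | h
      · exact absurd h (ne_of_mem_openEdge hx).1
      · exact absurd h (ne_of_mem_openEdge hx).2

theorem disjoint_interior_triangle {τ τ' : M.Tri} (h : τ ≠ τ') :
    Disjoint (interior (M.triangle τ)) (interior (M.triangle τ')) := by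
  obtain ⟨j, i⟩ := τ
  obtain ⟨j', i'⟩ := τ'
  by_cases hj : j = j'
  · subst hj
    exact (M.elt j).fan fun hi => h (Sigma.ext rfl (heq_of_eq hi))
  · exact (M.disjoint hj).mono (interior_mono (triangle_subset_carrier _))
      (interior_mono (triangle_subset_carrier _))

/-- Triangles are oriented counterclockwise, so two with the same oriented outer edge would lie on
the same side of it and overlap near its midpoint. A shared edge is therefore traversed in opposite
directions, and no third triangle can share it. -/
theorem va_ne_of_same_direction {τ τ' : M.Tri} (h : τ ≠ τ') :
    ¬ (M.va τ' = M.va τ ∧ M.vb τ' = M.vb τ) := by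
  rintro ⟨h1, h2⟩
  set x := (1 / 2 : ℝ) • M.va τ + (1 / 2 : ℝ) • M.vb τ with hxdef
  have hx : x ∈ M.openEdge τ := ⟨1 / 2, 1 / 2, by norm_num, by norm_num, by norm_num, rfl⟩
  have hx' : x ∈ M.openEdge τ' := by rw [openEdge, h1, h2]; exact hx
  have key : ∀ σ : M.Tri, M.va σ = M.va τ → M.vb σ = M.vb τ →
      ∀ᶠ δ : ℝ in nhdsWithin 0 (Ioi 0), x + δ • (M.ν τ - x) ∈ interior (M.triangle σ) := by
    intro σ ha hb
    have hxσ : x ∈ openSegment ℝ (M.va σ) (M.vb σ) := by rw [ha, hb]; exact hx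
    have hc : Filter.Tendsto (fun δ : ℝ => x + δ • (M.ν τ - x)) (nhdsWithin 0 (Ioi 0))
        (nhds x) := by
      have : Continuous fun δ : ℝ => x + δ • (M.ν τ - x) := by fun_prop
      have h2 := this.tendsto 0
      simp only [zero_smul, add_zero] at h2
      exact h2.mono_left nhdsWithin_le_nhds
    filter_upwards [hc.eventually (((M.elt σ.1).isOpen_cone σ.2).mem_nhds
      ((M.elt σ.1).mem_cone_of_mem_openSegment hxσ)), self_mem_nhdsWithin] with δ hδ hδ0
    have hδ0' : 0 < δ := hδ0
    apply mem_interior_triangle (cross_pos σ) hδ.1 hδ.2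
    have hp := cross_pos τ
    -- On a fixed oriented edge the third barycentric expression decreases by `δ` times the Jacobian
    -- of `τ`, whatever the apex of `σ`.
    have e : cross (x + δ • (M.ν τ - x) - M.ν σ) (M.vb σ - M.ν σ) +
        cross (M.va σ - M.ν σ) (x + δ • (M.ν τ - x) - M.ν σ) =
        cross (M.va σ - M.ν σ) (M.vb σ - M.ν σ) -
        δ * cross (M.va τ - M.ν τ) (M.vb τ - M.ν τ) := by
      rw [ha, hb, hxdef]; simp [cross]; ring
    rw [e]
    nlinarith
  obtain ⟨δ, hδ1, hδ2⟩ := ((key τ rfl rfl).and (key τ' h1 h2)).exists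
  exact disjoint_left.1 (disjoint_interior_triangle h) hδ1 hδ2

theorem reversed_of_outerEdge_eq {τ τ' : M.Tri} (hne : τ ≠ τ')
    (h : M.outerEdge τ' = M.outerEdge τ) : M.va τ' = M.vb τ ∧ M.vb τ' = M.va τ := by
  rcases eq_or_swap_of_segment_eq h with h | h
  · exact absurd h (va_ne_of_same_direction hne)
  · exact h

theorem fst_ne_of_outerEdge_eq {τ τ' : M.Tri} (hne : τ ≠ τ')
    (h : M.outerEdge τ' = M.outerEdge τ) : τ.1 ≠ τ'.1 := by
  intro hj
  obtain ⟨j, i⟩ := τ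
  obtain ⟨j', i'⟩ := τ'
  simp only at hj
  subst hj
  obtain ⟨x, hx⟩ := (openEdge_infinite (M := M) ⟨j, i⟩).nonempty
  apply (M.elt j).notMem_tri_of_mem_cone (i := i) (i' := i') (fun hi => hne (by rw [hi]))
    ((M.elt j).mem_cone_of_mem_openSegment hx)
  apply (M.elt j).edge_subset_tri
  change x ∈ M.outerEdge ⟨j, i'⟩
  rw [h]
  exact openEdge_subset _ hx

theorem eq_of_outerEdge_eq {τ τ' τ'' : M.Tri} (h' : τ ≠ τ') (h'' : τ ≠ τ'')
    (e' : M.outerEdge τ' = M.outerEdge τ) (e'' : M.outerEdge τ'' = M.outerEdge τ) : τ' = τ'' := by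
  by_contra hne
  have r1 := reversed_of_outerEdge_eq h' e'
  have r2 := reversed_of_outerEdge_eq h'' e''
  exact va_ne_of_same_direction hne ⟨r2.1.trans r1.1.symm, r2.2.trans r1.2.symm⟩

/-- Without a neighbour, removing all other elements from `Ω` would leave an open neighbourhood of
`x` inside the element of `τ`, although `x` is on its edge. -/
theorem exists_neighbour (hM : M.IsStar) {τ : M.Tri} {x : Plane} (hx : x ∈ M.openEdge τ)
    (hΩ : x ∈ G.Ω) : ∃ τ' : M.Tri, τ ≠ τ' ∧ M.outerEdge τ' = M.outerEdge τ := by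
  by_contra! hno
  apply notMem_interior_of_mem_openEdge hx τ.1
  have hcl : IsClosed (⋃ j ∈ {j : Fin M.N | j ≠ τ.1}, (M.elt j).carrier) :=
    (Set.toFinite _).isClosed_biUnion fun j _ => (M.elt j).isCompact_carrier.isClosed
  rw [mem_interior]
  refine ⟨G.Ω \ ⋃ j ∈ {j : Fin M.N | j ≠ τ.1}, (M.elt j).carrier, ?_, G.isOpen_Ω.sdiff hcl, hΩ, ?_⟩
  · rintro y ⟨hy, hy'⟩
    have := subset_closure hy
    rw [← M.cover] at this
    obtain ⟨j, hj⟩ := mem_iUnion.1 this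
    by_cases h : j = τ.1
    · rwa [← h]
    · exact absurd (mem_biUnion (show j ∈ {j : Fin M.N | j ≠ τ.1} from h) hj) hy'
  · intro hx'
    obtain ⟨j, hj, hxj⟩ := mem_iUnion₂.1 hx'
    obtain ⟨τ', rfl, h⟩ := exists_outerEdge_of_mem_openEdge hM hx hxj
    exact hno τ' (fun h => hj (by rw [h])) h

theorem exists_neighbour_of_not_subset_frontier (hM : M.IsStar) {τ : M.Tri}
    (h : ¬ M.outerEdge τ ⊆ frontier G.Ω) :
    ∃ τ' : M.Tri, τ ≠ τ' ∧ M.outerEdge τ' = M.outerEdge τ := by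
  obtain ⟨x, hx, hx'⟩ := not_subset.1 h
  have hΩ : x ∈ G.Ω := by
    by_contra hn
    refine hx' ⟨triangle_subset_closure τ (outerEdge_subset_triangle τ hx), ?_⟩
    rwa [G.isOpen_Ω.interior_eq]
  obtain ⟨y, hy, hy'⟩ := mem_closure_iff.1 (outerEdge_subset_closure_openEdge τ hx) _ G.isOpen_Ω hΩ
  exact exists_neighbour hM hy' hy

theorem disjoint_interior_fracture (j : Fin M.N) :
    Disjoint (interior (M.elt j).carrier) G.F.carrier := by
  rw [disjoint_left]
  intro x hx hF
  obtain ⟨j', i', hi, -⟩ := M.fitted x hF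
  exact notMem_interior_of_mem_outerEdge (τ := ⟨j', i'⟩) hi j hx

/-- The interior is connected and misses the fracture, so it lies in one of the two disjoint open
parts of the bulk. -/
theorem interior_subset_or (hM : M.IsStar) (j : Fin M.N) :
    interior (M.elt j).carrier ⊆ G.Ω₁ ∨ interior (M.elt j).carrier ⊆ G.Ω₂ := by
  obtain ⟨r, hr, hs⟩ := hM j
  apply IsPreconnected.subset_or_subset G.isOpen₁ G.isOpen₂ G.disjoint _
    (hs.isPreconnected_interior hr)
  rw [← G.bulk_eq]
  exact fun x hx => ⟨interior_carrier_subset j hx,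
    disjoint_left.1 (disjoint_interior_fracture j) hx⟩

theorem interior_carrier_nonempty (j : Fin M.N) : (interior (M.elt j).carrier).Nonempty :=
  ((M.elt j).interior_tri_nonempty 0).mono (interior_mono ((M.elt j).tri_subset_carrier 0))

theorem exists_mem_openEdge_relInterior {τ : M.Tri} (hF : M.outerEdge τ ⊆ G.F.carrier) :
    ∃ x ∈ M.openEdge τ, x ∈ G.F.relInterior := by
  by_contra! h
  refine openEdge_infinite τ (Set.Finite.subset (Set.toFinite {G.F.γ 0, G.F.γ G.F.len}) ?_)
  exact fun x hx => G.F.carrier_diff_subset ⟨hF (openEdge_subset τ hx), h x hx⟩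

/-- Near `x` only the elements of `τ` and `τ'` occur. If both have interiors disjoint from the open
set `U`, then `U` cannot come close to `x`. With `U` one of the subdomains, this shows that a
fracture edge has its two elements on different sides. -/
theorem false_of_same_side (hM : M.IsStar) {τ τ' : M.Tri} (hne : τ ≠ τ')
    (he : M.outerEdge τ' = M.outerEdge τ) {x : Plane} (hx : x ∈ M.openEdge τ) (hΩ : x ∈ G.Ω)
    {U : Set Plane} (hU : IsOpen U) (hxU : x ∈ closure U)
    (h1 : Disjoint (interior (M.elt τ.1).carrier) U)
    (h2 : Disjoint (interior (M.elt τ'.1).carrier) U) : False := by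
  have hcl : IsClosed (⋃ j ∈ {j : Fin M.N | j ≠ τ.1 ∧ j ≠ τ'.1}, (M.elt j).carrier) :=
    (Set.toFinite _).isClosed_biUnion fun j _ => (M.elt j).isCompact_carrier.isClosed
  have hx' : x ∈ G.Ω \ ⋃ j ∈ {j : Fin M.N | j ≠ τ.1 ∧ j ≠ τ'.1}, (M.elt j).carrier := by
    refine ⟨hΩ, fun h => ?_⟩
    obtain ⟨j, ⟨hj, hj'⟩, hxj⟩ := mem_iUnion₂.1 h
    obtain ⟨τ'', rfl, h⟩ := exists_outerEdge_of_mem_openEdge hM hx hxj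
    exact hj' (by rw [eq_of_outerEdge_eq hne (fun h => hj (by rw [h])) he h])
  obtain ⟨y, ⟨hy, hy'⟩, hyU⟩ := mem_closure_iff.1 hxU _ (G.isOpen_Ω.sdiff hcl) hx'
  have := subset_closure hy
  rw [← M.cover] at this
  obtain ⟨j, hj⟩ := mem_iUnion.1 this
  obtain ⟨z, hz, hz'⟩ := mem_closure_iff.1 ((M.elt j).carrier_subset_closure_interior hj) _ hU hyU
  by_cases h : j ≠ τ.1 ∧ j ≠ τ'.1
  · exact hy' (mem_biUnion (show j ∈ {j : Fin M.N | j ≠ τ.1 ∧ j ≠ τ'.1} from h) hj)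
  · rw [not_and_or, not_not, not_not] at h
    rcases h with rfl | rfl
    · exact disjoint_left.1 h1 hz' hz
    · exact disjoint_left.1 h2 hz' hz

theorem exists_neighbour_of_subset_fracture (hM : M.IsStar) {τ : M.Tri}
    (hF : M.outerEdge τ ⊆ G.F.carrier) :
    ∃ τ' : M.Tri, τ ≠ τ' ∧ M.outerEdge τ' = M.outerEdge τ ∧
      ((interior (M.elt τ.1).carrier ⊆ G.Ω₁ ∧ interior (M.elt τ'.1).carrier ⊆ G.Ω₂) ∨
       (interior (M.elt τ'.1).carrier ⊆ G.Ω₁ ∧ interior (M.elt τ.1).carrier ⊆ G.Ω₂)) := by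
  obtain ⟨x, hx, hxF⟩ := exists_mem_openEdge_relInterior hF
  have hΩ := G.fracture_inside hxF
  obtain ⟨τ', hne, he⟩ := exists_neighbour hM hx hΩ
  refine ⟨τ', hne, he, ?_⟩
  have hI := G.isInterface hxF
  rcases interior_subset_or hM τ.1 with h1 | h1 <;> rcases interior_subset_or hM τ'.1 with h2 | h2
  · exact (false_of_same_side hM hne he hx hΩ G.isOpen₂ (frontier_subset_closure hI.2)
      (G.disjoint.mono_left h1) (G.disjoint.mono_left h2)).elim
  · exact Or.inl ⟨h1, h2⟩
  · exact Or.inr ⟨h2, h1⟩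
  · exact (false_of_same_side hM hne he hx hΩ G.isOpen₁ (frontier_subset_closure hI.1)
      (G.disjoint.symm.mono_left h1) (G.disjoint.symm.mono_left h2)).elim

/-! ### Summation over edges -/

theorem mem_interiorEdges {e : M.Tri × M.Tri} : e ∈ M.interiorEdges ↔ e.1.1 < e.2.1 ∧
    M.outerEdge e.1 = M.outerEdge e.2 ∧ ¬ M.outerEdge e.1 ⊆ G.F.carrier := by
  simp [interiorEdges]

theorem mem_fractureEdges {e : M.Tri × M.Tri} : e ∈ M.fractureEdges ↔
    M.outerEdge e.1 = M.outerEdge e.2 ∧ M.outerEdge e.1 ⊆ G.F.carrier ∧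
    interior (M.elt e.1.1).carrier ⊆ G.Ω₁ ∧ interior (M.elt e.2.1).carrier ⊆ G.Ω₂ := by
  simp [fractureEdges]

theorem ne_of_sides {j j' : Fin M.N} (h1 : interior (M.elt j).carrier ⊆ G.Ω₁)
    (h2 : interior (M.elt j').carrier ⊆ G.Ω₂) : j ≠ j' := by
  rintro rfl
  obtain ⟨x, hx⟩ := interior_carrier_nonempty (M := M) j
  exact disjoint_left.1 G.disjoint (h1 hx) (h2 hx)

theorem ne_of_mem_interiorEdges {e : M.Tri × M.Tri} (he : e ∈ M.interiorEdges) : e.1 ≠ e.2 :=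
  fun h => (mem_interiorEdges.1 he).1.ne (by rw [h])

theorem ne_of_mem_fractureEdges {e : M.Tri × M.Tri} (he : e ∈ M.fractureEdges) : e.1 ≠ e.2 := by
  obtain ⟨-, -, h1, h2⟩ := mem_fractureEdges.1 he
  exact fun h => ne_of_sides h1 h2 (by rw [h])

theorem reversed_of_mem_interiorEdges {e : M.Tri × M.Tri} (he : e ∈ M.interiorEdges) :
    M.va e.2 = M.vb e.1 ∧ M.vb e.2 = M.va e.1 :=
  reversed_of_outerEdge_eq (ne_of_mem_interiorEdges he) (mem_interiorEdges.1 he).2.1.symm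

theorem reversed_of_mem_fractureEdges {e : M.Tri × M.Tri} (he : e ∈ M.fractureEdges) :
    M.va e.2 = M.vb e.1 ∧ M.vb e.2 = M.va e.1 :=
  reversed_of_outerEdge_eq (ne_of_mem_fractureEdges he) (mem_fractureEdges.1 he).1.symm

theorem injOn_fst_fractureEdges : InjOn Prod.fst (M.fractureEdges : Set (M.Tri × M.Tri)) := by
  intro e he e' he' h
  refine Prod.ext h (eq_of_outerEdge_eq (ne_of_mem_fractureEdges he)
    (by rw [h]; exact ne_of_mem_fractureEdges he') (mem_fractureEdges.1 he).1.symm ?_)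
  rw [h]; exact (mem_fractureEdges.1 he').1.symm

open Classical in
-- Every triangle whose outer edge is not on `∂Ω` occurs exactly once in the listed pairs, as first
-- or as second entry. The order of the element numbers, respectively the side of the fracture,
-- decides which. All edge cancellations below go through this bookkeeping.
theorem sum_eq_sum_edges (hM : M.IsStar) (g : M.Tri → ℝ)
    (hg : ∀ τ, M.outerEdge τ ⊆ frontier G.Ω → g τ = 0) :
    ∑ τ, g τ = ∑ e ∈ M.interiorEdges, (g e.1 + g e.2) +
      ∑ e ∈ M.fractureEdges, (g e.1 + g e.2) := by
  have inj1 : InjOn Prod.fst (M.interiorEdges : Set (M.Tri × M.Tri)) := by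
    intro e he e' he' h
    refine Prod.ext h (eq_of_outerEdge_eq (ne_of_mem_interiorEdges he)
      (by rw [h]; exact ne_of_mem_interiorEdges he') (mem_interiorEdges.1 he).2.1.symm ?_)
    rw [h]; exact (mem_interiorEdges.1 he').2.1.symm
  have inj2 : InjOn Prod.snd (M.interiorEdges : Set (M.Tri × M.Tri)) := by
    intro e he e' he' h
    refine Prod.ext (eq_of_outerEdge_eq (ne_of_mem_interiorEdges he).symm
      (by rw [h]; exact (ne_of_mem_interiorEdges he').symm) (mem_interiorEdges.1 he).2.1 ?_) h
    rw [h]; exact (mem_interiorEdges.1 he').2.1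
  have inj4 : InjOn Prod.snd (M.fractureEdges : Set (M.Tri × M.Tri)) := by
    intro e he e' he' h
    refine Prod.ext (eq_of_outerEdge_eq (ne_of_mem_fractureEdges he).symm
      (by rw [h]; exact (ne_of_mem_fractureEdges he').symm) (mem_fractureEdges.1 he).1 ?_) h
    rw [h]; exact (mem_fractureEdges.1 he').1
  rw [Finset.sum_add_distrib, Finset.sum_add_distrib,
    ← Finset.sum_image (f := g) (g := Prod.fst) inj1,
    ← Finset.sum_image (f := g) (g := Prod.snd) inj2,
    ← Finset.sum_image (f := g) (g := Prod.fst) injOn_fst_fractureEdges,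
    ← Finset.sum_image (f := g) (g := Prod.snd) inj4]
  have d1 : Disjoint (M.interiorEdges.image Prod.fst) (M.interiorEdges.image Prod.snd) := by
    rw [Finset.disjoint_left]
    intro τ h1 h2
    obtain ⟨e, he, rfl⟩ := Finset.mem_image.1 h1
    obtain ⟨e', he', h⟩ := Finset.mem_image.1 h2
    have : e.2 = e'.1 := eq_of_outerEdge_eq (ne_of_mem_interiorEdges he)
      (by rw [← h]; exact (ne_of_mem_interiorEdges he').symm) (mem_interiorEdges.1 he).2.1.symm
      (by rw [← h]; exact (mem_interiorEdges.1 he').2.1)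
    have l1 := (mem_interiorEdges.1 he).1
    have l2 := (mem_interiorEdges.1 he').1
    rw [h, ← this] at l2
    exact lt_asymm l1 l2
  have d2 : Disjoint (M.fractureEdges.image Prod.fst) (M.fractureEdges.image Prod.snd) := by
    rw [Finset.disjoint_left]
    intro τ h1 h2
    obtain ⟨e, he, rfl⟩ := Finset.mem_image.1 h1
    obtain ⟨e', he', h⟩ := Finset.mem_image.1 h2
    have l1 := (mem_fractureEdges.1 he).2.2.1
    have l2 := (mem_fractureEdges.1 he').2.2.2
    rw [h] at l2
    exact ne_of_sides l1 l2 rfl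
  have d3 : Disjoint (M.interiorEdges.image Prod.fst ∪ M.interiorEdges.image Prod.snd)
      (M.fractureEdges.image Prod.fst ∪ M.fractureEdges.image Prod.snd) := by
    rw [Finset.disjoint_left]
    intro τ h1 h2
    have a1 : ¬ M.outerEdge τ ⊆ G.F.carrier := by
      rcases Finset.mem_union.1 h1 with h | h
      · obtain ⟨e, he, rfl⟩ := Finset.mem_image.1 h
        exact (mem_interiorEdges.1 he).2.2
      · obtain ⟨e, he, rfl⟩ := Finset.mem_image.1 h
        rw [← (mem_interiorEdges.1 he).2.1]
        exact (mem_interiorEdges.1 he).2.2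
    apply a1
    rcases Finset.mem_union.1 h2 with h | h
    · obtain ⟨e, he, rfl⟩ := Finset.mem_image.1 h
      exact (mem_fractureEdges.1 he).2.1
    · obtain ⟨e, he, rfl⟩ := Finset.mem_image.1 h
      rw [← (mem_fractureEdges.1 he).1]
      exact (mem_fractureEdges.1 he).2.1
  rw [← Finset.sum_union d1, ← Finset.sum_union d2, ← Finset.sum_union d3]
  symm
  apply Finset.sum_subset (Finset.subset_univ _)
  intro τ _ hτ
  simp only [Finset.mem_union, not_or] at hτ
  obtain ⟨⟨h1, h2⟩, h3, h4⟩ := hτ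
  by_contra hne
  have hfr : ¬ M.outerEdge τ ⊆ frontier G.Ω := fun h => hne (hg τ h)
  by_cases hF : M.outerEdge τ ⊆ G.F.carrier
  · obtain ⟨τ', -, he, h | h⟩ := exists_neighbour_of_subset_fracture hM hF
    · exact h3 (Finset.mem_image.2 ⟨(τ, τ'), mem_fractureEdges.2 ⟨he.symm, hF, h⟩, rfl⟩)
    · exact h4 (Finset.mem_image.2 ⟨(τ', τ), mem_fractureEdges.2 ⟨he, by rwa [he], h⟩, rfl⟩)
  · obtain ⟨τ', hne', he⟩ := exists_neighbour_of_not_subset_frontier hM hfr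
    rcases (fst_ne_of_outerEdge_eq hne' he).lt_or_gt with h | h
    · exact h1 (Finset.mem_image.2 ⟨(τ, τ'), mem_interiorEdges.2 ⟨h, he.symm, hF⟩, rfl⟩)
    · exact h2 (Finset.mem_image.2 ⟨(τ', τ), mem_interiorEdges.2 ⟨h, he, by rwa [he]⟩, rfl⟩)

theorem exists_fractureEdge_of_mem_carrier (hM : M.IsStar) {x : Plane} (hx : x ∈ G.F.carrier) :
    ∃ e ∈ M.fractureEdges, x ∈ M.outerEdge e.1 := by
  obtain ⟨j, i, hi, hF⟩ := M.fitted x hx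
  obtain ⟨τ', -, he, h | h⟩ := exists_neighbour_of_subset_fracture hM (τ := ⟨j, i⟩) hF
  · exact ⟨(⟨j, i⟩, τ'), mem_fractureEdges.2 ⟨he.symm, hF, h⟩, hi⟩
  · exact ⟨(τ', ⟨j, i⟩), mem_fractureEdges.2 ⟨he, by rw [he]; exact hF, h⟩, by rw [he]; exact hi⟩

/-! ### The mesh covers the domain up to null sets -/

theorem measurableSet_triangle (τ : M.Tri) : MeasurableSet (M.triangle τ) :=
  ((M.elt τ.1).isCompact_tri τ.2).isClosed.measurableSet

theorem isCompact_triangle (τ : M.Tri) : IsCompact (M.triangle τ) :=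
  (M.elt τ.1).isCompact_tri τ.2

theorem convex_triangle (τ : M.Tri) : Convex ℝ (M.triangle τ) := convex_convexHull ℝ _

/-- Overlaps lie on the boundaries of convex sets, which are null sets. -/
theorem aedisjoint_triangle :
    Pairwise fun τ τ' : M.Tri => AEDisjoint volume (M.triangle τ) (M.triangle τ') := by
  intro τ τ' h
  have key : M.triangle τ ∩ M.triangle τ' ⊆
      frontier (M.triangle τ) ∪ frontier (M.triangle τ') := by
    rintro x ⟨h1, h2⟩
    by_contra hn
    rw [mem_union, not_or] at hn
    have i1 : x ∈ interior (M.triangle τ) := by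
      by_contra hi; exact hn.1 ⟨subset_closure h1, hi⟩
    have i2 : x ∈ interior (M.triangle τ') := by
      by_contra hi; exact hn.2 ⟨subset_closure h2, hi⟩
    exact disjoint_left.1 (disjoint_interior_triangle h) i1 i2
  refine measure_mono_null key (measure_union_null ?_ ?_)
  · exact (convex_triangle τ).addHaar_frontier volume
  · exact (convex_triangle τ').addHaar_frontier volume

theorem volume_outerEdge (τ : M.Tri) : volume (M.outerEdge τ) = 0 := by
  have hc : Convex ℝ (M.outerEdge τ) := convex_segment _ _
  have hsub : M.outerEdge τ ⊆ frontier (M.triangle τ) := by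
    intro x hx
    refine ⟨subset_closure (outerEdge_subset_triangle τ hx), fun h => ?_⟩
    exact notMem_interior_of_mem_outerEdge hx τ.1 (interior_mono (triangle_subset_carrier τ) h)
  exact measure_mono_null hsub ((convex_triangle τ).addHaar_frontier volume)

/-- What a triangle has outside the bulk lies on edges. Almost everywhere statements about the
coefficients thus pass from the bulk to every triangle. -/
theorem volume_triangle_diff_bulk (hM : M.IsStar) (τ : M.Tri) :
    volume (M.triangle τ \ G.bulk) = 0 := by
  refine measure_mono_null (t := ⋃ τ : M.Tri, M.outerEdge τ) ?_
    (measure_iUnion_null fun τ => volume_outerEdge τ)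
  rintro x ⟨hx, hb⟩
  obtain ⟨r, hr, hs⟩ := hM τ.1
  rcases hs.mem_interior_or_mem_edge hr (triangle_subset_carrier τ hx) with h | ⟨i, hi⟩
  · exact absurd ⟨interior_carrier_subset _ h,
      disjoint_left.1 (disjoint_interior_fracture _) h⟩ hb
  · exact mem_iUnion.2 ⟨⟨τ.1, i⟩, hi⟩

end Mesh

/-! ### Polynomials on the plane -/

section Polynomials

open MvPolynomial

@[simp] theorem ev_zero (x : Plane) : ev 0 x = 0 := by simp [ev]

@[simp] theorem ev_add (P Q : MvPolynomial (Fin 2) ℝ) (x : Plane) :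
    ev (P + Q) x = ev P x + ev Q x := by simp [ev]

@[simp] theorem ev_sub (P Q : MvPolynomial (Fin 2) ℝ) (x : Plane) :
    ev (P - Q) x = ev P x - ev Q x := by simp [ev]

@[simp] theorem ev_smul (r : ℝ) (P : MvPolynomial (Fin 2) ℝ) (x : Plane) :
    ev (r • P) x = r * ev P x := by simp [ev, smul_eval]

@[simp] theorem ev_mul (P Q : MvPolynomial (Fin 2) ℝ) (x : Plane) :
    ev (P * Q) x = ev P x * ev Q x := by simp [ev]

@[simp] theorem ev_C (r : ℝ) (x : Plane) : ev (C r) x = r := by simp [ev]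

@[simp] theorem ev_X (i : Fin 2) (x : Plane) : ev (X i) x = x i := by simp [ev]

theorem hasFDerivAt_ev (P : MvPolynomial (Fin 2) ℝ) (x : Plane) :
    HasFDerivAt (ev P) (ev (pderiv 0 P) x • (EuclideanSpace.proj 0 : Plane →L[ℝ] ℝ) +
      ev (pderiv 1 P) x • (EuclideanSpace.proj 1 : Plane →L[ℝ] ℝ)) x := by
  induction P using MvPolynomial.induction_on with
  | C r =>
    have : ev (C r) = fun _ => r := by ext y; simp
    rw [this]
    simpa using hasFDerivAt_const r x
  | add P Q hP hQ =>
    have : ev (P + Q) = ev P + ev Q := by ext y; simp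
    rw [this]
    refine (hP.add hQ).congr_fderiv (ContinuousLinearMap.ext fun v => ?_)
    simp
    ring
  | mul_X P i hP =>
    have : ev (P * X i) = ev P * (fun y => y i) := by ext y; simp
    rw [this]
    have hX : HasFDerivAt (fun y : Plane => y i) (EuclideanSpace.proj i : Plane →L[ℝ] ℝ) x :=
      (EuclideanSpace.proj i : Plane →L[ℝ] ℝ).hasFDerivAt
    refine (hP.mul hX).congr_fderiv (ContinuousLinearMap.ext fun v => ?_)
    fin_cases i <;> · simp [pderiv_X]; ring

theorem fderiv_ev (P : MvPolynomial (Fin 2) ℝ) (x v : Plane) :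
    fderiv ℝ (ev P) x v = ev (pderiv 0 P) x * v 0 + ev (pderiv 1 P) x * v 1 := by
  rw [(hasFDerivAt_ev P x).fderiv]; simp

theorem contDiff_ev (P : MvPolynomial (Fin 2) ℝ) {n : WithTop ℕ∞} : ContDiff ℝ n (ev P) := by
  induction P using MvPolynomial.induction_on with
  | C r =>
    have : ev (C r) = fun _ => r := by ext y; simp
    rw [this]; exact contDiff_const
  | add P Q hP hQ =>
    have : ev (P + Q) = ev P + ev Q := by ext y; simp
    rw [this]; exact hP.add hQ
  | mul_X P i hP =>
    have : ev (P * X i) = ev P * (fun y => y i) := by ext y; simp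
    rw [this]
    exact hP.mul (EuclideanSpace.proj i : Plane →L[ℝ] ℝ).contDiff

@[fun_prop] theorem continuous_ev (P : MvPolynomial (Fin 2) ℝ) : Continuous (ev P) :=
  (contDiff_ev P (n := 0)).continuous

/-- An open set contains a product of infinite sets, on which a polynomial is determined. Functions
vanishing almost everywhere on a triangle thereby become zero as polynomials, as uniqueness in the
discrete spaces requires. -/
theorem eq_zero_of_ev_eq_zero {P : MvPolynomial (Fin 2) ℝ} {U : Set Plane} (hU : IsOpen U)
    (hne : U.Nonempty) (h : ∀ x ∈ U, ev P x = 0) : P = 0 := by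
  obtain ⟨x, hx⟩ := hne
  have hc : Continuous fun y : Fin 2 → ℝ => (WithLp.toLp 2 y : Plane) := PiLp.continuous_toLp 2 _
  obtain ⟨ε, hε, hball⟩ := Metric.isOpen_iff.1 (hU.preimage hc) (WithLp.ofLp x) hx
  apply funext_set (fun i => Metric.ball (WithLp.ofLp x i) ε)
  · intro i
    rw [Real.ball_eq_Ioo]
    exact Ioo_infinite (by linarith)
  · intro y hy
    have : y ∈ Metric.ball (WithLp.ofLp x) ε := by
      rw [ball_pi _ hε]; exact hy
    simpa [ev] using h _ (hball this)

theorem totalDegree_pderiv_le (P : MvPolynomial (Fin 2) ℝ) (i : Fin 2) :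
    (pderiv i P).totalDegree ≤ P.totalDegree - 1 := by
  conv_lhs => rw [P.as_sum, map_sum]
  apply totalDegree_finsetSum_le
  intro m hm
  rw [pderiv_monomial]
  by_cases h0 : m i = 0
  · simp [h0]
  · refine (totalDegree_monomial_le _ _).trans ?_
    have h1 := le_totalDegree hm
    have h2 : m.sum (fun _ e => e) = (m - Finsupp.single i 1).sum (fun _ e => e) + 1 := by
      have : m = (m - Finsupp.single i 1) + Finsupp.single i 1 := by
        rw [tsub_add_cancel_of_le]
        rw [Finsupp.single_le_iff]; omega
      conv_lhs => rw [this]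
      rw [Finsupp.sum_add_index' (by simp) (by simp), Finsupp.sum_single_index rfl]
    change (m - Finsupp.single i 1).sum (fun _ e => e) ≤ _
    omega

theorem totalDegree_mul_pderiv_le {k : ℕ} {A P : MvPolynomial (Fin 2) ℝ}
    (hA : A.totalDegree ≤ 1) (hP : P.totalDegree ≤ k) (i : Fin 2) :
    (A * pderiv i P).totalDegree ≤ k := by
  have h1 := totalDegree_pderiv_le P i
  -- For constant `P` the truncated subtraction in `totalDegree - 1` loses the gain of one degree,
  -- but then the derivative is zero. This case carries the lowest order `k = 0`.
  rcases Nat.eq_zero_or_pos P.totalDegree with h | h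
  · rw [totalDegree_eq_zero_iff_eq_C] at h
    rw [h]; simp
  · have := totalDegree_mul A (pderiv i P)
    omega

/-- The pullback of a polynomial by the affine map `aff o a b`. -/
def pull (o a b : Plane) (P : MvPolynomial (Fin 2) ℝ) : MvPolynomial (Fin 2) ℝ :=
  aeval (fun i => C (o i) + C (a i) * X 0 + C (b i) * X 1) P

theorem totalDegree_linear_le (r s t : ℝ) :
    (C r + C s * X 0 + C t * X 1 : MvPolynomial (Fin 2) ℝ).totalDegree ≤ 1 := by
  have h : ∀ (s : ℝ) (i : Fin 2),
      (C s * X i : MvPolynomial (Fin 2) ℝ).totalDegree ≤ 1 := by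
    intro s i
    refine (totalDegree_mul _ _).trans ?_
    simp
  refine (totalDegree_add _ _).trans (max_le ((totalDegree_add _ _).trans (max_le ?_ (h _ _)))
    (h _ _))
  simp

theorem totalDegree_pull_le (o a b : Plane) (P : MvPolynomial (Fin 2) ℝ) :
    (pull o a b P).totalDegree ≤ P.totalDegree := by
  rw [pull, aeval_def, eval₂_eq]
  apply totalDegree_finsetSum_le
  intro m hm
  refine (totalDegree_mul _ _).trans ?_
  rw [algebraMap_eq, totalDegree_C, zero_add]
  refine (totalDegree_finsetProd _ _).trans ?_
  refine le_trans ?_ (le_totalDegree hm)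
  rw [Finsupp.sum]
  apply Finset.sum_le_sum
  intro i _
  refine (totalDegree_pow _ _).trans ?_
  simpa using Nat.mul_le_mul_left (m i) (totalDegree_linear_le (o i) (a i) (b i))

/-- Evaluation of a polynomial in Cartesian coordinates. -/
def evr (P : MvPolynomial (Fin 2) ℝ) (z : ℝ × ℝ) : ℝ := ev P !₂[z.1, z.2]

theorem evr_pull (o a b : Plane) (P : MvPolynomial (Fin 2) ℝ) (z : ℝ × ℝ) :
    evr (pull o a b P) z = ev P (aff o a b z) := by
  induction P using MvPolynomial.induction_on with
  | C r => simp [evr, pull, algebraMap_eq]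
  | add P Q hP hQ => simp only [evr, pull, map_add, ev_add] at hP hQ ⊢; rw [hP, hQ]
  | mul_X P i hP =>
    simp only [evr, pull, map_mul, ev_mul, aeval_X] at hP ⊢
    rw [hP]
    simp [aff]
    left; ring

theorem continuous_evr (P : MvPolynomial (Fin 2) ℝ) : Continuous (evr P) := by
  have : Continuous fun z : ℝ × ℝ => (!₂[z.1, z.2] : Plane) :=
    (PiLp.continuous_toLp 2 _).comp (by fun_prop)
  exact (continuous_ev P).comp this

/-- Chain rule: partial derivatives in reference coordinates are the directional derivatives along
the two sides. -/
theorem evr_pderiv_pull (o a b : Plane) (P : MvPolynomial (Fin 2) ℝ) (z : ℝ × ℝ) :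
    evr (pderiv 0 (pull o a b P)) z = fderiv ℝ (ev P) (aff o a b z) a ∧
    evr (pderiv 1 (pull o a b P)) z = fderiv ℝ (ev P) (aff o a b z) b := by
  have h : ev (pull o a b P) = fun x => ev P (o + colMap a b x) := by
    ext x
    rw [← aff_eq_colMap, ← evr_pull]
    simp only [evr, planeEquiv_apply]
    congr 1
    ext i; fin_cases i <;> rfl
  have h1 : HasFDerivAt (ev (pull o a b P)) ((fderiv ℝ (ev P) (aff o a b z)).comp (colMap a b))
      !₂[z.1, z.2] := by
    rw [h]
    have hz : aff o a b z = o + colMap a b !₂[z.1, z.2] := by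
      rw [← aff_eq_colMap]; rfl
    rw [hz]
    exact ((contDiff_ev P (n := 1)).differentiable (by norm_num) _).hasFDerivAt.comp _
      ((colMap a b).hasFDerivAt.const_add o)
  constructor
  · have := fderiv_ev (pull o a b P) !₂[z.1, z.2] (EuclideanSpace.single 0 1)
    rw [h1.fderiv] at this
    simp [colMap_apply] at this
    rw [this]; rfl
  · have := fderiv_ev (pull o a b P) !₂[z.1, z.2] (EuclideanSpace.single 1 1)
    rw [h1.fderiv] at this
    simp [colMap_apply] at this
    rw [this]; rfl

end Polynomials

/-! ### Comparison of quadratic forms -/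

/-- The quotient of the two forms is homogeneous of degree zero and attains its maximum on the unit
sphere, which is compact in finite dimension. -/
theorem exists_quadratic_le_pi {n : ℕ} (D N : (Fin n → ℝ) →ₗ[ℝ] (Fin n → ℝ) →ₗ[ℝ] ℝ)
    (hD : ∀ x ≠ 0, 0 < D x x) : ∃ C, ∀ x, N x x ≤ C * D x x := by
  have hc : ∀ B : (Fin n → ℝ) →ₗ[ℝ] (Fin n → ℝ) →ₗ[ℝ] ℝ, Continuous fun x => B x x := by
    intro B
    have : ∀ x, B x x = ∑ i, ∑ j, x i * (x j * B (Pi.single i 1) (Pi.single j 1)) := by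
      intro x
      conv_lhs => rw [LinearMap.pi_apply_eq_sum_univ (B x) x]
      rw [LinearMap.pi_apply_eq_sum_univ B x]
      simp only [LinearMap.sum_apply, LinearMap.smul_apply, smul_eq_mul, Finset.mul_sum]
      rw [Finset.sum_comm]
      refine Finset.sum_congr rfl fun i _ => Finset.sum_congr rfl fun j _ => ?_
      have e : ∀ i : Fin n, (fun j => if i = j then (1 : ℝ) else 0) = Pi.single i 1 := by
        intro i; ext j; simp [Pi.single_apply, eq_comm]
      rw [e, e]; ring
    simp only [this]
    fun_prop
  rcases (Metric.sphere (0 : Fin n → ℝ) 1).eq_empty_or_nonempty with he | hne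
  -- The sphere is empty only in dimension zero.
  · refine ⟨0, fun x => ?_⟩
    have : x = 0 := by
      by_contra hx
      have : ‖x‖⁻¹ • x ∈ Metric.sphere (0 : Fin n → ℝ) 1 := by
        simp [norm_smul, hx]
      rw [he] at this
      exact this
    simp [this]
  · have hK := isCompact_sphere (0 : Fin n → ℝ) 1
    have hpos : ∀ x ∈ Metric.sphere (0 : Fin n → ℝ) 1, 0 < D x x := by
      intro x hx
      apply hD
      rintro rfl
      simp at hx
    obtain ⟨y, -, hy⟩ := hK.exists_isMaxOn hne
      (((hc N).continuousOn).div ((hc D).continuousOn) fun x hx => (hpos x hx).ne')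
    refine ⟨N y y / D y y, fun x => ?_⟩
    by_cases hx : x = 0
    · simp [hx]
    have hxs : ‖x‖⁻¹ • x ∈ Metric.sphere (0 : Fin n → ℝ) 1 := by simp [norm_smul, hx]
    have h1 := hy hxs
    have h2 := hpos _ hxs
    change N _ _ / D _ _ ≤ N y y / D y y at h1
    rw [div_le_iff₀ h2] at h1
    simp only [map_smul, LinearMap.smul_apply, smul_eq_mul] at h1
    have hn : 0 < ‖x‖⁻¹ := inv_pos.2 (norm_pos_iff.2 hx)
    have h3 : ‖x‖⁻¹ * ‖x‖⁻¹ * N x x ≤ ‖x‖⁻¹ * ‖x‖⁻¹ * (N y y / D y y * D x x) := by linarith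
    exact le_of_mul_le_mul_left h3 (by positivity)

theorem exists_quadratic_le {V : Type*} [AddCommGroup V] [Module ℝ V] [Module.Finite ℝ V]
    (D N : V →ₗ[ℝ] V →ₗ[ℝ] ℝ) (hD : ∀ x ≠ 0, 0 < D x x) : ∃ C, ∀ x, N x x ≤ C * D x x := by
  let e := (Module.finBasis ℝ V).equivFun
  obtain ⟨C, hC⟩ := exists_quadratic_le_pi (D.compl₁₂ e.symm.toLinearMap e.symm.toLinearMap)
    (N.compl₁₂ e.symm.toLinearMap e.symm.toLinearMap) (fun x hx => hD _ (by simpa using hx))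
  refine ⟨C, fun x => ?_⟩
  have := hC (e x)
  simpa [LinearMap.compl₁₂_apply] using this

/-! ### A Poincaré inequality for polynomials on the reference triangle -/

section Reference

open MvPolynomial

/-- A weighted Dirichlet form on the reference triangle. -/
def refGrad (P Q : MvPolynomial (Fin 2) ℝ) : ℝ :=
  ∫ z in refTri, (z.1 * (evr (pderiv 0 P) z * evr (pderiv 0 Q) z) +
    z.2 * (evr (pderiv 1 P) z * evr (pderiv 1 Q) z))

/-- The `L²` inner product on the reference triangle and on its outer edge. -/
def refInner (P Q : MvPolynomial (Fin 2) ℝ) : ℝ :=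
  (∫ z in refTri, evr P z * evr Q z) + ∫ t in (0 : ℝ)..1, evr P (1 - t, t) * evr Q (1 - t, t)

/-- The mean value over the outer edge of the reference triangle. -/
def refMean (P : MvPolynomial (Fin 2) ℝ) : ℝ := ∫ t in (0 : ℝ)..1, evr P (1 - t, t)

@[simp] theorem evr_add (P Q : MvPolynomial (Fin 2) ℝ) (z : ℝ × ℝ) :
    evr (P + Q) z = evr P z + evr Q z := by simp [evr]

@[simp] theorem evr_sub (P Q : MvPolynomial (Fin 2) ℝ) (z : ℝ × ℝ) :
    evr (P - Q) z = evr P z - evr Q z := by simp [evr]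

@[simp] theorem evr_smul (r : ℝ) (P : MvPolynomial (Fin 2) ℝ) (z : ℝ × ℝ) :
    evr (r • P) z = r * evr P z := by simp [evr]

@[simp] theorem evr_C (r : ℝ) (z : ℝ × ℝ) : evr (C r) z = r := by simp [evr]

theorem continuous_evr_edge (P : MvPolynomial (Fin 2) ℝ) :
    Continuous fun t : ℝ => evr P (1 - t, t) :=
  (continuous_evr P).comp (by fun_prop)

theorem integrableOn_refTri {f : ℝ × ℝ → ℝ} (hf : Continuous f) : IntegrableOn f refTri :=
  hf.continuousOn.integrableOn_compact isCompact_refTri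

theorem refMean_add (P Q : MvPolynomial (Fin 2) ℝ) : refMean (P + Q) = refMean P + refMean Q := by
  simp only [refMean, evr_add]
  exact intervalIntegral.integral_add ((continuous_evr_edge P).intervalIntegrable _ _)
    ((continuous_evr_edge Q).intervalIntegrable _ _)

theorem refMean_smul (r : ℝ) (P : MvPolynomial (Fin 2) ℝ) : refMean (r • P) = r * refMean P := by
  simp only [refMean, evr_smul, intervalIntegral.integral_const_mul]

theorem refMean_C (r : ℝ) : refMean (C r) = r := by simp [refMean]

theorem refGrad_comm (P Q : MvPolynomial (Fin 2) ℝ) : refGrad P Q = refGrad Q P := by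
  simp only [refGrad, mul_comm]

theorem refGrad_add_left (P Q R : MvPolynomial (Fin 2) ℝ) :
    refGrad (P + Q) R = refGrad P R + refGrad Q R := by
  have c := continuous_evr
  simp only [refGrad]
  rw [← integral_add]
  · simp only [map_add, evr_add]; congr 1; ext z; ring
  · apply integrableOn_refTri
    have := c (pderiv 0 P); have := c (pderiv 1 P); have := c (pderiv 0 R)
    have := c (pderiv 1 R); fun_prop
  · apply integrableOn_refTri
    have := c (pderiv 0 Q); have := c (pderiv 1 Q); have := c (pderiv 0 R)
    have := c (pderiv 1 R); fun_prop

theorem refGrad_smul_left (r : ℝ) (P R : MvPolynomial (Fin 2) ℝ) :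
    refGrad (r • P) R = r * refGrad P R := by
  simp only [refGrad, Derivation.map_smul, evr_smul]
  rw [← integral_const_mul]
  congr 1; ext z; ring

theorem refInner_comm (P Q : MvPolynomial (Fin 2) ℝ) : refInner P Q = refInner Q P := by
  simp only [refInner, mul_comm]

theorem refInner_add_left (P Q R : MvPolynomial (Fin 2) ℝ) :
    refInner (P + Q) R = refInner P R + refInner Q R := by
  simp only [refInner]
  have h1 : ∫ z in refTri, evr (P + Q) z * evr R z =
      (∫ z in refTri, evr P z * evr R z) + ∫ z in refTri, evr Q z * evr R z := by
    simp only [evr_add, add_mul]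
    exact integral_add (integrableOn_refTri ((continuous_evr P).mul (continuous_evr R)))
      (integrableOn_refTri ((continuous_evr Q).mul (continuous_evr R)))
  have h2 : ∫ t in (0 : ℝ)..1, evr (P + Q) (1 - t, t) * evr R (1 - t, t) =
      (∫ t in (0 : ℝ)..1, evr P (1 - t, t) * evr R (1 - t, t)) +
      ∫ t in (0 : ℝ)..1, evr Q (1 - t, t) * evr R (1 - t, t) := by
    simp only [evr_add, add_mul]
    exact intervalIntegral.integral_add
      (((continuous_evr_edge P).mul (continuous_evr_edge R)).intervalIntegrable _ _)
      (((continuous_evr_edge Q).mul (continuous_evr_edge R)).intervalIntegrable _ _)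
  rw [h1, h2]; ring

theorem refInner_smul_left (r : ℝ) (P R : MvPolynomial (Fin 2) ℝ) :
    refInner (r • P) R = r * refInner P R := by
  simp only [refInner, evr_smul, mul_assoc, integral_const_mul,
    intervalIntegral.integral_const_mul]
  ring

theorem refGrad_nonneg (P : MvPolynomial (Fin 2) ℝ) : 0 ≤ refGrad P P := by
  apply setIntegral_nonneg measurableSet_refTri
  rintro z ⟨h1, h2, -⟩
  have := mul_self_nonneg (evr (pderiv 0 P) z)
  have := mul_self_nonneg (evr (pderiv 1 P) z)
  positivity

theorem isOpen_refTri_interior : IsOpen {z : ℝ × ℝ | 0 < z.1 ∧ 0 < z.2 ∧ z.1 + z.2 < 1} :=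
  (isOpen_lt continuous_const continuous_fst).inter
    ((isOpen_lt continuous_const continuous_snd).inter
      (isOpen_lt (continuous_fst.add continuous_snd) continuous_const))

/-- The weights degenerate on two sides but are positive in the open triangle, which is enough for
polynomials. -/
theorem pderiv_eq_zero_of_refGrad {P : MvPolynomial (Fin 2) ℝ} (h : refGrad P P = 0) :
    pderiv 0 P = 0 ∧ pderiv 1 P = 0 := by
  set f : ℝ × ℝ → ℝ := fun z => z.1 * (evr (pderiv 0 P) z * evr (pderiv 0 P) z) +
    z.2 * (evr (pderiv 1 P) z * evr (pderiv 1 P) z) with hf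
  have hfc : Continuous f := by
    have := continuous_evr (pderiv 0 P); have := continuous_evr (pderiv 1 P); fun_prop
  set U : Set (ℝ × ℝ) := {z : ℝ × ℝ | 0 < z.1 ∧ 0 < z.2 ∧ z.1 + z.2 < 1} with hU
  have hUT : U ⊆ refTri := fun z hz => ⟨hz.1.le, hz.2.1.le, hz.2.2.le⟩
  have h0 : f =ᵐ[volume.restrict refTri] 0 := by
    rw [← setIntegral_eq_zero_iff_of_nonneg_ae _ (integrableOn_refTri hfc)]
    · exact h
    · filter_upwards [ae_restrict_mem measurableSet_refTri] with z hz
      obtain ⟨h1, h2, -⟩ := hz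
      have := mul_self_nonneg (evr (pderiv 0 P) z)
      have := mul_self_nonneg (evr (pderiv 1 P) z)
      simp only [hf, Pi.zero_apply]; positivity
  have h1 : EqOn f 0 U := by
    apply Measure.eqOn_open_of_ae_eq (μ := volume) _ isOpen_refTri_interior hfc.continuousOn
      continuousOn_const
    exact ae_restrict_of_ae_restrict_of_subset hUT h0
  have hpos : ∀ z ∈ U, evr (pderiv 0 P) z = 0 ∧ evr (pderiv 1 P) z = 0 := by
    intro z hz
    have := h1 hz
    simp only [hf, Pi.zero_apply] at this
    have a1 := mul_self_nonneg (evr (pderiv 0 P) z)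
    have a2 := mul_self_nonneg (evr (pderiv 1 P) z)
    have b1 := mul_nonneg hz.1.le a1
    have b2 := mul_nonneg hz.2.1.le a2
    constructor
    · have : z.1 * (evr (pderiv 0 P) z * evr (pderiv 0 P) z) = 0 := by linarith
      simpa [hz.1.ne'] using this
    · have : z.2 * (evr (pderiv 1 P) z * evr (pderiv 1 P) z) = 0 := by linarith
      simpa [hz.2.1.ne'] using this
  have hopen : IsOpen {x : Plane | (x 0, x 1) ∈ U} :=
    isOpen_refTri_interior.preimage (by fun_prop : Continuous fun x : Plane => (x 0, x 1))
  have hne : {x : Plane | (x 0, x 1) ∈ U}.Nonempty :=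
    ⟨!₂[1 / 3, 1 / 3], by simp only [hU, mem_ofPred_eq]; norm_num⟩
  have hev : ∀ (Q : MvPolynomial (Fin 2) ℝ) (x : Plane), ev Q x = evr Q (x 0, x 1) := by
    intro Q x
    rw [evr]; congr 1; ext i; fin_cases i <;> rfl
  exact ⟨eq_zero_of_ev_eq_zero hopen hne fun x hx => by rw [hev]; exact (hpos _ hx).1,
    eq_zero_of_ev_eq_zero hopen hne fun x hx => by rw [hev]; exact (hpos _ hx).2⟩

theorem ev_eq_of_pderiv_eq_zero {P : MvPolynomial (Fin 2) ℝ} (h0 : pderiv 0 P = 0)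
    (h1 : pderiv 1 P = 0) (x y : Plane) : ev P x = ev P y := by
  apply is_const_of_fderiv_eq_zero (𝕜 := ℝ)
  · exact (contDiff_ev P (n := 1)).differentiable (by norm_num)
  · intro x
    ext v
    rw [fderiv_ev, h0, h1]; simp

theorem eq_zero_of_refGrad_eq_zero {P : MvPolynomial (Fin 2) ℝ} (h : refGrad P P = 0)
    (hm : refMean P = 0) : P = 0 := by
  obtain ⟨h0, h1⟩ := pderiv_eq_zero_of_refGrad h
  have hc := ev_eq_of_pderiv_eq_zero h0 h1
  have : ∀ z, evr P z = ev P 0 := fun z => hc _ _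
  simp only [refMean, this] at hm
  simp at hm
  exact eq_zero_of_ev_eq_zero isOpen_univ univ_nonempty fun x _ => by rw [hc x 0, hm]

/-- The mean over the outer edge as a linear form. -/
def refMeanL : MvPolynomial (Fin 2) ℝ →ₗ[ℝ] ℝ where
  toFun := refMean
  map_add' := refMean_add
  map_smul' := refMean_smul

/-- The weighted Dirichlet form as a bilinear form. -/
def refGradL : MvPolynomial (Fin 2) ℝ →ₗ[ℝ] MvPolynomial (Fin 2) ℝ →ₗ[ℝ] ℝ :=
  LinearMap.mk₂ ℝ refGrad refGrad_add_left refGrad_smul_left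
    (fun P Q R => by rw [refGrad_comm, refGrad_add_left, refGrad_comm Q, refGrad_comm R])
    (fun r P Q => by rw [refGrad_comm, refGrad_smul_left, refGrad_comm Q]; rfl)

/-- The `L²` inner product as a bilinear form. -/
def refInnerL : MvPolynomial (Fin 2) ℝ →ₗ[ℝ] MvPolynomial (Fin 2) ℝ →ₗ[ℝ] ℝ :=
  LinearMap.mk₂ ℝ refInner refInner_add_left refInner_smul_left
    (fun P Q R => by rw [refInner_comm, refInner_add_left, refInner_comm Q, refInner_comm R])
    (fun r P Q => by rw [refInner_comm, refInner_smul_left, refInner_comm Q]; rfl)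

theorem refGradL_apply (P Q : MvPolynomial (Fin 2) ℝ) : refGradL P Q = refGrad P Q := rfl

theorem refInnerL_apply (P Q : MvPolynomial (Fin 2) ℝ) : refInnerL P Q = refInner P Q := rfl

theorem refMeanL_apply (P : MvPolynomial (Fin 2) ℝ) : refMeanL P = refMean P := rfl

theorem refGrad_sub_C (P : MvPolynomial (Fin 2) ℝ) (r : ℝ) :
    refGrad (P - C r) (P - C r) = refGrad P P := by
  simp only [refGrad, map_sub, pderiv_C, sub_zero]

/-- Polynomials of degree at most `k` with mean value zero over the outer edge. -/
def refZero (k : ℕ) : Submodule ℝ (MvPolynomial (Fin 2) ℝ) :=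
  restrictTotalDegree (Fin 2) ℝ k ⊓ LinearMap.ker refMeanL

instance (k : ℕ) : Module.Finite ℝ (refZero k) :=
  Submodule.finiteDimensional_of_le
    (inf_le_left : refZero k ≤ restrictTotalDegree (Fin 2) ℝ k)

theorem sub_C_refMean_mem {k : ℕ} {P : MvPolynomial (Fin 2) ℝ} (hP : P.totalDegree ≤ k) :
    P - C (refMean P) ∈ refZero k := by
  refine ⟨?_, ?_⟩
  · rw [SetLike.mem_coe, mem_restrictTotalDegree]
    refine (totalDegree_sub _ _).trans (max_le hP ?_)
    rw [totalDegree_C]; exact Nat.zero_le _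
  · rw [SetLike.mem_coe, LinearMap.mem_ker, map_sub, refMeanL_apply, refMeanL_apply, refMean_C,
      sub_self]

/-- On polynomials of degree at most `k` with zero mean over the outer edge, `refGrad` is positive
definite: a zero gradient forces a constant, and the mean forces it to vanish. Finite dimension
gives a constant depending on `k` only. -/
theorem exists_refInner_le (k : ℕ) : ∃ K : ℝ, 0 < K ∧ ∀ P : MvPolynomial (Fin 2) ℝ,
    P.totalDegree ≤ k →
      refInner (P - C (refMean P)) (P - C (refMean P)) ≤ K * refGrad P P := by
  have hpos : ∀ x : refZero k, x ≠ 0 →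
      0 < refGradL.compl₁₂ (refZero k).subtype (refZero k).subtype x x := by
    intro x hx
    rw [LinearMap.compl₁₂_apply, Submodule.subtype_apply, refGradL_apply]
    refine lt_of_le_of_ne (refGrad_nonneg x.1) fun h => hx (Subtype.ext ?_)
    exact eq_zero_of_refGrad_eq_zero h.symm x.2.2
  obtain ⟨K, hK⟩ := exists_quadratic_le _
    (refInnerL.compl₁₂ (refZero k).subtype (refZero k).subtype) hpos
  refine ⟨max K 1, by positivity, fun P hP => ?_⟩
  have h1 := hK ⟨_, sub_C_refMean_mem hP⟩
  rw [LinearMap.compl₁₂_apply, LinearMap.compl₁₂_apply, Submodule.subtype_apply, refGradL_apply,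
    refInnerL_apply, refGrad_sub_C] at h1
  exact h1.trans (mul_le_mul_of_nonneg_right (le_max_left _ _) (refGrad_nonneg P))

end Reference

/-! ### Integrals over edges -/

/-- Integrability over the segment from `a` to `b`. -/
def EdgeIntegrable (a b : Plane) (g : Plane → ℝ) : Prop :=
  IntervalIntegrable (fun t : ℝ => g (AffineMap.lineMap a b t)) volume 0 1

theorem continuous_lineMap (a b : Plane) :
    Continuous fun t : ℝ => (AffineMap.lineMap a b t : Plane) := by
  simp only [AffineMap.lineMap_apply]; fun_prop

theorem Continuous.edgeIntegrable {g : Plane → ℝ} (hg : Continuous g) (a b : Plane) :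
    EdgeIntegrable a b g := (hg.comp (continuous_lineMap a b)).intervalIntegrable _ _

theorem EdgeIntegrable.add {a b : Plane} {f g : Plane → ℝ} (hf : EdgeIntegrable a b f)
    (hg : EdgeIntegrable a b g) : EdgeIntegrable a b fun x => f x + g x :=
  IntervalIntegrable.add hf hg

theorem EdgeIntegrable.const_mul {a b : Plane} {f : Plane → ℝ} (hf : EdgeIntegrable a b f)
    (r : ℝ) : EdgeIntegrable a b fun x => r * f x :=
  IntervalIntegrable.const_mul hf r

theorem edgeIntegral_add {a b : Plane} {f g : Plane → ℝ} (hf : EdgeIntegrable a b f)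
    (hg : EdgeIntegrable a b g) :
    edgeIntegral a b (fun x => f x + g x) = edgeIntegral a b f + edgeIntegral a b g := by
  rw [edgeIntegral, intervalIntegral.integral_add hf hg, mul_add]; rfl

theorem edgeIntegral_sub {a b : Plane} {f g : Plane → ℝ} (hf : EdgeIntegrable a b f)
    (hg : EdgeIntegrable a b g) :
    edgeIntegral a b (fun x => f x - g x) = edgeIntegral a b f - edgeIntegral a b g := by
  rw [edgeIntegral, intervalIntegral.integral_sub hf hg, mul_sub]; rfl

theorem edgeIntegral_const_mul (a b : Plane) (f : Plane → ℝ) (r : ℝ) :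
    edgeIntegral a b (fun x => r * f x) = r * edgeIntegral a b f := by
  rw [edgeIntegral, intervalIntegral.integral_const_mul, edgeIntegral]; ring

theorem edgeIntegral_neg (a b : Plane) (f : Plane → ℝ) :
    edgeIntegral a b (fun x => -f x) = -edgeIntegral a b f := by
  rw [edgeIntegral, intervalIntegral.integral_neg, edgeIntegral]; ring

theorem edgeIntegral_congr {a b : Plane} {f g : Plane → ℝ} (h : ∀ x ∈ segment ℝ a b, f x = g x) :
    edgeIntegral a b f = edgeIntegral a b g := by
  rw [edgeIntegral, edgeIntegral]
  congr 1
  apply intervalIntegral.integral_congr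
  intro t ht
  rw [uIcc_of_le zero_le_one] at ht
  apply h
  rw [segment_eq_image_lineMap]
  exact ⟨t, ht, rfl⟩

theorem EdgeIntegrable.congr {a b : Plane} {f g : Plane → ℝ} (hf : EdgeIntegrable a b f)
    (h : ∀ x ∈ segment ℝ a b, f x = g x) : EdgeIntegrable a b g := by
  apply IntervalIntegrable.congr _ hf
  intro t ht
  rw [uIoc_of_le zero_le_one] at ht
  apply h
  rw [segment_eq_image_lineMap]
  exact ⟨t, Ioc_subset_Icc_self ht, rfl⟩

theorem edgeIntegral_comm (a b : Plane) (f : Plane → ℝ) :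
    edgeIntegral a b f = edgeIntegral b a f := by
  rw [edgeIntegral, edgeIntegral, dist_comm]
  congr 1
  have h := intervalIntegral.integral_comp_sub_left (a := (0 : ℝ)) (b := 1)
    (fun t => f (AffineMap.lineMap b a t)) 1
  rw [sub_self, sub_zero] at h
  rw [← h]
  congr 1
  ext t
  rw [AffineMap.lineMap_apply_one_sub]

theorem edgeIntegral_nonneg {a b : Plane} {f : Plane → ℝ} (h : ∀ x ∈ segment ℝ a b, 0 ≤ f x) :
    0 ≤ edgeIntegral a b f := by
  apply mul_nonneg dist_nonneg
  apply intervalIntegral.integral_nonneg zero_le_one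
  intro t ht
  apply h
  rw [segment_eq_image_lineMap]
  exact ⟨t, ht, rfl⟩

theorem edgeIntegral_mono {a b : Plane} {f g : Plane → ℝ} (hf : EdgeIntegrable a b f)
    (hg : EdgeIntegrable a b g) (h : ∀ x ∈ segment ℝ a b, f x ≤ g x) :
    edgeIntegral a b f ≤ edgeIntegral a b g := by
  have := edgeIntegral_nonneg (a := a) (b := b) (f := fun x => g x - f x)
    fun x hx => sub_nonneg.2 (h x hx)
  rw [edgeIntegral_sub hg hf] at this
  linarith

theorem rightNormal_swap (a b : Plane) : rightNormal b a = -rightNormal a b := by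
  rw [rightNormal, rightNormal, norm_sub_rev]
  ext i; fin_cases i <;> simp <;> ring

/-- The length in the arc length element cancels the normalization of the normal. -/
theorem edgeIntegral_rightNormal {a b : Plane} (hab : a ≠ b) (F₀ F₁ : Plane → ℝ) :
    edgeIntegral a b (fun x => F₀ x * rightNormal a b 0 + F₁ x * rightNormal a b 1) =
      flux F₀ F₁ a b := by
  have h1 : ‖b - a‖ ≠ 0 := norm_ne_zero_iff.2 (sub_ne_zero.2 hab.symm)
  rw [edgeIntegral, flux, ← intervalIntegral.integral_const_mul]
  congr 1
  ext t
  rw [dist_comm, dist_eq_norm]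
  simp [rightNormal]
  field_simp
  ring

/-! ### The elementwise divergence theorem and the adjointness of the two coupling forms. -/

namespace Mesh

variable {G : Geometry} {M : Mesh G}

/-- The triangle following `τ` in the same element. -/
def next (τ : M.Tri) : M.Tri := ⟨τ.1, τ.2 + 1⟩

theorem prev_next (τ : M.Tri) : M.prev (next τ) = τ :=
  Sigma.ext rfl (heq_of_eq (add_sub_cancel_right τ.2 1))

theorem next_prev (τ : M.Tri) : next (M.prev τ) = τ :=
  Sigma.ext rfl (heq_of_eq (sub_add_cancel τ.2 1))

/-- Cyclic rotation of the triangles in each element. -/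
def rotate : M.Tri ≃ M.Tri := ⟨next, M.prev, prev_next, next_prev⟩

theorem sum_next (f : M.Tri → ℝ) : ∑ τ, f (next τ) = ∑ τ, f τ := Equiv.sum_comp rotate f

theorem ne_center (τ : M.Tri) : M.ν τ ≠ M.va τ := by
  intro h
  have := cross_pos τ
  rw [h, sub_self] at this
  simp [cross] at this

/-- Each spoke is a side of two consecutive triangles, with opposite orientations; rotating the
index in each element collects both fluxes at the same spoke. -/
theorem sum_integral_divField {F₀ F₁ : M.Tri → Plane → ℝ} (h₀ : ∀ τ, ContDiff ℝ 1 (F₀ τ))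
    (h₁ : ∀ τ, ContDiff ℝ 1 (F₁ τ)) :
    ∑ τ, M.triIntegral τ (divField (F₀ τ) (F₁ τ)) =
      ∑ τ, flux (F₀ τ) (F₁ τ) (M.va τ) (M.vb τ) +
      ∑ τ, (flux (F₀ τ) (F₁ τ) (M.ν τ) (M.va τ) -
        flux (F₀ (M.prev τ)) (F₁ (M.prev τ)) (M.ν τ) (M.va τ)) := by
  have e : ∀ τ, M.triIntegral τ (divField (F₀ τ) (F₁ τ)) =
      flux (F₀ τ) (F₁ τ) (M.va τ) (M.vb τ) + flux (F₀ τ) (F₁ τ) (M.ν τ) (M.va τ) -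
      flux (F₀ τ) (F₁ τ) (M.ν τ) (M.vb τ) := fun τ =>
    integral_divField_triangle (h₀ τ) (h₁ τ) (cross_pos τ)
  have e2 : ∑ τ : M.Tri, flux (F₀ τ) (F₁ τ) (M.ν τ) (M.vb τ) =
      ∑ τ : M.Tri, flux (F₀ (M.prev τ)) (F₁ (M.prev τ)) (M.ν τ) (M.va τ) := by
    rw [← sum_next fun τ => flux (F₀ (M.prev τ)) (F₁ (M.prev τ)) (M.ν τ) (M.va τ)]
    apply Finset.sum_congr rfl
    intro τ _
    rw [prev_next]; rfl
  simp only [e]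
  rw [Finset.sum_sub_distrib, Finset.sum_add_distrib, e2, Finset.sum_sub_distrib]
  ring

theorem continuous_dotN (v : M.Vector) (τ : M.Tri) (n : Plane) : Continuous (dotN v τ n) := by
  unfold dotN; fun_prop

theorem continuous_dvg (v : M.Vector) (τ : M.Tri) : Continuous (dvg v τ) := by
  unfold dvg; fun_prop

theorem continuous_vec_dot_grad (v : M.Vector) (q : M.Scalar) (τ : M.Tri) :
    Continuous fun x => vec v τ x ⬝ᵥ grad q τ x := by
  simp only [dotProduct, vec, grad]; fun_prop

theorem integrableOn_triangle {f : Plane → ℝ} (hf : Continuous f) (τ : M.Tri) :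
    IntegrableOn f (M.triangle τ) := hf.continuousOn.integrableOn_compact (isCompact_triangle τ)

theorem divField_mul (v : M.Vector) (q : M.Scalar) (τ : M.Tri) (x : Plane) :
    divField (ev (q τ * v τ 0)) (ev (q τ * v τ 1)) x =
      ev (q τ) x * dvg v τ x + vec v τ x ⬝ᵥ grad q τ x := by
  simp [dvg, divField, fderiv_ev, Fin.sum_univ_two, vec, grad, dotProduct]
  ring

theorem flux_eq_outerIntegral (v : M.Vector) (q : M.Scalar) (τ : M.Tri) :
    flux (ev (q τ * v τ 0)) (ev (q τ * v τ 1)) (M.va τ) (M.vb τ) =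
      M.outerIntegral τ fun x => ev (q τ) x * dotN v τ (M.outerNormal τ) x := by
  rw [← edgeIntegral_rightNormal (va_ne_vb τ), outerIntegral]
  congr 1
  ext x
  simp [dotN, outerNormal, Fin.sum_univ_two]
  ring

theorem flux_eq_spokeIntegral (v : M.Vector) (q : M.Scalar) (τ σ : M.Tri) :
    flux (ev (q σ * v σ 0)) (ev (q σ * v σ 1)) (M.ν τ) (M.va τ) =
      -edgeIntegral (M.ν τ) (M.va τ) fun x => ev (q σ) x * dotN v σ (M.spokeNormal τ) x := by
  rw [← edgeIntegral_rightNormal (ne_center τ), ← edgeIntegral_neg]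
  congr 1
  ext x
  rw [spokeNormal, rightNormal_swap]
  simp [dotN, Fin.sum_univ_two]
  ring

/-- This is the divergence theorem for `q v`. Since `v · n` is single-valued on a spoke, its
contribution there is `v · n` times the jump of `q`, which is the spoke term of `bForm`. Only outer
edges and divergences remain. -/
theorem bForm_eq {k : ℕ} {v : M.Vector} (hv : v ∈ M.Vh k) (q : M.Scalar) :
    bForm v q = (∑ τ, M.outerIntegral τ fun x => ev (q τ) x * dotN v τ (M.outerNormal τ) x) -
      ∑ τ, M.triIntegral τ fun x => ev (q τ) x * dvg v τ x := by
  have key := sum_integral_divField (M := M) (F₀ := fun τ => ev (q τ * v τ 0))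
    (F₁ := fun τ => ev (q τ * v τ 1)) (fun τ => contDiff_ev _) (fun τ => contDiff_ev _)
  simp only [flux_eq_outerIntegral] at key
  have e1 : ∀ τ, M.triIntegral τ (divField (ev (q τ * v τ 0)) (ev (q τ * v τ 1))) =
      M.triIntegral τ (fun x => ev (q τ) x * dvg v τ x) +
      M.triIntegral τ (fun x => vec v τ x ⬝ᵥ grad q τ x) := by
    intro τ
    simp only [triIntegral, divField_mul]
    exact integral_add (integrableOn_triangle ((continuous_ev _).mul (continuous_dvg v τ)) τ)
      (integrableOn_triangle (continuous_vec_dot_grad v q τ) τ)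
  have e2 : ∀ τ, flux (ev (q τ * v τ 0)) (ev (q τ * v τ 1)) (M.ν τ) (M.va τ) -
      flux (ev (q (M.prev τ) * v (M.prev τ) 0)) (ev (q (M.prev τ) * v (M.prev τ) 1))
        (M.ν τ) (M.va τ) = edgeIntegral (M.ν τ) (M.va τ) fun x =>
      dotN v τ (M.spokeNormal τ) x * jump q (M.prev τ, τ) x := by
    intro τ
    -- The spoke normal belongs to the direction from `va` to `ν`, opposite to the flux, which turns
    -- the difference of fluxes around.
    rw [flux_eq_spokeIntegral, flux_eq_spokeIntegral, neg_sub_neg, ← edgeIntegral_sub]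
    · apply edgeIntegral_congr
      intro x hx
      have := hv.2 τ x hx
      rw [sub_eq_zero] at this
      rw [this, jump]; ring
    · exact Continuous.edgeIntegrable ((continuous_ev _).mul (continuous_dotN _ _ _)) _ _
    · exact Continuous.edgeIntegrable ((continuous_ev _).mul (continuous_dotN _ _ _)) _ _
  simp only [e1, e2] at key
  rw [Finset.sum_add_distrib] at key
  rw [bForm]
  linarith

theorem outerIntegral_reversed {τ τ' : M.Tri} (h : M.va τ' = M.vb τ ∧ M.vb τ' = M.va τ)
    (f : Plane → ℝ) : M.outerIntegral τ' f = M.outerIntegral τ f := by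
  rw [outerIntegral, outerIntegral, h.1, h.2, edgeIntegral_comm]

theorem outerNormal_reversed {τ τ' : M.Tri} (h : M.va τ' = M.vb τ ∧ M.vb τ' = M.va τ) :
    M.outerNormal τ' = -M.outerNormal τ := by
  rw [outerNormal, outerNormal, h.1, h.2, rightNormal_swap]

theorem dotN_neg (v : M.Vector) (τ : M.Tri) (n x : Plane) : dotN v τ (-n) x = -dotN v τ n x := by
  simp [dotN]

theorem outerIntegral_add {τ : M.Tri} {f g : Plane → ℝ}
    (hf : EdgeIntegrable (M.va τ) (M.vb τ) f) (hg : EdgeIntegrable (M.va τ) (M.vb τ) g) :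
    M.outerIntegral τ (fun x => f x + g x) = M.outerIntegral τ f + M.outerIntegral τ g :=
  edgeIntegral_add hf hg

/-- Pairing the outer edges, `q` is single-valued on interior edges and zero on the boundary, while
on the fracture `q₁ v₁ - q₂ v₂ = [q]{v} + {q}[v]`. This adjointness cancels the coupling terms on
the diagonal and lets the Darcy equation be read through `bForm`. -/
theorem bForm_eq_bStarForm (hM : M.IsStar) {k : ℕ} {v : M.Vector} (hv : v ∈ M.Vh k)
    {q : M.Scalar} (hq : q ∈ M.Sh k) : bForm v q = bStarForm q v := by
  rw [bForm_eq hv, bStarForm, sum_eq_sum_edges hM]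
  · have e1 : ∀ e ∈ M.interiorEdges,
        ((M.outerIntegral e.1 fun x => ev (q e.1) x * dotN v e.1 (M.outerNormal e.1) x) +
        M.outerIntegral e.2 fun x => ev (q e.2) x * dotN v e.2 (M.outerNormal e.2) x) =
        M.outerIntegral e.1 fun x => ev (q e.1) x * jumpN v e x := by
      intro e he
      have hr := reversed_of_mem_interiorEdges he
      rw [outerIntegral_reversed hr, outerNormal_reversed hr, ← outerIntegral_add]
      · apply edgeIntegral_congr
        intro x hx
        have := hq.2.1 e he x hx
        rw [jump, sub_eq_zero] at this
        rw [jumpN, ← this, dotN_neg]; ring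
      · exact Continuous.edgeIntegrable ((continuous_ev _).mul (continuous_dotN _ _ _)) _ _
      · exact Continuous.edgeIntegrable ((continuous_ev _).mul (continuous_dotN _ _ _)) _ _
    have e2 : ∀ e ∈ M.fractureEdges,
        ((M.outerIntegral e.1 fun x => ev (q e.1) x * dotN v e.1 (M.outerNormal e.1) x) +
        M.outerIntegral e.2 fun x => ev (q e.2) x * dotN v e.2 (M.outerNormal e.2) x) =
        (M.outerIntegral e.1 fun x => jump q e x * avgN v e x) +
        M.outerIntegral e.1 fun x => avg q e x * jumpN v e x := by
      intro e he
      have hr := reversed_of_mem_fractureEdges he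
      have c1 := continuous_dotN v e.1 (M.outerNormal e.1)
      have c2 := continuous_dotN v e.2 (M.outerNormal e.1)
      rw [outerIntegral_reversed hr, outerNormal_reversed hr, ← outerIntegral_add,
        ← outerIntegral_add]
      · apply edgeIntegral_congr
        intro x hx
        rw [jumpN, avgN, jump, avg, dotN_neg]; ring
      · refine Continuous.edgeIntegrable ?_ _ _
        unfold jump avgN; fun_prop
      · refine Continuous.edgeIntegrable ?_ _ _
        unfold avg jumpN; fun_prop
      · exact Continuous.edgeIntegrable ((continuous_ev _).mul (continuous_dotN _ _ _)) _ _
      · exact Continuous.edgeIntegrable ((continuous_ev _).mul (continuous_dotN _ _ _)) _ _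
    rw [Finset.sum_congr rfl e1, Finset.sum_congr rfl e2, Finset.sum_add_distrib]
    ring
  · intro τ hτ
    have : M.outerIntegral τ (fun x => ev (q τ) x * dotN v τ (M.outerNormal τ) x) =
        M.outerIntegral τ fun x => 0 * x 0 := by
      apply edgeIntegral_congr
      intro x hx
      rw [hq.2.2 τ hτ x hx]; ring
    rw [this, outerIntegral, edgeIntegral_const_mul, zero_mul]

end Mesh

/-! ### Inverses of elliptic matrices -/

section Elliptic

variable {A : Matrix (Fin 2) (Fin 2) ℝ} {κ : ℝ}

theorem mul_dot_le_of_elliptic (h : ∀ z : Fin 2 → ℝ, z ⬝ᵥ z = 1 → κ ≤ (A *ᵥ z) ⬝ᵥ z)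
    (z : Fin 2 → ℝ) : κ * (z ⬝ᵥ z) ≤ (A *ᵥ z) ⬝ᵥ z := by
  by_cases hz : z = 0
  · simp [hz]
  have hpos : 0 < z ⬝ᵥ z := by
    refine lt_of_le_of_ne ?_ (fun h => hz (dotProduct_self_eq_zero.1 h.symm))
    simp only [dotProduct, Fin.sum_univ_two]; nlinarith [sq_nonneg (z 0), sq_nonneg (z 1)]
  set s := Real.sqrt (z ⬝ᵥ z)
  have hs : 0 < s := Real.sqrt_pos.2 hpos
  have hss : s * s = z ⬝ᵥ z := Real.mul_self_sqrt hpos.le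
  have h1 := h (s⁻¹ • z) (by
    rw [smul_dotProduct, dotProduct_smul, smul_eq_mul, smul_eq_mul, ← hss]; field_simp)
  rw [Matrix.mulVec_smul, smul_dotProduct, dotProduct_smul, smul_eq_mul, smul_eq_mul] at h1
  calc κ * (z ⬝ᵥ z) ≤ (s⁻¹ * (s⁻¹ * (A *ᵥ z ⬝ᵥ z))) * (s * s) := by
        rw [hss]; gcongr
    _ = A *ᵥ z ⬝ᵥ z := by field_simp

variable (hκ : 0 < κ) (h : ∀ z : Fin 2 → ℝ, z ⬝ᵥ z = 1 → κ ≤ (A *ᵥ z) ⬝ᵥ z)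

include hκ h in
-- Ellipticity excludes a kernel, so `A⁻¹` is a true inverse.
theorem mulVec_inv_of_elliptic (y : Fin 2 → ℝ) : A *ᵥ (A⁻¹ *ᵥ y) = y := by
  have hdet : IsUnit A.det := by
    rw [isUnit_iff_ne_zero]
    intro hd
    obtain ⟨z, hz, hz0⟩ := Matrix.exists_mulVec_eq_zero_iff.2 hd
    have h1 := mul_dot_le_of_elliptic h z
    rw [hz0, zero_dotProduct] at h1
    have : 0 ≤ z ⬝ᵥ z := by
      simp only [dotProduct, Fin.sum_univ_two]; nlinarith [sq_nonneg (z 0), sq_nonneg (z 1)]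
    have : z ⬝ᵥ z = 0 := by nlinarith
    exact hz (dotProduct_self_eq_zero.1 this)
  rw [Matrix.mulVec_mulVec, Matrix.mul_nonsing_inv _ hdet, Matrix.one_mulVec]

include hκ h in
theorem elliptic_inv_le (y : Fin 2 → ℝ) :
    κ * ((A⁻¹ *ᵥ y) ⬝ᵥ (A⁻¹ *ᵥ y)) ≤ (A⁻¹ *ᵥ y) ⬝ᵥ y := by
  have h1 := mul_dot_le_of_elliptic h (A⁻¹ *ᵥ y)
  rwa [mulVec_inv_of_elliptic hκ h, dotProduct_comm y] at h1

theorem sum_sq_dot_nonneg (y : Fin 2 → ℝ) : 0 ≤ y ⬝ᵥ y := by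
  simp only [dotProduct, Fin.sum_univ_two]; nlinarith [sq_nonneg (y 0), sq_nonneg (y 1)]

include hκ h in
theorem elliptic_inv_nonneg (y : Fin 2 → ℝ) : 0 ≤ (A⁻¹ *ᵥ y) ⬝ᵥ y :=
  (mul_nonneg hκ.le (sum_sq_dot_nonneg _)).trans (elliptic_inv_le hκ h y)

include hκ h in
theorem eq_zero_of_elliptic_inv (y : Fin 2 → ℝ) (h0 : (A⁻¹ *ᵥ y) ⬝ᵥ y = 0) : y = 0 := by
  have h1 := elliptic_inv_le hκ h y
  have h2 := sum_sq_dot_nonneg (A⁻¹ *ᵥ y)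
  have : A⁻¹ *ᵥ y = 0 := dotProduct_self_eq_zero.1 (by nlinarith)
  rw [← mulVec_inv_of_elliptic hκ h y, this, Matrix.mulVec_zero]

include hκ h in
theorem elliptic_inv_upper (y : Fin 2 → ℝ) : (A⁻¹ *ᵥ y) ⬝ᵥ y ≤ κ⁻¹ * (y ⬝ᵥ y) := by
  have h1 := elliptic_inv_le hκ h y
  set w := A⁻¹ *ᵥ y
  -- Expanding `0 ≤ |κ w - y|²` and using `κ |w|² ≤ w · y` gives `κ w · y ≤ |y|²`.
  have h2 := sum_sq_dot_nonneg (κ • w - y)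
  have h3 : (κ • w - y) ⬝ᵥ (κ • w - y) = κ * (κ * (w ⬝ᵥ w)) - 2 * κ * (w ⬝ᵥ y) + y ⬝ᵥ y := by
    simp [dotProduct, Fin.sum_univ_two]; ring
  rw [h3] at h2
  have h4 : κ * (w ⬝ᵥ y) ≤ y ⬝ᵥ y := by nlinarith
  rw [inv_mul_eq_div, le_div_iff₀ hκ, mul_comm]
  exact h4

include hκ h in
-- Bounded measurable entries make the weighted products of continuous fields integrable.
theorem abs_elliptic_inv_apply_le (i j : Fin 2) : |A⁻¹ i j| ≤ κ⁻¹ := by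
  have h1 := elliptic_inv_le hκ h (Pi.single j 1)
  have h2 := elliptic_inv_upper hκ h (Pi.single j 1)
  have h3 : κ * ((A⁻¹ *ᵥ Pi.single j 1) ⬝ᵥ (A⁻¹ *ᵥ Pi.single j 1)) ≤ κ⁻¹ := by
    refine (h1.trans h2).trans ?_
    simp
  have h4 : A⁻¹ i j ^ 2 ≤ (A⁻¹ *ᵥ Pi.single j 1) ⬝ᵥ (A⁻¹ *ᵥ Pi.single j 1) := by
    simp only [Matrix.mulVec_single_one, dotProduct, Fin.sum_univ_two, Matrix.col_apply]
    fin_cases i <;> simp <;> nlinarith [sq_nonneg (A⁻¹ 0 j), sq_nonneg (A⁻¹ 1 j)]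
  apply abs_le_of_sq_le_sq _ (by positivity)
  have h5 : κ * A⁻¹ i j ^ 2 ≤ κ⁻¹ := (mul_le_mul_of_nonneg_left h4 hκ.le).trans h3
  have : A⁻¹ i j ^ 2 ≤ κ⁻¹ * κ⁻¹ := by
    rw [inv_mul_eq_div, le_div_iff₀ hκ, mul_comm]; exact h5
  rw [sq κ⁻¹]; exact this

theorem dot_inv_comm (hA : A.IsSymm) (y w : Fin 2 → ℝ) :
    (A⁻¹ *ᵥ y) ⬝ᵥ w = (A⁻¹ *ᵥ w) ⬝ᵥ y := by
  have : (A⁻¹)ᵀ = A⁻¹ := by rw [Matrix.transpose_nonsing_inv, hA.eq]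
  rw [dotProduct_comm, Matrix.dotProduct_mulVec, ← Matrix.mulVec_transpose, this]

end Elliptic

/-- The discriminant form of Cauchy–Schwarz. -/
theorem sq_le_mul_of_quadratic_nonneg {a b c : ℝ} (h : ∀ t : ℝ, 0 ≤ t ^ 2 * a - 2 * t * b + c) :
    b ^ 2 ≤ a * c := by
  have h1 := discrim_le_zero (a := a) (b := -2 * b) (c := c) fun t => by
    have := h t; linarith
  rw [discrim] at h1
  nlinarith

/-! ### The velocity product weighted by the inverse permeability. -/

namespace Mesh

variable {G : Geometry} {M : Mesh G}

theorem restrict_triangle_le (hM : M.IsStar) (τ : M.Tri) :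
    volume.restrict (M.triangle τ) ≤ volume.restrict G.bulk := by
  apply Measure.restrict_mono_ae
  rw [ae_le_set]
  exact volume_triangle_diff_bulk hM τ

theorem triangle_ae_of_bulk (hM : M.IsStar) (τ : M.Tri) {P : Plane → Prop}
    (h : ∀ᵐ x ∂volume.restrict G.bulk, P x) : ∀ᵐ x ∂volume.restrict (M.triangle τ), P x :=
  ae_mono (restrict_triangle_le hM τ) h

theorem aemeasurable_inv (c : Coefficients G) (i j : Fin 2) :
    AEMeasurable (fun x => (c.K x)⁻¹ i j) (volume.restrict G.bulk) := by
  have h00 := c.K_meas 0 0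
  have h01 := c.K_meas 0 1
  have h10 := c.K_meas 1 0
  have h11 := c.K_meas 1 1
  have hdet : AEMeasurable (fun x => (c.K x).det) (volume.restrict G.bulk) := by
    simp only [Matrix.det_fin_two]
    exact (h00.mul h11).sub (h01.mul h10)
  have : ∀ x, (c.K x)⁻¹ i j = (c.K x).det⁻¹ * !![c.K x 1 1, -c.K x 0 1; -c.K x 1 0, c.K x 0 0] i j := by
    intro x
    rw [Matrix.inv_def, Matrix.adjugate_fin_two, Ring.inverse_eq_inv']
    rfl
  simp only [this]
  apply hdet.inv.mul
  fin_cases i <;> fin_cases j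
  · exact h11
  · exact h01.neg
  · exact h10.neg
  · exact h00

/-- The bilinear form of `K⁻¹` on the triangle `τ`. -/
def massT (c : Coefficients G) (τ : M.Tri) (V W : Plane → Fin 2 → ℝ) : ℝ :=
  M.triIntegral τ fun x => ((c.K x)⁻¹ *ᵥ V x) ⬝ᵥ W x

theorem integrableOn_mass (hM : M.IsStar) (c : Coefficients G) (τ : M.Tri)
    {V W : Plane → Fin 2 → ℝ} (hV : Continuous V) (hW : Continuous W) :
    IntegrableOn (fun x => ((c.K x)⁻¹ *ᵥ V x) ⬝ᵥ W x) (M.triangle τ) := by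
  have key : ∀ i j : Fin 2, IntegrableOn (fun x => (c.K x)⁻¹ i j * (V x j * W x i))
      (M.triangle τ) := by
    intro i j
    apply Integrable.bdd_mul (c := c.K₁⁻¹)
    · apply integrableOn_triangle
      exact ((continuous_apply j).comp hV).mul ((continuous_apply i).comp hW)
    · exact ((aemeasurable_inv c i j).mono_measure (restrict_triangle_le hM τ)).aestronglyMeasurable
    · filter_upwards [triangle_ae_of_bulk hM τ c.K_bounds] with x hx
      exact abs_elliptic_inv_apply_le c.K₁_pos (fun z hz => (hx z hz).1) i j
  have e : (fun x => ((c.K x)⁻¹ *ᵥ V x) ⬝ᵥ W x) = fun x =>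
      ((c.K x)⁻¹ 0 0 * (V x 0 * W x 0) + (c.K x)⁻¹ 0 1 * (V x 1 * W x 0)) +
      ((c.K x)⁻¹ 1 0 * (V x 0 * W x 1) + (c.K x)⁻¹ 1 1 * (V x 1 * W x 1)) := by
    ext x
    simp [dotProduct, Matrix.mulVec, Fin.sum_univ_two]; ring
  rw [e]
  exact ((key 0 0).add (key 0 1)).add ((key 1 0).add (key 1 1))

theorem massT_add_left (hM : M.IsStar) (c : Coefficients G) (τ : M.Tri)
    {U V W : Plane → Fin 2 → ℝ} (hU : Continuous U) (hV : Continuous V) (hW : Continuous W) :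
    massT c τ (U + V) W = massT c τ U W + massT c τ V W := by
  simp only [massT, triIntegral]
  rw [← integral_add (integrableOn_mass hM c τ hU hW) (integrableOn_mass hM c τ hV hW)]
  congr 1; ext x
  rw [Pi.add_apply, Matrix.mulVec_add, add_dotProduct]

theorem massT_smul_left (c : Coefficients G) (τ : M.Tri) (r : ℝ) (V W : Plane → Fin 2 → ℝ) :
    massT c τ (r • V) W = r * massT c τ V W := by
  simp only [massT, triIntegral]
  rw [← integral_const_mul]
  congr 1; ext x
  rw [Pi.smul_apply, Matrix.mulVec_smul, smul_dotProduct, smul_eq_mul]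

theorem massT_comm (hM : M.IsStar) (c : Coefficients G) (τ : M.Tri) (V W : Plane → Fin 2 → ℝ) :
    massT c τ V W = massT c τ W V := by
  apply integral_congr_ae
  filter_upwards [triangle_ae_of_bulk hM τ c.K_symm] with x hx
  exact dot_inv_comm hx _ _

theorem massT_nonneg (hM : M.IsStar) (c : Coefficients G) (τ : M.Tri) (V : Plane → Fin 2 → ℝ) :
    0 ≤ massT c τ V V := by
  apply integral_nonneg_of_ae
  filter_upwards [triangle_ae_of_bulk hM τ c.K_bounds] with x hx
  exact elliptic_inv_nonneg c.K₁_pos (fun z hz => (hx z hz).1) _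

theorem massT_le (hM : M.IsStar) (c : Coefficients G) (τ : M.Tri) {V : Plane → Fin 2 → ℝ}
    (hV : Continuous V) : massT c τ V V ≤ c.K₁⁻¹ * M.triIntegral τ fun x => V x ⬝ᵥ V x := by
  rw [triIntegral, ← integral_const_mul]
  apply integral_mono_ae (integrableOn_mass hM c τ hV hV)
  · apply Integrable.const_mul
    apply integrableOn_triangle
    simp only [dotProduct]; fun_prop
  · filter_upwards [triangle_ae_of_bulk hM τ c.K_bounds] with x hx
    exact elliptic_inv_upper c.K₁_pos (fun z hz => (hx z hz).1) _

theorem interior_triangle_nonempty (τ : M.Tri) : (interior (M.triangle τ)).Nonempty :=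
  (M.elt τ.1).interior_tri_nonempty τ.2

/-- Positivity of `K⁻¹` makes the field zero almost everywhere, and continuity extends this to the
open triangle. -/
theorem eqOn_interior_of_massT_eq_zero (hM : M.IsStar) (c : Coefficients G) (τ : M.Tri)
    {V : Plane → Fin 2 → ℝ} (hV : Continuous V) (h : massT c τ V V = 0) :
    EqOn V 0 (interior (M.triangle τ)) := by
  have h0 : (fun x => ((c.K x)⁻¹ *ᵥ V x) ⬝ᵥ V x) =ᵐ[volume.restrict (M.triangle τ)] 0 := by
    rw [← setIntegral_eq_zero_iff_of_nonneg_ae _ (integrableOn_mass hM c τ hV hV)]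
    · exact h
    · filter_upwards [triangle_ae_of_bulk hM τ c.K_bounds] with x hx
      exact elliptic_inv_nonneg c.K₁_pos (fun z hz => (hx z hz).1) _
  apply Measure.eqOn_open_of_ae_eq (μ := volume) _ isOpen_interior hV.continuousOn
    continuousOn_const
  apply ae_restrict_of_ae_restrict_of_subset interior_subset
  filter_upwards [h0, triangle_ae_of_bulk hM τ c.K_bounds] with x hx hx2
  exact eq_zero_of_elliptic_inv c.K₁_pos (fun z hz => (hx2 z hz).1) _ hx

@[fun_prop] theorem continuous_vec (v : M.Vector) (τ : M.Tri) : Continuous (vec v τ) := by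
  unfold vec; fun_prop

theorem vec_add (u v : M.Vector) (τ : M.Tri) : vec (u + v) τ = vec u τ + vec v τ := by
  ext x i; simp [vec]

theorem vec_smul (r : ℝ) (v : M.Vector) (τ : M.Tri) : vec (r • v) τ = r • vec v τ := by
  ext x i; simp [vec]

theorem eq_zero_of_massT_eq_zero (hM : M.IsStar) (c : Coefficients G) (τ : M.Tri) {v : M.Vector}
    (h : massT c τ (vec v τ) (vec v τ) = 0) : v τ = 0 := by
  ext1 i
  apply eq_zero_of_ev_eq_zero isOpen_interior (interior_triangle_nonempty τ)
  intro x hx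
  exact congrFun (eqOn_interior_of_massT_eq_zero hM c τ (continuous_vec v τ) h hx) i

theorem mass_eq_sum (c : Coefficients G) (u v : M.Vector) :
    mass c u v = ∑ τ, massT c τ (vec u τ) (vec v τ) := rfl

/-- The bilinear form of `K⁻¹` on the primal element number `j`. -/
def massE (c : Coefficients G) (j : Fin M.N) (u v : M.Vector) : ℝ :=
  ∑ i, massT c ⟨j, i⟩ (vec u ⟨j, i⟩) (vec v ⟨j, i⟩)

theorem mass_eq_sum_massE (c : Coefficients G) (u v : M.Vector) :
    mass c u v = ∑ j, massE c j u v := by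
  rw [mass_eq_sum, Fintype.sum_sigma]; rfl

theorem massE_nonneg (hM : M.IsStar) (c : Coefficients G) (j : Fin M.N) (u : M.Vector) :
    0 ≤ massE c j u u := Finset.sum_nonneg fun _ _ => massT_nonneg hM c _ _

theorem massE_sq_le (hM : M.IsStar) (c : Coefficients G) (j : Fin M.N) (u v : M.Vector) :
    massE c j u v ^ 2 ≤ massE c j u u * massE c j v v := by
  apply sq_le_mul_of_quadratic_nonneg
  intro t
  have h := massE_nonneg hM c j (t • u + (-1 : ℝ) • v)
  have e : massE c j (t • u + (-1 : ℝ) • v) (t • u + (-1 : ℝ) • v) =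
      t ^ 2 * massE c j u u - 2 * t * massE c j u v + massE c j v v := by
    simp only [massE, Finset.mul_sum, ← Finset.sum_sub_distrib, ← Finset.sum_add_distrib]
    apply Finset.sum_congr rfl
    intro i _
    have cu := continuous_vec u ⟨j, i⟩
    have cv := continuous_vec v ⟨j, i⟩
    have a1 : ∀ W, Continuous W → massT c (⟨j, i⟩ : M.Tri)
        (vec (t • u + (-1 : ℝ) • v) ⟨j, i⟩) W =
        t * massT c ⟨j, i⟩ (vec u ⟨j, i⟩) W - massT c ⟨j, i⟩ (vec v ⟨j, i⟩) W := by
      intro W hW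
      rw [vec_add, vec_smul, vec_smul, massT_add_left hM c _ (cu.const_smul t)
        (cv.const_smul _) hW, massT_smul_left, massT_smul_left]
      ring
    rw [a1 _ (continuous_vec _ _), massT_comm hM c _ (vec u _), massT_comm hM c _ (vec v ⟨j, i⟩),
      a1 _ cu, a1 _ cv, massT_comm hM c _ (vec v ⟨j, i⟩) (vec u ⟨j, i⟩)]
    ring
  linarith

theorem massE_le (hM : M.IsStar) (c : Coefficients G) (j : Fin M.N) (v : M.Vector) :
    massE c j v v ≤ c.K₁⁻¹ * ∑ i, M.triIntegral ⟨j, i⟩ fun x =>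
      vec v ⟨j, i⟩ x ⬝ᵥ vec v ⟨j, i⟩ x := by
  rw [Finset.mul_sum]
  exact Finset.sum_le_sum fun i _ => massT_le hM c _ (continuous_vec v _)

end Mesh

/-! ### Reference coordinates and the Darcy equation tested in one element. -/

theorem aff_edge (o p q : Plane) (t : ℝ) :
    aff o (p - o) (q - o) (1 - t, t) = AffineMap.lineMap p q t := by
  ext i; simp [aff, AffineMap.lineMap_apply]; ring

theorem volume_refTri : ∫ _ in refTri, (1 : ℝ) = 1 / 2 := by
  rw [integral_refTri _ continuous_const]
  have : ∀ t : ℝ, ∫ _ in (0 : ℝ)..(1 - t), (1 : ℝ) = 1 - t := by intro t; simp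
  simp only [this]
  rw [intervalIntegral.integral_sub (by simp) (by simp)]
  simp; norm_num

/-- Normal traces on a spoke become determinants with the spoke vector, so tangency and normal
continuity are questions about `cross`. -/
theorem dot_rightNormal_spoke (w p q : Plane) :
    w 0 * rightNormal q p 0 + w 1 * rightNormal q p 1 = ‖p - q‖⁻¹ * cross (q - p) w := by
  simp [rightNormal, cross]; ring

namespace Mesh

variable {G : Geometry} {M : Mesh G}

/-- The Jacobian of the affine parametrization of `τ`, that is twice its area. -/
def jac (τ : M.Tri) : ℝ := cross (M.va τ - M.ν τ) (M.vb τ - M.ν τ)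

theorem jac_pos (τ : M.Tri) : 0 < jac τ := cross_pos τ

/-- The affine parametrization of `τ` over the reference triangle. -/
def par (τ : M.Tri) (z : ℝ × ℝ) : Plane := aff (M.ν τ) (M.va τ - M.ν τ) (M.vb τ - M.ν τ) z

/-- The polynomial `q|_τ` in reference coordinates. -/
def pullT (q : M.Scalar) (τ : M.Tri) : MvPolynomial (Fin 2) ℝ :=
  pull (M.ν τ) (M.va τ - M.ν τ) (M.vb τ - M.ν τ) (q τ)

theorem triIntegral_eq (τ : M.Tri) (g : Plane → ℝ) :
    M.triIntegral τ g = jac τ * ∫ z in refTri, g (par τ z) :=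
  setIntegral_triangle (cross_pos τ) g

theorem continuous_par (τ : M.Tri) : Continuous (par τ) := continuous_aff _ _ _

theorem evr_pullT (q : M.Scalar) (τ : M.Tri) (z : ℝ × ℝ) :
    evr (pullT q τ) z = ev (q τ) (par τ z) := evr_pull _ _ _ _ _

theorem diam_nonneg (j : Fin M.N) : 0 ≤ Metric.diam (M.elt j).carrier := Metric.diam_nonneg

theorem norm_va_sub_le (τ : M.Tri) : ‖M.va τ - M.ν τ‖ ≤ Metric.diam (M.elt τ.1).carrier := by
  rw [← dist_eq_norm]
  exact Metric.dist_le_diam_of_mem (M.elt τ.1).isCompact_carrier.isBounded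
    (outerEdge_subset_carrier τ (left_mem_segment _ _ _))
    (triangle_subset_carrier τ ((M.elt τ.1).center_mem_tri τ.2))

theorem norm_vb_sub_le (τ : M.Tri) : ‖M.vb τ - M.ν τ‖ ≤ Metric.diam (M.elt τ.1).carrier := by
  rw [← dist_eq_norm]
  exact Metric.dist_le_diam_of_mem (M.elt τ.1).isCompact_carrier.isBounded
    (outerEdge_subset_carrier τ (right_mem_segment _ _ _))
    (triangle_subset_carrier τ ((M.elt τ.1).center_mem_tri τ.2))

/-- A field living in one element sees only the velocity there; Cauchy–Schwarz and the bound on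
`K⁻¹` then give purely local control of `p`. -/
theorem bForm_sq_le (hM : M.IsStar) {c : Coefficients G} {k : ℕ} {u : M.Vector} {p : M.Scalar}
    (hp : p ∈ M.Sh k) (hd : ∀ v ∈ M.Vh k, mass c u v + bStarForm p v = 0) {v : M.Vector}
    (hv : v ∈ M.Vh k) (j : Fin M.N) (hj : ∀ τ : M.Tri, τ.1 ≠ j → v τ = 0) :
    bForm v p ^ 2 ≤ massE c j u u * (c.K₁⁻¹ * ∑ i, M.triIntegral ⟨j, i⟩ fun x =>
      vec v ⟨j, i⟩ x ⬝ᵥ vec v ⟨j, i⟩ x) := by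
  have h1 := hd v hv
  rw [← bForm_eq_bStarForm hM hv hp] at h1
  have h2 : mass c u v = massE c j u v := by
    rw [mass_eq_sum_massE]
    apply Finset.sum_eq_single j _ (by simp)
    intro j' _ hne
    apply Finset.sum_eq_zero
    intro i _
    have : vec v ⟨j', i⟩ = 0 := by ext x l; simp [vec, hj ⟨j', i⟩ hne]
    rw [this, massT_comm hM, ← zero_smul ℝ (0 : Plane → Fin 2 → ℝ), massT_smul_left, zero_mul]
  have h3 : bForm v p ^ 2 = massE c j u v ^ 2 := by
    rw [← h2, show bForm v p = -mass c u v by linarith, neg_sq]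
  rw [h3]
  exact (massE_sq_le hM c j u v).trans
    (mul_le_mul_of_nonneg_left (massE_le hM c j v) (massE_nonneg hM c j u))

/-! ### The gradient test field -/

section GradTest

open MvPolynomial

/-- The first barycentric coordinate function of `τ`. -/
def bary₁ (τ : M.Tri) : MvPolynomial (Fin 2) ℝ :=
  C (-(M.ν τ 0 * (M.vb τ - M.ν τ) 1 - M.ν τ 1 * (M.vb τ - M.ν τ) 0) / jac τ) +
    C ((M.vb τ - M.ν τ) 1 / jac τ) * X 0 + C (-(M.vb τ - M.ν τ) 0 / jac τ) * X 1

/-- The second barycentric coordinate function of `τ`. -/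
def bary₂ (τ : M.Tri) : MvPolynomial (Fin 2) ℝ :=
  C (-((M.va τ - M.ν τ) 0 * M.ν τ 1 - (M.va τ - M.ν τ) 1 * M.ν τ 0) / jac τ) +
    C (-(M.va τ - M.ν τ) 1 / jac τ) * X 0 + C ((M.va τ - M.ν τ) 0 / jac τ) * X 1

theorem ev_bary₁ (τ : M.Tri) (x : Plane) :
    ev (bary₁ τ) x = cross (x - M.ν τ) (M.vb τ - M.ν τ) / jac τ := by
  simp [bary₁, cross]; ring

theorem ev_bary₂ (τ : M.Tri) (x : Plane) :
    ev (bary₂ τ) x = cross (M.va τ - M.ν τ) (x - M.ν τ) / jac τ := by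
  simp [bary₂, cross]; ring

/-- `s ∂_d P`, where `d` is a direction and `s` a polynomial. -/
def dirTerm (s P : MvPolynomial (Fin 2) ℝ) (d : Plane) : MvPolynomial (Fin 2) ℝ :=
  d 0 • (s * pderiv 0 P) + d 1 • (s * pderiv 1 P)

theorem ev_dirTerm (s P : MvPolynomial (Fin 2) ℝ) (d x : Plane) :
    ev (dirTerm s P d) x = ev s x * fderiv ℝ (ev P) x d := by
  rw [fderiv_ev]; simp [dirTerm]; ring

theorem totalDegree_dirTerm_le {k : ℕ} {s P : MvPolynomial (Fin 2) ℝ} (d : Plane)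
    (hs : s.totalDegree ≤ 1) (hP : P.totalDegree ≤ k) : (dirTerm s P d).totalDegree ≤ k :=
  (totalDegree_add _ _).trans (max_le
    ((totalDegree_smul_le _ _).trans (totalDegree_mul_pderiv_le hs hP _))
    ((totalDegree_smul_le _ _).trans (totalDegree_mul_pderiv_le hs hP _)))

/-- The field `s (∂_a p) a + t (∂_b p) b` on the element number `j`, where `s`, `t` are the
barycentric coordinates and `a`, `b` the sides of each triangle at `ν`. -/
def gradTest (p : M.Scalar) (j : Fin M.N) : M.Vector := fun τ l =>
  if τ.1 = j then (M.va τ - M.ν τ) l • dirTerm (bary₁ τ) (p τ) (M.va τ - M.ν τ) +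
    (M.vb τ - M.ν τ) l • dirTerm (bary₂ τ) (p τ) (M.vb τ - M.ν τ) else 0

theorem vec_gradTest (p : M.Scalar) {j : Fin M.N} {τ : M.Tri} (h : τ.1 = j) (x : Plane)
    (l : Fin 2) : vec (gradTest p j) τ x l =
      (M.va τ - M.ν τ) l * (ev (bary₁ τ) x * fderiv ℝ (ev (p τ)) x (M.va τ - M.ν τ)) +
      (M.vb τ - M.ν τ) l * (ev (bary₂ τ) x * fderiv ℝ (ev (p τ)) x (M.vb τ - M.ν τ)) := by
  simp only [vec, gradTest, if_pos h, ev_add, ev_smul, ev_dirTerm]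

theorem dotN_eq_vec (v : M.Vector) (τ : M.Tri) (n x : Plane) :
    dotN v τ n x = vec v τ x 0 * n 0 + vec v τ x 1 * n 1 := by
  simp [dotN, vec, Fin.sum_univ_two]

theorem gradTest_eq_zero (p : M.Scalar) {j : Fin M.N} {τ : M.Tri} (h : τ.1 ≠ j) :
    gradTest p j τ = 0 := by
  ext1 l; simp [gradTest, h]

theorem dotN_eq_zero_of_eq_zero {v : M.Vector} {τ : M.Tri} (h : v τ = 0) (n x : Plane) :
    dotN v τ n x = 0 := by simp [dotN, h]

/-- On this spoke the coordinate multiplying `b` vanishes, and the rest of the field is parallel to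
the spoke. -/
theorem dotN_gradTest_va (p : M.Scalar) (j : Fin M.N) (τ : M.Tri) {x : Plane}
    (hx : x ∈ segment ℝ (M.ν τ) (M.va τ)) : dotN (gradTest p j) τ (M.spokeNormal τ) x = 0 := by
  by_cases h : τ.1 = j
  · have hb : ev (bary₂ τ) x = 0 := by
      rw [segment_eq_image_lineMap] at hx
      obtain ⟨r, -, rfl⟩ := hx
      rw [ev_bary₂, AffineMap.lineMap_apply, vsub_eq_sub, vadd_eq_add, add_sub_cancel_right,
        cross_smul_right, cross_self]
      simp
    rw [dotN_eq_vec, vec_gradTest p h, vec_gradTest p h, hb]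
    have := dot_rightNormal_spoke (M.va τ - M.ν τ) (M.ν τ) (M.va τ)
    rw [cross_self, mul_zero] at this
    rw [spokeNormal]
    linear_combination (ev (bary₁ τ) x * fderiv ℝ (ev (p τ)) x (M.va τ - M.ν τ)) * this
  · exact dotN_eq_zero_of_eq_zero (gradTest_eq_zero p h) _ _

theorem dotN_gradTest_vb (p : M.Scalar) (j : Fin M.N) (τ : M.Tri) {x : Plane}
    (hx : x ∈ segment ℝ (M.ν τ) (M.vb τ)) :
    dotN (gradTest p j) τ (rightNormal (M.vb τ) (M.ν τ)) x = 0 := by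
  by_cases h : τ.1 = j
  · have hb : ev (bary₁ τ) x = 0 := by
      rw [segment_eq_image_lineMap] at hx
      obtain ⟨r, -, rfl⟩ := hx
      rw [ev_bary₁, AffineMap.lineMap_apply, vsub_eq_sub, vadd_eq_add, add_sub_cancel_right,
        cross_smul_left, cross_self]
      simp
    rw [dotN_eq_vec, vec_gradTest p h, vec_gradTest p h, hb]
    have := dot_rightNormal_spoke (M.vb τ - M.ν τ) (M.ν τ) (M.vb τ)
    rw [cross_self, mul_zero] at this
    linear_combination (ev (bary₂ τ) x * fderiv ℝ (ev (p τ)) x (M.vb τ - M.ν τ)) * this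
  · exact dotN_eq_zero_of_eq_zero (gradTest_eq_zero p h) _ _

theorem dotN_gradTest_prev (p : M.Scalar) (j : Fin M.N) (τ : M.Tri) {x : Plane}
    (hx : x ∈ segment ℝ (M.ν τ) (M.va τ)) :
    dotN (gradTest p j) (M.prev τ) (M.spokeNormal τ) x = 0 := by
  have h := dotN_gradTest_vb p j (M.prev τ) (x := x)
  have e : M.vb (M.prev τ) = M.va τ := by
    conv_rhs => rw [← next_prev τ]
    rfl
  rw [e] at h
  exact h hx

/-- Both normal traces on every spoke vanish, so nothing has to match between neighbouring
triangles; a linear factor times a first derivative keeps the degree at most `k`. -/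
theorem gradTest_mem {k : ℕ} {p : M.Scalar} (hp : ∀ τ, (p τ).totalDegree ≤ k) (j : Fin M.N) :
    gradTest p j ∈ M.Vh k := by
  refine ⟨fun τ l => ?_, fun τ x hx => ?_⟩
  · rw [gradTest]
    split_ifs
    · exact (totalDegree_add _ _).trans (max_le
        ((totalDegree_smul_le _ _).trans
          (totalDegree_dirTerm_le _ (totalDegree_linear_le _ _ _) (hp τ)))
        ((totalDegree_smul_le _ _).trans
          (totalDegree_dirTerm_le _ (totalDegree_linear_le _ _ _) (hp τ))))
    · simp
  · rw [dotN_gradTest_va p j τ hx, dotN_gradTest_prev p j τ hx, sub_zero]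

theorem ev_bary₁_par (τ : M.Tri) (z : ℝ × ℝ) : ev (bary₁ τ) (par τ z) = z.1 := by
  rw [ev_bary₁, par, cross_aff_left]
  exact mul_div_cancel_right₀ _ (jac_pos τ).ne'

theorem ev_bary₂_par (τ : M.Tri) (z : ℝ × ℝ) : ev (bary₂ τ) (par τ z) = z.2 := by
  rw [ev_bary₂, par, cross_aff_right]
  exact mul_div_cancel_right₀ _ (jac_pos τ).ne'

theorem vec_gradTest_par (p : M.Scalar) {j : Fin M.N} {τ : M.Tri} (h : τ.1 = j) (z : ℝ × ℝ)
    (l : Fin 2) : vec (gradTest p j) τ (par τ z) l =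
      (M.va τ - M.ν τ) l * (z.1 * evr (pderiv 0 (pullT p τ)) z) +
      (M.vb τ - M.ν τ) l * (z.2 * evr (pderiv 1 (pullT p τ)) z) := by
  have := evr_pderiv_pull (M.ν τ) (M.va τ - M.ν τ) (M.vb τ - M.ν τ) (p τ) z
  rw [vec_gradTest p h, ev_bary₁_par, ev_bary₂_par, pullT, this.1, this.2, par]

/-- The field is designed so that `v · ∇p = s (∂_a p)² + t (∂_b p)²`. This is the integrand of
`refGrad` without any metric factor, so no angle condition on the triangles is needed. The spoke
terms vanish by tangency. -/
theorem bForm_gradTest (p : M.Scalar) (j : Fin M.N) :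
    bForm (gradTest p j) p =
      ∑ i, jac (M := M) ⟨j, i⟩ * refGrad (pullT p ⟨j, i⟩) (pullT p ⟨j, i⟩) := by
  have h1 : ∀ τ : M.Tri, (edgeIntegral (M.ν τ) (M.va τ) fun x =>
      dotN (gradTest p j) τ (M.spokeNormal τ) x * jump p (M.prev τ, τ) x) = 0 := by
    intro τ
    rw [edgeIntegral_congr (g := fun x => 0 * x 0), edgeIntegral_const_mul, zero_mul]
    intro x hx
    rw [dotN_gradTest_va p j τ hx]; ring
  rw [bForm]
  simp only [h1, Finset.sum_const_zero, neg_zero, zero_add]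
  rw [Fintype.sum_sigma]
  rw [Finset.sum_eq_single j _ (by simp)]
  · apply Finset.sum_congr rfl
    intro i _
    rw [triIntegral_eq, refGrad]
    congr 2
    ext z
    have := evr_pderiv_pull (M.ν ⟨j, i⟩) (M.va ⟨j, i⟩ - M.ν ⟨j, i⟩) (M.vb ⟨j, i⟩ - M.ν ⟨j, i⟩)
      (p ⟨j, i⟩) z
    rw [fderiv_ev, fderiv_ev] at this
    simp only [dotProduct, Fin.sum_univ_two]
    have hτ : (⟨j, i⟩ : M.Tri).1 = j := rfl
    rw [vec_gradTest_par p hτ, vec_gradTest_par p hτ]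
    simp only [grad, pullT]
    rw [this.1, this.2, par]
    ring
  · intro j' _ hne
    apply Finset.sum_eq_zero
    intro i _
    have : ∀ x, vec (gradTest p j) ⟨j', i⟩ x = 0 := by
      intro x; ext l; simp [vec, gradTest_eq_zero p (τ := (⟨j', i⟩ : M.Tri)) hne]
    simp [this, triIntegral]

theorem normSq_gradTest_le (p : M.Scalar) (j : Fin M.N) :
    (∑ i, M.triIntegral ⟨j, i⟩ fun x =>
      vec (gradTest p j) ⟨j, i⟩ x ⬝ᵥ vec (gradTest p j) ⟨j, i⟩ x) ≤
    2 * Metric.diam (M.elt j).carrier ^ 2 *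
      ∑ i, jac (M := M) ⟨j, i⟩ * refGrad (pullT p ⟨j, i⟩) (pullT p ⟨j, i⟩) := by
  rw [Finset.mul_sum]
  apply Finset.sum_le_sum
  intro i _
  set τ : M.Tri := ⟨j, i⟩
  rw [triIntegral_eq, mul_left_comm]
  apply mul_le_mul_of_nonneg_left _ (jac_pos τ).le
  rw [refGrad, ← integral_const_mul]
  have c0 := continuous_evr (pderiv 0 (pullT p τ))
  have c1 := continuous_evr (pderiv 1 (pullT p τ))
  have hv : ∀ l, Continuous fun z => vec (gradTest p j) τ (par τ z) l := fun l =>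
    (continuous_apply l).comp ((continuous_vec _ _).comp (continuous_par τ))
  apply setIntegral_mono_on (integrableOn_refTri _) (integrableOn_refTri (by fun_prop))
    measurableSet_refTri
  · rintro z ⟨h1, h2, h3⟩
    simp only [dotProduct, Fin.sum_univ_two]
    have hτ : τ.1 = j := rfl
    rw [vec_gradTest_par p hτ, vec_gradTest_par p hτ]
    set D := Metric.diam (M.elt j).carrier
    set X := evr (pderiv 0 (pullT p τ)) z
    set Y := evr (pderiv 1 (pullT p τ)) z
    have ha : ‖M.va τ - M.ν τ‖ ^ 2 ≤ D ^ 2 :=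
      pow_le_pow_left₀ (norm_nonneg _) (norm_va_sub_le τ) 2
    have hb : ‖M.vb τ - M.ν τ‖ ^ 2 ≤ D ^ 2 :=
      pow_le_pow_left₀ (norm_nonneg _) (norm_vb_sub_le τ) 2
    rw [norm_sq_eq] at ha hb
    set a := M.va τ - M.ν τ
    set b := M.vb τ - M.ν τ
    have e1 : (a 0 * (z.1 * X) + b 0 * (z.2 * Y)) * (a 0 * (z.1 * X) + b 0 * (z.2 * Y)) +
        (a 1 * (z.1 * X) + b 1 * (z.2 * Y)) * (a 1 * (z.1 * X) + b 1 * (z.2 * Y)) ≤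
        2 * ((a 0 ^ 2 + a 1 ^ 2) * (z.1 * X) ^ 2) + 2 * ((b 0 ^ 2 + b 1 ^ 2) * (z.2 * Y) ^ 2) := by
      nlinarith [sq_nonneg (a 0 * (z.1 * X) - b 0 * (z.2 * Y)),
        sq_nonneg (a 1 * (z.1 * X) - b 1 * (z.2 * Y))]
    have e2 := mul_le_mul_of_nonneg_right ha (sq_nonneg (z.1 * X))
    have e3 := mul_le_mul_of_nonneg_right hb (sq_nonneg (z.2 * Y))
    -- The square of the weight is bounded by the weight itself, since barycentric coordinates are
    -- at most one.
    have e4 : (z.1 * X) ^ 2 ≤ z.1 * (X * X) := by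
      have : z.1 * z.1 ≤ z.1 * 1 := mul_le_mul_of_nonneg_left (by linarith) h1
      nlinarith [mul_le_mul_of_nonneg_right this (mul_self_nonneg X)]
    have e5 : (z.2 * Y) ^ 2 ≤ z.2 * (Y * Y) := by
      have : z.2 * z.2 ≤ z.2 * 1 := mul_le_mul_of_nonneg_left (by linarith) h2
      nlinarith [mul_le_mul_of_nonneg_right this (mul_self_nonneg Y)]
    have e6 := mul_le_mul_of_nonneg_left e4 (sq_nonneg D)
    have e7 := mul_le_mul_of_nonneg_left e5 (sq_nonneg D)
    linarith
  · simp only [dotProduct, Fin.sum_univ_two]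
    exact ((hv 0).mul (hv 0)).add ((hv 1).mul (hv 1))

theorem le_of_sq_le_mul {X Y : ℝ} (hY : 0 ≤ Y) (h : X ^ 2 ≤ Y * X) : X ≤ Y := by
  by_contra! hlt
  nlinarith

/-- With `X` the sum in question, `X` is the pairing and `2 h² X` bounds `‖v‖²`, so the local Darcy
bound has the form `X² ≤ Y X`. -/
theorem sum_refGrad_le (hM : M.IsStar) {c : Coefficients G} {k : ℕ} {u : M.Vector} {p : M.Scalar}
    (hp : p ∈ M.Sh k) (hd : ∀ v ∈ M.Vh k, mass c u v + bStarForm p v = 0) (j : Fin M.N) :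
    ∑ i, jac (M := M) ⟨j, i⟩ * refGrad (pullT p ⟨j, i⟩) (pullT p ⟨j, i⟩) ≤
      2 * c.K₁⁻¹ * Metric.diam (M.elt j).carrier ^ 2 * massE c j u u := by
  have hU := massE_nonneg hM c j u
  have hK : 0 < c.K₁⁻¹ := inv_pos.2 c.K₁_pos
  apply le_of_sq_le_mul (by positivity)
  have h1 := bForm_sq_le hM hp hd (gradTest_mem hp.1 j) j (fun τ h => gradTest_eq_zero p h)
  rw [bForm_gradTest] at h1
  have h2 := mul_le_mul_of_nonneg_left (mul_le_mul_of_nonneg_left (normSq_gradTest_le p j) hK.le) hU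
  refine (h1.trans h2).trans (le_of_eq ?_)
  ring

end GradTest

end Mesh

/-- A cyclic sequence with prescribed differences of sum zero. -/
theorem exists_cyclic_primitive {n : ℕ} (F : Fin (n + 1) → ℝ) (hF : ∑ i, F i = 0) :
    ∃ A : Fin (n + 1) → ℝ, (∀ i, A i - A (i + 1) = F i) ∧
      ∀ i, ∃ s : Finset (Fin (n + 1)), A i = -∑ l ∈ s, F l := by
  classical
  -- Negative partial sums. Inside the cycle the differences are immediate; from the last index back
  -- to `0` the total sum zero is used.
  refine ⟨fun i => -∑ l ∈ Finset.univ.filter (· < i), F l, fun i => ?_, fun i => ⟨_, rfl⟩⟩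
  by_cases hi : i = Fin.last n
  · subst hi
    have h1 : Finset.univ.filter (fun l : Fin (n + 1) => l < Fin.last n + 1) = ∅ := by
      ext l; simp
    have h2 : (Finset.univ : Finset (Fin (n + 1))) =
        insert (Fin.last n) (Finset.univ.filter (· < Fin.last n)) := by
      ext l; simp [Fin.lt_last_iff_ne_last, em]
    rw [h2, Finset.sum_insert (by simp)] at hF
    simp only [h1, Finset.sum_empty]
    linarith
  · have h2 : Finset.univ.filter (fun l : Fin (n + 1) => l < i + 1) =
        insert i (Finset.univ.filter (· < i)) := by
      ext l
      have hv : (i + 1).val = i.val + 1 := by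
        rw [Fin.val_add_one, if_neg hi]
      simp only [Finset.mem_filter, Finset.mem_univ, true_and, Finset.mem_insert, Fin.lt_def, hv,
        Fin.ext_iff]
      omega
    simp only [h2]
    rw [Finset.sum_insert (by simp)]
    ring

namespace Mesh

variable {G : Geometry} {M : Mesh G}

/-! ### Piecewise constant test fields -/

section ConstTest

open MvPolynomial

/-- The constant vector on `τ` with `det (a, w) = A τ` and `det (b, w) = A (next τ)`, where `a`,
`b` are the sides of `τ` at `ν`. -/
def constVec (A : M.Tri → ℝ) (τ : M.Tri) : Plane :=
  (jac τ)⁻¹ • (A τ • (M.vb τ - M.ν τ) - A (next τ) • (M.va τ - M.ν τ))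

/-- The piecewise constant field on the element number `j` given by `constVec`. -/
def constTest (A : M.Tri → ℝ) (j : Fin M.N) : M.Vector := fun τ l =>
  if τ.1 = j then C (constVec A τ l) else 0

theorem cross_va_constVec (A : M.Tri → ℝ) (τ : M.Tri) :
    cross (M.va τ - M.ν τ) (constVec A τ) = A τ := by
  have := jac_pos τ
  rw [constVec, cross_smul_right, cross_sub_right, cross_smul_right, cross_smul_right, cross_self]
  change (jac τ)⁻¹ * (A τ * jac τ - _) = _
  field_simp; ring

theorem cross_vb_constVec (A : M.Tri → ℝ) (τ : M.Tri) :
    cross (M.vb τ - M.ν τ) (constVec A τ) = A (next τ) := by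
  have := jac_pos τ
  rw [constVec, cross_smul_right, cross_sub_right, cross_smul_right, cross_smul_right, cross_self,
    cross_comm (M.vb τ - M.ν τ)]
  change (jac τ)⁻¹ * (_ - A (next τ) * (-jac τ)) = _
  field_simp; ring

theorem vec_constTest (A : M.Tri → ℝ) {j : Fin M.N} {τ : M.Tri} (h : τ.1 = j) (x : Plane)
    (l : Fin 2) : vec (constTest A j) τ x l = constVec A τ l := by
  simp only [vec, constTest, if_pos h, ev_C]

theorem constTest_eq_zero (A : M.Tri → ℝ) {j : Fin M.N} {τ : M.Tri} (h : τ.1 ≠ j) :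
    constTest A j τ = 0 := by
  ext1 l; simp [constTest, h]

/-- On the spoke of `τ` both adjacent triangles have normal trace `A τ` divided by the length of the
spoke, so every choice of `A` is admissible. -/
theorem constTest_mem (A : M.Tri → ℝ) (j : Fin M.N) (k : ℕ) : constTest A j ∈ M.Vh k := by
  refine ⟨fun τ l => ?_, fun τ x _ => ?_⟩
  · rw [constTest]
    split_ifs <;> simp
  · by_cases h : τ.1 = j
    · have hp : (M.prev τ).1 = j := h
      rw [dotN_eq_vec, dotN_eq_vec, vec_constTest A h, vec_constTest A h, vec_constTest A hp,
        vec_constTest A hp, spokeNormal, dot_rightNormal_spoke, dot_rightNormal_spoke,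
        cross_va_constVec]
      have h2 := cross_vb_constVec A (M.prev τ)
      rw [next_prev] at h2
      have e : M.vb (M.prev τ) = M.va τ := by
        conv_rhs => rw [← next_prev τ]
        rfl
      rw [e] at h2
      rw [show cross (M.va τ - M.ν τ) (constVec A (M.prev τ)) = A τ from h2, sub_self]
    · rw [dotN_eq_zero_of_eq_zero (constTest_eq_zero A h),
        dotN_eq_zero_of_eq_zero (constTest_eq_zero A (τ := M.prev τ) h), sub_zero]

theorem outerIntegral_eq (τ : M.Tri) (f : Plane → ℝ) :
    M.outerIntegral τ f = ‖M.vb τ - M.va τ‖ * ∫ t in (0 : ℝ)..1, f (par τ (1 - t, t)) := by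
  rw [outerIntegral, edgeIntegral, dist_comm, dist_eq_norm]
  simp only [par, aff_edge]

theorem dot_outerNormal (w : Plane) (τ : M.Tri) :
    w 0 * M.outerNormal τ 0 + w 1 * M.outerNormal τ 1 =
      ‖M.vb τ - M.va τ‖⁻¹ * cross w (M.vb τ - M.va τ) := by
  simp [outerNormal, rightNormal, cross]; ring

theorem cross_constVec_edge (A : M.Tri → ℝ) (τ : M.Tri) :
    cross (constVec A τ) (M.vb τ - M.va τ) = A τ - A (next τ) := by
  have e : M.vb τ - M.va τ = (M.vb τ - M.ν τ) - (M.va τ - M.ν τ) := by abel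
  rw [e, cross_sub_right, cross_comm _ (M.vb τ - M.ν τ), cross_comm _ (M.va τ - M.ν τ),
    cross_va_constVec, cross_vb_constVec]
  ring

theorem norm_edge_pos (τ : M.Tri) : 0 < ‖M.vb τ - M.va τ‖ :=
  norm_pos_iff.2 (sub_ne_zero.2 (va_ne_vb τ).symm)

/-- Constants have no divergence, and the total flux through an outer edge is a difference of
consecutive values of `A`; the pairing sees only the edge means of `p`. -/
theorem bForm_constTest (A : M.Tri → ℝ) (p : M.Scalar) (j : Fin M.N) :
    bForm (constTest A j) p =
      ∑ i, (A ⟨j, i⟩ - A ⟨j, i + 1⟩) * refMean (pullT p ⟨j, i⟩) := by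
  have hdiv : ∀ τ x, dvg (constTest A j) τ x = 0 := by
    intro τ x
    simp only [dvg, constTest]
    split_ifs <;> simp
  have h0 : ∀ τ : M.Tri, M.triIntegral τ (fun x => ev (p τ) x * dvg (constTest A j) τ x) = 0 := by
    intro τ; simp [hdiv, triIntegral]
  rw [bForm_eq (constTest_mem A j 0)]
  simp only [h0, Finset.sum_const_zero, sub_zero]
  rw [Fintype.sum_sigma, Finset.sum_eq_single j _ (by simp)]
  · apply Finset.sum_congr rfl
    intro i _
    have hn := norm_edge_pos (M := M) ⟨j, i⟩
    rw [outerIntegral_eq, refMean, ← intervalIntegral.integral_const_mul,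
      ← intervalIntegral.integral_const_mul]
    congr 1
    ext t
    have hτ : (⟨j, i⟩ : M.Tri).1 = j := rfl
    rw [dotN_eq_vec, vec_constTest A hτ, vec_constTest A hτ, dot_outerNormal, cross_constVec_edge,
      evr_pullT]
    field_simp
    rfl
  · intro j' _ hne
    apply Finset.sum_eq_zero
    intro i _
    have : ∀ n x, dotN (constTest A j) ⟨j', i⟩ n x = 0 := fun n x =>
      dotN_eq_zero_of_eq_zero (constTest_eq_zero A (τ := (⟨j', i⟩ : M.Tri)) hne) n x
    simp [this, outerIntegral_eq]

theorem normSq_constTest (A : M.Tri → ℝ) (j : Fin M.N) :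
    (∑ i, M.triIntegral ⟨j, i⟩ fun x =>
      vec (constTest A j) ⟨j, i⟩ x ⬝ᵥ vec (constTest A j) ⟨j, i⟩ x) =
    ∑ i, jac (M := M) ⟨j, i⟩ / 2 * ‖constVec A ⟨j, i⟩‖ ^ 2 := by
  apply Finset.sum_congr rfl
  intro i _
  have hτ : (⟨j, i⟩ : M.Tri).1 = j := rfl
  have : ∀ z : ℝ × ℝ, vec (constTest A j) ⟨j, i⟩ (par ⟨j, i⟩ z) ⬝ᵥ
      vec (constTest A j) ⟨j, i⟩ (par ⟨j, i⟩ z) = ‖constVec A ⟨j, i⟩‖ ^ 2 * 1 := by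
    intro z
    rw [norm_sq_eq, dotProduct, Fin.sum_univ_two, vec_constTest A hτ, vec_constTest A hτ]
    ring
  rw [triIntegral_eq]
  simp only [this]
  rw [integral_const_mul, volume_refTri]
  ring

/-- Written with the edge vector, the field is `A τ (vb - va) + (A τ - A (next τ)) (va - ν)` over
the Jacobian. Assumption (A) bounds edge length over Jacobian by `1 / (ρ h)`, so short edges cause
no blow-up. -/
theorem norm_constVec_sq_le {ρ h : ℝ} (hρ : 0 < ρ) (hh : 0 < h) (A : M.Tri → ℝ) (τ : M.Tri)
    (ha : ‖M.va τ - M.ν τ‖ ≤ h) (hH : ρ * h * ‖M.vb τ - M.va τ‖ ≤ jac τ) :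
    jac τ / 2 * ‖constVec A τ‖ ^ 2 ≤
      jac τ * A τ ^ 2 / (ρ * h) ^ 2 + h ^ 2 * ((A τ - A (next τ)) ^ 2 / jac τ) := by
  have hJ := jac_pos τ
  have e : constVec A τ = (jac τ)⁻¹ • (A τ • (M.vb τ - M.va τ) +
      (A τ - A (next τ)) • (M.va τ - M.ν τ)) := by
    rw [constVec]; congr 1; module
  have h1 : ‖constVec A τ‖ ≤ (jac τ)⁻¹ * (|A τ| * ‖M.vb τ - M.va τ‖ +
      |A τ - A (next τ)| * ‖M.va τ - M.ν τ‖) := by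
    rw [e, norm_smul, Real.norm_eq_abs, abs_of_pos (inv_pos.2 hJ)]
    refine mul_le_mul_of_nonneg_left ((norm_add_le _ _).trans ?_) (inv_pos.2 hJ).le
    rw [norm_smul, norm_smul, Real.norm_eq_abs, Real.norm_eq_abs]
  have h2 : ‖constVec A τ‖ ≤ |A τ| / (ρ * h) + |A τ - A (next τ)| * h / jac τ := by
    refine h1.trans ?_
    rw [mul_add]
    apply add_le_add
    · rw [inv_mul_le_iff₀ hJ, ← mul_div_assoc, le_div_iff₀ (by positivity)]
      nlinarith [abs_nonneg (A τ), mul_le_mul_of_nonneg_left hH (abs_nonneg (A τ))]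
    · rw [inv_mul_eq_div]; gcongr
  have h3 : ‖constVec A τ‖ ^ 2 ≤
      2 * (|A τ| / (ρ * h)) ^ 2 + 2 * (|A τ - A (next τ)| * h / jac τ) ^ 2 := by
    refine (pow_le_pow_left₀ (norm_nonneg _) h2 2).trans ?_
    nlinarith [sq_nonneg (|A τ| / (ρ * h) - |A τ - A (next τ)| * h / jac τ)]
  calc jac τ / 2 * ‖constVec A τ‖ ^ 2
      ≤ jac τ / 2 * (2 * (|A τ| / (ρ * h)) ^ 2 + 2 * (|A τ - A (next τ)| * h / jac τ) ^ 2) := by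
        gcongr
    _ = _ := by
        simp only [div_pow, mul_pow, sq_abs]
        field_simp

/-- The triangles are essentially disjoint and lie in the disc of radius the diameter; a Jacobian is
twice an area. -/
theorem sum_jac_le (j : Fin M.N) :
    ∑ i, jac (M := M) ⟨j, i⟩ ≤ 2 * Real.pi * Metric.diam (M.elt j).carrier ^ 2 := by
  have h1 : ∀ τ : M.Tri, jac τ = 2 * ∫ _ in M.triangle τ, (1 : ℝ) := by
    intro τ
    have := triIntegral_eq τ fun _ => (1 : ℝ)
    rw [volume_refTri] at this
    rw [triIntegral] at this
    linarith
  simp only [h1]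
  rw [← Finset.mul_sum, mul_assoc]
  apply mul_le_mul_of_nonneg_left _ (by norm_num)
  have hfin : volume (⋃ i, M.triangle ⟨j, i⟩) < ⊤ :=
    ((isCompact_iUnion fun i => isCompact_triangle (M := M) ⟨j, i⟩).measure_lt_top)
  have h2 := integral_iUnion_ae (μ := volume) (s := fun i => M.triangle ⟨j, i⟩)
    (f := fun _ => (1 : ℝ)) (fun i => (measurableSet_triangle _).nullMeasurableSet)
    (fun i i' h => aedisjoint_triangle (fun h' => h (by simpa using h')))
    (integrableOn_const hfin.ne)
  rw [tsum_fintype] at h2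
  rw [← h2]
  have hsub : ⋃ i, M.triangle ⟨j, i⟩ ⊆
      Metric.closedBall (M.elt j).center (Metric.diam (M.elt j).carrier) := by
    intro x hx
    obtain ⟨i, hi⟩ := mem_iUnion.1 hx
    exact Metric.dist_le_diam_of_mem (M.elt j).isCompact_carrier.isBounded
      (triangle_subset_carrier _ hi) ((M.elt j).tri_subset_carrier i ((M.elt j).center_mem_tri i))
  rw [setIntegral_const, smul_eq_mul, mul_one]
  refine (measureReal_mono hsub measure_closedBall_lt_top.ne).trans (le_of_eq ?_)
  rw [measureReal_def, EuclideanSpace.volume_closedBall_fin_two,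
    ENNReal.toReal_mul, ENNReal.toReal_pow, ENNReal.toReal_ofReal Metric.diam_nonneg]
  rw [ENNReal.toReal_ofReal Real.pi_pos.le, mul_comm]

/-- The weighted mean over an element of the means over its outer edges. -/
def elementMean (p : M.Scalar) (j : Fin M.N) : ℝ :=
  (∑ i, jac (M := M) ⟨j, i⟩ * refMean (pullT p ⟨j, i⟩)) / ∑ i, jac (M := M) ⟨j, i⟩

theorem sum_jac_pos (j : Fin M.N) : 0 < ∑ i, jac (M := M) ⟨j, i⟩ :=
  Finset.sum_pos (fun _ _ => jac_pos _) ⟨0, Finset.mem_univ _⟩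

theorem sum_jac_mul_sub (p : M.Scalar) (j : Fin M.N) :
    ∑ i, jac (M := M) ⟨j, i⟩ * (refMean (pullT p ⟨j, i⟩) - elementMean p j) = 0 := by
  have := sum_jac_pos (M := M) j
  simp only [mul_sub, Finset.sum_sub_distrib, ← Finset.sum_mul]
  rw [elementMean]; field_simp; ring

/-- The fluxes are chosen as `J i * m i`, where `m i` is the deviation of the edge mean from the
area-weighted mean of the element. They sum to zero, so a cyclic primitive exists, and the pairing
with `p` is the left-hand side `X`. Cauchy–Schwarz bounds the primitive by `(∑ J) X` independently
of the number of edges. -/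
theorem sum_mean_sq_le (hM : M.IsStar) {ρ : ℝ} (hρ : 0 < ρ) (hA : M.AssumptionA ρ)
    {c : Coefficients G} {k : ℕ} {u : M.Vector} {p : M.Scalar}
    (hp : p ∈ M.Sh k) (hd : ∀ v ∈ M.Vh k, mass c u v + bStarForm p v = 0) (j : Fin M.N) :
    ∑ i, jac (M := M) ⟨j, i⟩ * (refMean (pullT p ⟨j, i⟩) - elementMean p j) ^ 2 ≤
      c.K₁⁻¹ * ((2 * Real.pi) ^ 2 / ρ ^ 2 + 1) * Metric.diam (M.elt j).carrier ^ 2 *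
        massE c j u u := by
  set h := Metric.diam (M.elt j).carrier with hh
  have hpos : 0 < h := (M.elt j).diam_pos
  set m : Fin ((M.elt j).nv + 3) → ℝ := fun i => refMean (pullT p ⟨j, i⟩) - elementMean p j
  set J : Fin ((M.elt j).nv + 3) → ℝ := fun i => jac (M := M) ⟨j, i⟩
  have hJ : ∀ i, 0 < J i := fun i => jac_pos _
  have hsum0 : ∑ i, J i * m i = 0 := sum_jac_mul_sub p j
  obtain ⟨B, hB, hBs⟩ := exists_cyclic_primitive (fun i => J i * m i) hsum0
  set X := ∑ i, J i * m i ^ 2 with hX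
  have hX0 : 0 ≤ X := Finset.sum_nonneg fun i _ => mul_nonneg (hJ i).le (sq_nonneg _)
  have hBsq : ∀ i, B i ^ 2 ≤ (∑ i, J i) * X := by
    intro i
    obtain ⟨s, hs⟩ := hBs i
    rw [hs, neg_sq]
    refine (Finset.sum_sq_le_sum_mul_sum_of_sq_le_mul s (f := J) (g := fun i => J i * m i ^ 2)
      (fun i _ => (hJ i).le) (fun i _ => mul_nonneg (hJ i).le (sq_nonneg _))
      (fun i _ => le_of_eq (by ring))).trans ?_
    apply mul_le_mul
    · exact Finset.sum_le_sum_of_subset_of_nonneg (Finset.subset_univ _) fun i _ _ => (hJ i).le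
    · exact Finset.sum_le_sum_of_subset_of_nonneg (Finset.subset_univ _) fun i _ _ =>
        mul_nonneg (hJ i).le (sq_nonneg _)
    · exact Finset.sum_nonneg fun i _ => mul_nonneg (hJ i).le (sq_nonneg _)
    · exact Finset.sum_nonneg fun i _ => (hJ i).le
  -- The primitive is extended by zero to the other elements.
  let A : M.Tri → ℝ := fun τ => if hτ : τ.1 = j then B (hτ ▸ τ.2) else 0
  have hAB : ∀ i, A ⟨j, i⟩ = B i := fun i => by simp [A]
  have hb : bForm (constTest A j) p = X := by
    rw [bForm_constTest]
    simp only [hAB, hB]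
    -- Subtracting the element mean changes nothing, because the prescribed fluxes sum to zero.
    have : ∑ i, J i * m i * refMean (pullT p ⟨j, i⟩) = X + elementMean p j * ∑ i, J i * m i := by
      rw [hX, Finset.mul_sum, ← Finset.sum_add_distrib]
      apply Finset.sum_congr rfl
      intro i _
      simp only [m]; ring
    rw [this, hsum0, mul_zero, add_zero]
  have hn : (∑ i, M.triIntegral ⟨j, i⟩ fun x =>
      vec (constTest A j) ⟨j, i⟩ x ⬝ᵥ vec (constTest A j) ⟨j, i⟩ x) ≤
      ((2 * Real.pi) ^ 2 / ρ ^ 2 + 1) * h ^ 2 * X := by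
    rw [normSq_constTest]
    have hstep : ∀ i, jac (M := M) ⟨j, i⟩ / 2 * ‖constVec A ⟨j, i⟩‖ ^ 2 ≤
        J i * (((∑ i, J i) * X) / (ρ * h) ^ 2) + h ^ 2 * (J i * m i ^ 2) := by
      intro i
      have h1 := norm_constVec_sq_le hρ hpos A ⟨j, i⟩ (norm_va_sub_le (M := M) ⟨j, i⟩)
        (hA.mul_diam_mul_norm_le ⟨j, i⟩)
      have hnext : next (⟨j, i⟩ : M.Tri) = ⟨j, i + 1⟩ := rfl
      rw [hnext, hAB, hAB, hB] at h1
      refine h1.trans (add_le_add ?_ (le_of_eq ?_))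
      · rw [mul_div_assoc]
        exact mul_le_mul_of_nonneg_left (div_le_div_of_nonneg_right (hBsq i) (sq_nonneg _))
          (hJ i).le
      · have := (hJ i).ne'
        change h ^ 2 * ((J i * m i) ^ 2 / J i) = _
        field_simp
    refine (Finset.sum_le_sum fun i _ => hstep i).trans ?_
    rw [Finset.sum_add_distrib, ← Finset.sum_mul, ← Finset.mul_sum]
    have hS : ∑ i, J i ≤ 2 * Real.pi * h ^ 2 := sum_jac_le j
    have hS0 : 0 ≤ ∑ i, J i := Finset.sum_nonneg fun i _ => (hJ i).le
    have h4 : (∑ i, J i) * ((∑ i, J i) * X / (ρ * h) ^ 2) ≤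
        (2 * Real.pi * h ^ 2) * ((2 * Real.pi * h ^ 2) * X / (ρ * h) ^ 2) := by gcongr
    have h5 : (2 * Real.pi * h ^ 2) * ((2 * Real.pi * h ^ 2) * X / (ρ * h) ^ 2) =
        (2 * Real.pi) ^ 2 / ρ ^ 2 * h ^ 2 * X := by field_simp
    calc _ ≤ (2 * Real.pi) ^ 2 / ρ ^ 2 * h ^ 2 * X + h ^ 2 * X := by
          rw [← h5]; exact add_le_add h4 le_rfl
      _ = _ := by ring
  have hU := massE_nonneg hM c j u
  have hK : 0 < c.K₁⁻¹ := inv_pos.2 c.K₁_pos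
  have h1 := bForm_sq_le hM hp hd (constTest_mem A j k) j (fun τ h => constTest_eq_zero A h)
  rw [hb] at h1
  change X ≤ _
  apply le_of_sq_le_mul (by positivity)
  have h2 := mul_le_mul_of_nonneg_left (mul_le_mul_of_nonneg_left hn hK.le) hU
  refine (h1.trans h2).trans (le_of_eq ?_)
  ring

end ConstTest

/-! ### The local estimate -/

section LocalBound

open MvPolynomial

theorem refTri_sub_sq_le (P : MvPolynomial (Fin 2) ℝ) (m : ℝ) :
    ∫ z in refTri, (evr P z - m) ^ 2 ≤
      2 * refInner (P - C (refMean P)) (P - C (refMean P)) + (refMean P - m) ^ 2 := by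
  set r := refMean P
  have hc := continuous_evr P
  have h1 : ∫ z in refTri, (evr P z - m) ^ 2 ≤
      ∫ z in refTri, (2 * ((evr P z - r) * (evr P z - r)) + (2 * (r - m) ^ 2) * 1) := by
    apply setIntegral_mono_on (integrableOn_refTri (by fun_prop))
      (integrableOn_refTri (by fun_prop)) measurableSet_refTri
    intro z _
    -- This is `(x + y)² ≤ 2 x² + 2 y²`; the constant part is then halved by the area of the
    -- reference triangle.
    nlinarith [sq_nonneg (evr P z - r - (r - m))]
  rw [integral_add (integrableOn_refTri (by fun_prop)) (integrableOn_refTri (by fun_prop)),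
    integral_const_mul, integral_const_mul, volume_refTri] at h1
  have h2 : 0 ≤ ∫ t in (0 : ℝ)..1, (evr P (1 - t, t) - r) * (evr P (1 - t, t) - r) :=
    intervalIntegral.integral_nonneg zero_le_one fun t _ => mul_self_nonneg _
  simp only [refInner, evr_sub, evr_C]
  linarith

theorem refEdge_sub_sq_le (P : MvPolynomial (Fin 2) ℝ) (m : ℝ) :
    ∫ t in (0 : ℝ)..1, (evr P (1 - t, t) - m) ^ 2 ≤
      2 * refInner (P - C (refMean P)) (P - C (refMean P)) + 2 * (refMean P - m) ^ 2 := by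
  set r := refMean P
  have hc := continuous_evr_edge P
  have h1 : ∫ t in (0 : ℝ)..1, (evr P (1 - t, t) - m) ^ 2 ≤
      ∫ t in (0 : ℝ)..1, (2 * ((evr P (1 - t, t) - r) * (evr P (1 - t, t) - r)) +
        2 * (r - m) ^ 2) := by
    apply intervalIntegral.integral_mono_on zero_le_one
    · apply Continuous.intervalIntegrable; fun_prop
    · apply Continuous.intervalIntegrable; fun_prop
    · intro t _
      nlinarith [sq_nonneg (evr P (1 - t, t) - r - (r - m))]
  rw [intervalIntegral.integral_add, intervalIntegral.integral_const_mul,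
    intervalIntegral.integral_const] at h1
  · have h2 : 0 ≤ ∫ z in refTri, (evr P z - r) * (evr P z - r) :=
      setIntegral_nonneg measurableSet_refTri fun z _ => mul_self_nonneg _
    simp only [refInner, evr_sub, evr_C]
    simp only [sub_zero, one_smul] at h1
    linarith
  · apply Continuous.intervalIntegrable; fun_prop
  · exact intervalIntegrable_const

/-- The gradient field controls oscillation within a triangle, the constant fields control the edge
means across the element, and the reference inequality combines them. On edges the length is
replaced by the Jacobian over `ρ h`, which costs one power of `h`. -/
theorem exists_local_bound (c : Coefficients G) (k : ℕ) {ρ : ℝ} (hρ : 0 < ρ) :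
    ∃ B : ℝ, 0 < B ∧ ∀ M : Mesh G, M.AssumptionA ρ → ∀ (u : M.Vector) (p : M.Scalar),
      p ∈ M.Sh k → (∀ v ∈ M.Vh k, mass c u v + bStarForm p v = 0) → ∀ j : Fin M.N,
      (∑ i, M.triIntegral ⟨j, i⟩ fun x => (ev (p ⟨j, i⟩) x - elementMean p j) ^ 2) ≤
        B * Metric.diam (M.elt j).carrier ^ 2 * massE c j u u ∧
      (∑ i, M.outerIntegral ⟨j, i⟩ fun x => (ev (p ⟨j, i⟩) x - elementMean p j) ^ 2) ≤
        B * Metric.diam (M.elt j).carrier * massE c j u u := by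
  obtain ⟨K, hK, hKP⟩ := exists_refInner_le k
  have hκ : 0 < c.K₁⁻¹ := inv_pos.2 c.K₁_pos
  set c₁ := 2 * c.K₁⁻¹ with hc₁
  set c₂ := c.K₁⁻¹ * ((2 * Real.pi) ^ 2 / ρ ^ 2 + 1) with hc₂
  have hc₁0 : 0 < c₁ := by positivity
  have hc₂0 : 0 < c₂ := by positivity
  -- The factor `1 + ρ⁻¹` serves both bounds at once: `1` for the interior and `ρ⁻¹` for the edges.
  refine ⟨(2 * K * c₁ + 2 * c₂) * (1 + ρ⁻¹), by positivity, fun M hA u p hp hd j => ?_⟩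
  have hM := hA.isStar hρ
  set h := Metric.diam (M.elt j).carrier with hh
  have hpos : 0 < h := (M.elt j).diam_pos
  have hU := massE_nonneg hM c j u
  have hD := sum_refGrad_le hM hp hd j
  have hX := sum_mean_sq_le hM hρ hA hp hd j
  have href : ∀ i, refInner (pullT p ⟨j, i⟩ - C (refMean (pullT p ⟨j, i⟩)))
      (pullT p ⟨j, i⟩ - C (refMean (pullT p ⟨j, i⟩))) ≤
      K * refGrad (pullT p ⟨j, i⟩) (pullT p ⟨j, i⟩) := fun i =>
    hKP _ ((totalDegree_pull_le _ _ _ _).trans (hp.1 _))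
  constructor
  · have h1 : ∀ i, (M.triIntegral ⟨j, i⟩ fun x => (ev (p ⟨j, i⟩) x - elementMean p j) ^ 2) ≤
        2 * K * (jac (M := M) ⟨j, i⟩ * refGrad (pullT p ⟨j, i⟩) (pullT p ⟨j, i⟩)) +
        jac (M := M) ⟨j, i⟩ * (refMean (pullT p ⟨j, i⟩) - elementMean p j) ^ 2 := by
      intro i
      rw [triIntegral_eq]
      have h2 := refTri_sub_sq_le (pullT p ⟨j, i⟩) (elementMean p j)
      simp only [evr_pullT] at h2
      have h3 := href i
      calc _ ≤ jac (M := M) ⟨j, i⟩ * (2 * (K * refGrad (pullT p ⟨j, i⟩) (pullT p ⟨j, i⟩)) +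
            (refMean (pullT p ⟨j, i⟩) - elementMean p j) ^ 2) :=
            mul_le_mul_of_nonneg_left (by linarith) (jac_pos _).le
        _ = _ := by ring
    refine (Finset.sum_le_sum fun i _ => h1 i).trans ?_
    rw [Finset.sum_add_distrib, ← Finset.mul_sum]
    calc _ ≤ 2 * K * (c₁ * h ^ 2 * massE c j u u) + c₂ * h ^ 2 * massE c j u u :=
          add_le_add (mul_le_mul_of_nonneg_left hD (by positivity)) hX
      _ = (2 * K * c₁ + c₂) * (h ^ 2 * massE c j u u) := by ring
      _ ≤ ((2 * K * c₁ + 2 * c₂) * (1 + ρ⁻¹)) * (h ^ 2 * massE c j u u) := by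
          apply mul_le_mul_of_nonneg_right _ (by positivity)
          have : 0 < ρ⁻¹ := inv_pos.2 hρ
          nlinarith [mul_pos (mul_pos hK hc₁0) this, mul_pos hc₂0 this]
      _ = _ := by ring
  · have h1 : ∀ i, (M.outerIntegral ⟨j, i⟩ fun x => (ev (p ⟨j, i⟩) x - elementMean p j) ^ 2) ≤
        (ρ * h)⁻¹ *
        (2 * K * (jac (M := M) ⟨j, i⟩ * refGrad (pullT p ⟨j, i⟩) (pullT p ⟨j, i⟩)) +
        2 * (jac (M := M) ⟨j, i⟩ * (refMean (pullT p ⟨j, i⟩) - elementMean p j) ^ 2)) := by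
      intro i
      rw [outerIntegral_eq]
      have h2 := refEdge_sub_sq_le (pullT p ⟨j, i⟩) (elementMean p j)
      simp only [evr_pullT] at h2
      have h3 := href i
      have h4 : ‖M.vb ⟨j, i⟩ - M.va ⟨j, i⟩‖ ≤ (ρ * h)⁻¹ * jac (M := M) ⟨j, i⟩ := by
        rw [inv_mul_eq_div, le_div_iff₀ (by positivity), mul_comm]
        exact hA.mul_diam_mul_norm_le ⟨j, i⟩
      have h5 : 0 ≤ 2 * (K * refGrad (pullT p ⟨j, i⟩) (pullT p ⟨j, i⟩)) +
            2 * (refMean (pullT p ⟨j, i⟩) - elementMean p j) ^ 2 := by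
        have := refGrad_nonneg (pullT p ⟨j, i⟩)
        positivity
      calc _ ≤ ‖M.vb ⟨j, i⟩ - M.va ⟨j, i⟩‖ *
            (2 * (K * refGrad (pullT p ⟨j, i⟩) (pullT p ⟨j, i⟩)) +
            2 * (refMean (pullT p ⟨j, i⟩) - elementMean p j) ^ 2) :=
            mul_le_mul_of_nonneg_left (by linarith) (norm_nonneg _)
        _ ≤ ((ρ * h)⁻¹ * jac (M := M) ⟨j, i⟩) *
            (2 * (K * refGrad (pullT p ⟨j, i⟩) (pullT p ⟨j, i⟩)) +
            2 * (refMean (pullT p ⟨j, i⟩) - elementMean p j) ^ 2) :=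
            mul_le_mul_of_nonneg_right h4 h5
        _ = _ := by ring
    refine (Finset.sum_le_sum fun i _ => h1 i).trans ?_
    rw [← Finset.mul_sum, Finset.sum_add_distrib, ← Finset.mul_sum, ← Finset.mul_sum]
    calc _ ≤ (ρ * h)⁻¹ * (2 * K * (c₁ * h ^ 2 * massE c j u u) +
          2 * (c₂ * h ^ 2 * massE c j u u)) := by
          apply mul_le_mul_of_nonneg_left _ (by positivity)
          exact add_le_add (mul_le_mul_of_nonneg_left hD (by positivity))
            (mul_le_mul_of_nonneg_left hX (by norm_num))
      _ = ((2 * K * c₁ + 2 * c₂) * ρ⁻¹) * (h * massE c j u u) := by field_simp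
      _ ≤ ((2 * K * c₁ + 2 * c₂) * (1 + ρ⁻¹)) * (h * massE c j u u) := by
          apply mul_le_mul_of_nonneg_right _ (by positivity)
          apply mul_le_mul_of_nonneg_left _ (by positivity)
          linarith
      _ = _ := by ring

end LocalBound

end Mesh

/-! ### The global discrete Poincaré inequality. -/

namespace Mesh

variable {G : Geometry} {M : Mesh G}

/-- The Euclidean product of two vectors of the plane. -/
def dot (x n : Plane) : ℝ := x 0 * n 0 + x 1 * n 1

theorem abs_dot_le (x n : Plane) : |dot x n| ≤ ‖x‖ * ‖n‖ := by
  apply abs_le_of_sq_le_sq _ (by positivity)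
  rw [mul_pow, norm_sq_eq, norm_sq_eq, dot]
  nlinarith [sq_nonneg (x 0 * n 1 - x 1 * n 0)]

theorem dot_neg (x n : Plane) : dot x (-n) = -dot x n := by simp [dot]; ring

theorem continuous_dot (n : Plane) : Continuous fun x => dot x n := by unfold dot; fun_prop

theorem sum_sigma_eq (f : M.Tri → ℝ) : ∑ τ, f τ = ∑ j, ∑ i, f ⟨j, i⟩ := by
  rw [← Finset.univ_sigma_univ, Finset.sum_sigma]

theorem triIntegral_const (τ : M.Tri) (r : ℝ) : M.triIntegral τ (fun _ => r) = jac τ * (r / 2) := by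
  rw [triIntegral_eq]
  have : ∫ _ in refTri, r = r * ∫ _ in refTri, (1 : ℝ) := by
    rw [← integral_const_mul]; simp
  rw [this, volume_refTri]; ring

theorem divField_position (s : ℝ) (x : Plane) :
    divField (fun x => s * x 0) (fun x => s * x 1) x = 2 * s := by
  have h : ∀ i : Fin 2, (fun x : Plane => s * x i) = ev (MvPolynomial.C s * MvPolynomial.X i) := by
    intro i; ext x; simp
  rw [divField, h 0, h 1, fderiv_ev, fderiv_ev]
  simp
  ring

/-- The divergence theorem for `m² x`. The factor is constant on each element, so the spokes
contribute nothing; divergence `2` over area `jac τ / 2` gives the weight `jac τ`. -/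
theorem sum_jac_mul_sq (m : Fin M.N → ℝ) :
    ∑ τ : M.Tri, jac τ * m τ.1 ^ 2 =
      ∑ τ : M.Tri, M.outerIntegral τ fun x => m τ.1 ^ 2 * dot x (M.outerNormal τ) := by
  have hc : ∀ (s : ℝ) (i : Fin 2), ContDiff ℝ 1 fun x : Plane => s * x i := by
    intro s i; fun_prop
  have key := sum_integral_divField (M := M) (F₀ := fun τ x => m τ.1 ^ 2 * x 0)
    (F₁ := fun τ x => m τ.1 ^ 2 * x 1) (fun τ => hc _ 0) (fun τ => hc _ 1)
  have h0 : ∀ τ : M.Tri, divField (fun x => m τ.1 ^ 2 * x 0) (fun x => m τ.1 ^ 2 * x 1) =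
      fun _ => 2 * m τ.1 ^ 2 := by
    intro τ; ext x; exact divField_position _ x
  simp only [h0, triIntegral_const, prev, sub_self, Finset.sum_const_zero, add_zero] at key
  have h1 : ∀ τ : M.Tri, jac τ * m τ.1 ^ 2 = jac τ * (2 * m τ.1 ^ 2 / 2) := by intro τ; ring
  simp only [h1]
  rw [key]
  refine Finset.sum_congr rfl fun τ _ => ?_
  rw [← edgeIntegral_rightNormal (va_ne_vb τ)]
  apply edgeIntegral_congr
  intro x _
  rw [dot, outerNormal]; ring

/-- Opposite normals cancel `p²` on interior edges; on the fracture `p₁² - p₂² = 2 [p] {p}`. -/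
theorem sum_outer_sq_dot (hM : M.IsStar) {k : ℕ} {p : M.Scalar} (hp : p ∈ M.Sh k) :
    ∑ τ, M.outerIntegral τ (fun x => ev (p τ) x ^ 2 * dot x (M.outerNormal τ)) =
      ∑ e ∈ M.fractureEdges, M.outerIntegral e.1 fun x =>
        2 * (jump p e x * avg p e x) * dot x (M.outerNormal e.1) := by
  rw [sum_eq_sum_edges hM]
  · have hI : ∀ τ n a b, EdgeIntegrable a b fun x => ev (p τ) x ^ 2 * dot x n := fun τ n a b =>
      Continuous.edgeIntegrable (((continuous_ev _).pow 2).mul (continuous_dot n)) _ _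
    have e1 : ∀ e ∈ M.interiorEdges,
        ((M.outerIntegral e.1 fun x => ev (p e.1) x ^ 2 * dot x (M.outerNormal e.1)) +
        M.outerIntegral e.2 fun x => ev (p e.2) x ^ 2 * dot x (M.outerNormal e.2)) = 0 := by
      intro e he
      have hr := reversed_of_mem_interiorEdges he
      rw [outerIntegral_reversed hr, outerNormal_reversed hr, ← outerIntegral_add (hI _ _ _ _)
        (hI _ _ _ _)]
      trans M.outerIntegral e.1 fun x => 0 * x 0
      · apply edgeIntegral_congr
        intro x hx
        have := hp.2.1 e he x hx
        rw [jump, sub_eq_zero] at this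
        rw [← this, dot_neg]; ring
      · rw [outerIntegral, edgeIntegral_const_mul, zero_mul]
    have e2 : ∀ e ∈ M.fractureEdges,
        ((M.outerIntegral e.1 fun x => ev (p e.1) x ^ 2 * dot x (M.outerNormal e.1)) +
        M.outerIntegral e.2 fun x => ev (p e.2) x ^ 2 * dot x (M.outerNormal e.2)) =
        M.outerIntegral e.1 fun x => 2 * (jump p e x * avg p e x) * dot x (M.outerNormal e.1) := by
      intro e he
      have hr := reversed_of_mem_fractureEdges he
      rw [outerIntegral_reversed hr, outerNormal_reversed hr, ← outerIntegral_add (hI _ _ _ _)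
        (hI _ _ _ _)]
      apply edgeIntegral_congr
      intro x hx
      rw [jump, avg, dot_neg]; ring
    rw [Finset.sum_congr rfl e1, Finset.sum_congr rfl e2, Finset.sum_const_zero, zero_add]
  · intro τ hτ
    trans M.outerIntegral τ fun x => 0 * x 0
    · apply edgeIntegral_congr
      intro x hx
      rw [hp.2.2 τ hτ x hx]; ring
    · rw [outerIntegral, edgeIntegral_const_mul, zero_mul]

/-- Young's inequality for `(m - p)(m + p) x·n` with weight `ρ h`. Since `ρ h |e|` is at most the
Jacobian, the term in `m²` becomes exactly half of what the sum over triangles can absorb. -/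
theorem outer_sub_sq_dot_le {ρ R : ℝ} (hρ : 0 < ρ) (hA : M.AssumptionA ρ) (τ : M.Tri)
    (hd : 0 < Metric.diam (M.elt τ.1).carrier)
    (hx : ∀ x ∈ M.outerEdge τ, ‖x‖ ≤ R) (P : MvPolynomial (Fin 2) ℝ) (m : ℝ) :
    (M.outerIntegral τ fun x => (m ^ 2 - ev P x ^ 2) * dot x (M.outerNormal τ)) ≤
      (4 * R ^ 2 / (ρ * Metric.diam (M.elt τ.1).carrier) + ρ * Metric.diam (M.elt τ.1).carrier / 8) *
        (M.outerIntegral τ fun x => (ev P x - m) ^ 2) + jac τ * m ^ 2 / 2 := by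
  set h := Metric.diam (M.elt τ.1).carrier with hh
  have h1 : (M.outerIntegral τ fun x => (m ^ 2 - ev P x ^ 2) * dot x (M.outerNormal τ)) ≤
      M.outerIntegral τ fun x => (4 * R ^ 2 / (ρ * h) + ρ * h / 8) * (ev P x - m) ^ 2 +
        (ρ * h * m ^ 2 / 2) := by
    apply edgeIntegral_mono
    · exact Continuous.edgeIntegrable
        ((continuous_const.sub ((continuous_ev P).pow 2)).mul (continuous_dot _)) _ _
    · exact Continuous.edgeIntegrable ((continuous_const.mul
        (((continuous_ev P).sub continuous_const).pow 2)).add continuous_const) _ _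
    · intro x hxe
      have hn : |dot x (M.outerNormal τ)| ≤ R := by
        refine (abs_dot_le _ _).trans ?_
        rw [outerNormal, PrimalElement.norm_rightNormal (va_ne_vb τ), mul_one]
        exact hx x hxe
      generalize dot x (M.outerNormal τ) = d at hn
      generalize ev P x = y
      have hd2 : d ^ 2 ≤ R ^ 2 := by
        rw [← sq_abs]; exact pow_le_pow_left₀ (abs_nonneg _) hn 2
      have hq : 0 < ρ * h := by positivity
      generalize ρ * h = q at hq
      have a1 : (m ^ 2 - y ^ 2) * d ≤ 4 * d ^ 2 / q * (y - m) ^ 2 + q / 16 * (m + y) ^ 2 := by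
        have : 0 ≤ 4 / q * (d * (y - m) + q / 8 * (m + y)) ^ 2 := by positivity
        have e : 4 / q * (d * (y - m) + q / 8 * (m + y)) ^ 2 =
          4 * d ^ 2 / q * (y - m) ^ 2 + q / 16 * (m + y) ^ 2 - (m ^ 2 - y ^ 2) * d := by
          field_simp; ring
        linarith
      have a2 : 4 * d ^ 2 / q * (y - m) ^ 2 ≤ 4 * R ^ 2 / q * (y - m) ^ 2 := by gcongr
      have a3 : (m + y) ^ 2 ≤ 8 * m ^ 2 + 2 * (y - m) ^ 2 := by
        -- Multiplied by `q / 16`, the right-hand side gives the coefficients `q / 2` for `m²` and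
        -- `q / 8` for `(y - m)²` of the claim.
        nlinarith [sq_nonneg (2 * m - (y - m))]
      have a4 := mul_le_mul_of_nonneg_left a3 (by positivity : 0 ≤ q / 16)
      nlinarith
  refine h1.trans ?_
  have hI : EdgeIntegrable (M.va τ) (M.vb τ) fun x => (ev P x - m) ^ 2 :=
    Continuous.edgeIntegrable (((continuous_ev P).sub continuous_const).pow 2) _ _
  rw [outerIntegral_add (hI.const_mul _) (Continuous.edgeIntegrable continuous_const _ _),
    outerIntegral, edgeIntegral_const_mul]
  apply add_le_add le_rfl
  rw [outerIntegral, edgeIntegral, dist_comm, dist_eq_norm]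
  have h2 := hA.mul_diam_mul_norm_le τ
  simp only [intervalIntegral.integral_const, sub_zero, one_smul]
  calc _ = (ρ * h * ‖M.vb τ - M.va τ‖) * (m ^ 2 / 2) := by ring
    _ ≤ jac τ * (m ^ 2 / 2) := mul_le_mul_of_nonneg_right h2 (by positivity)
    _ = _ := by ring

theorem _root_.FracturedFlow.Geometry.exists_bound (G : Geometry) :
    ∃ R : ℝ, 0 < R ∧ ∀ x ∈ closure G.Ω, ‖x‖ ≤ R := by
  obtain ⟨R, hR⟩ := G.isBounded.closure.exists_norm_le
  exact ⟨max R 1, by positivity, fun x hx => (hR x hx).trans (le_max_left _ _)⟩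

theorem diam_le {R : ℝ} (hR : 0 < R) (h : ∀ x ∈ closure G.Ω, ‖x‖ ≤ R) (j : Fin M.N) :
    Metric.diam (M.elt j).carrier ≤ 2 * R := by
  apply Metric.diam_le_of_forall_dist_le (by positivity)
  intro x hx y hy
  have h1 := h x (carrier_subset_closure j hx)
  have h2 := h y (carrier_subset_closure j hy)
  rw [dist_eq_norm]
  linarith [norm_sub_le x y]

/-- The element means are estimated with the position field, half of their norm being absorbed; `p -
m` is local. No dual problem and no regularity of `Ω` enters. -/
theorem exists_poincare (c : Coefficients G) (k : ℕ) {ρ : ℝ} (hρ : 0 < ρ) :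
    ∃ C : ℝ, 0 < C ∧ ∀ M : Mesh G, M.AssumptionA ρ → ∀ (u : M.Vector) (p : M.Scalar),
      p ∈ M.Sh k → (∀ v ∈ M.Vh k, mass c u v + bStarForm p v = 0) →
      (∑ τ, M.triIntegral τ fun x => ev (p τ) x ^ 2) ≤
        C * (mass c u u + (∑ e ∈ M.fractureEdges, M.outerIntegral e.1 fun x => jump p e x ^ 2) +
          ∑ e ∈ M.fractureEdges, M.outerIntegral e.1 fun x => avg p e x ^ 2) := by
  obtain ⟨B, hB, hloc⟩ := exists_local_bound c k hρ
  obtain ⟨R, hR, hΩ⟩ := G.exists_bound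
  -- The edge weight times `B h`, with the diameter `h` bounded by `2 R`.
  set D := (4 * R ^ 2 / ρ + ρ * R ^ 2 / 2) * B with hD
  have hD0 : 0 < D := by positivity
  -- From `p² ≤ 2 (p - m)² + 2 m²`: twice `4 R² B` for the oscillation, and `2 D`, `2 R` for the
  -- means after absorption has doubled the remaining terms.
  refine ⟨8 * R ^ 2 * B + 2 * D + 2 * R, by positivity, fun M hA u p hp hu => ?_⟩
  have hM := hA.isStar hρ
  specialize hloc M hA u p hp hu
  set m := elementMean p with hm
  set U := mass c u u with hU
  set J := ∑ e ∈ M.fractureEdges, M.outerIntegral e.1 fun x => jump p e x ^ 2 with hJ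
  set A := ∑ e ∈ M.fractureEdges, M.outerIntegral e.1 fun x => avg p e x ^ 2 with hA'
  have hU0 : 0 ≤ U := by
    rw [hU, mass_eq_sum_massE]; exact Finset.sum_nonneg fun j _ => massE_nonneg hM c j u
  have hJ0 : 0 ≤ J := Finset.sum_nonneg fun e _ => edgeIntegral_nonneg fun x _ => sq_nonneg _
  have hA0 : 0 ≤ A := Finset.sum_nonneg fun e _ => edgeIntegral_nonneg fun x _ => sq_nonneg _
  have hdR : ∀ j, Metric.diam (M.elt j).carrier ≤ 2 * R := diam_le hR hΩ
  have hin : ∑ τ, (M.triIntegral τ fun x => (ev (p τ) x - m τ.1) ^ 2) ≤ 4 * R ^ 2 * B * U := by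
    rw [sum_sigma_eq, hU, mass_eq_sum_massE, Finset.mul_sum]
    refine Finset.sum_le_sum fun j _ => (hloc j).1.trans ?_
    apply mul_le_mul_of_nonneg_right _ (massE_nonneg hM c j u)
    have := pow_le_pow_left₀ (diam_nonneg j) (hdR j) 2
    nlinarith
  have hedge : ∑ τ, M.outerIntegral τ (fun x => (m τ.1 ^ 2 - ev (p τ) x ^ 2) *
      dot x (M.outerNormal τ)) ≤ D * U + (∑ τ : M.Tri, jac τ * m τ.1 ^ 2) / 2 := by
    refine (Finset.sum_le_sum fun τ _ => outer_sub_sq_dot_le hρ hA τ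
      ((M.elt τ.1).diam_pos) (fun x hx => hΩ x (carrier_subset_closure _
        (outerEdge_subset_carrier τ hx))) (p τ) (m τ.1)).trans ?_
    rw [Finset.sum_add_distrib, ← Finset.sum_div]
    apply add_le_add _ le_rfl
    rw [sum_sigma_eq, hU, mass_eq_sum_massE, Finset.mul_sum]
    refine Finset.sum_le_sum fun j _ => ?_
    dsimp only
    rw [← Finset.mul_sum]
    set h := Metric.diam (M.elt j).carrier with hh
    have h0 : 0 < h := (M.elt j).diam_pos
    refine (mul_le_mul_of_nonneg_left (hloc j).2 (by positivity)).trans ?_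
    have hE := massE_nonneg hM c j u
    calc (4 * R ^ 2 / (ρ * h) + ρ * h / 8) * (B * h * massE c j u u) =
          ((4 * R ^ 2 / ρ + ρ * h ^ 2 / 8) * B) * massE c j u u := by field_simp
      _ ≤ D * massE c j u u := by
          apply mul_le_mul_of_nonneg_right _ hE
          rw [hD]
          apply mul_le_mul_of_nonneg_right _ hB.le
          have := pow_le_pow_left₀ h0.le (hdR j) 2
          nlinarith
  have hfr : (∑ e ∈ M.fractureEdges, M.outerIntegral e.1 fun x =>
        2 * (jump p e x * avg p e x) * dot x (M.outerNormal e.1)) ≤ R * (J + A) := by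
    rw [hJ, hA', ← Finset.sum_add_distrib, Finset.mul_sum]
    refine Finset.sum_le_sum fun e _ => ?_
    have cj : Continuous (jump p e) := by unfold jump; fun_prop
    have ca : Continuous (avg p e) := by unfold avg; fun_prop
    have ij : EdgeIntegrable (M.va e.1) (M.vb e.1) fun x => jump p e x ^ 2 :=
      Continuous.edgeIntegrable (cj.pow 2) _ _
    have ia : EdgeIntegrable (M.va e.1) (M.vb e.1) fun x => avg p e x ^ 2 :=
      Continuous.edgeIntegrable (ca.pow 2) _ _
    rw [← outerIntegral_add ij ia, outerIntegral, outerIntegral,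
      ← edgeIntegral_const_mul]
    apply edgeIntegral_mono
    · exact Continuous.edgeIntegrable ((continuous_const.mul (cj.mul ca)).mul (continuous_dot _)) _ _
    · exact Continuous.edgeIntegrable (continuous_const.mul ((cj.pow 2).add (ca.pow 2))) _ _
    · intro x hx
      have hn : |dot x (M.outerNormal e.1)| ≤ R := by
        refine (abs_dot_le _ _).trans ?_
        rw [outerNormal, PrimalElement.norm_rightNormal (va_ne_vb e.1), mul_one]
        exact hΩ x (carrier_subset_closure _ (outerEdge_subset_carrier e.1 hx))
      rw [abs_le] at hn
      generalize dot x (M.outerNormal e.1) = d at hn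
      generalize jump p e x = a
      generalize avg p e x = b
      nlinarith [mul_nonneg (sub_nonneg.2 hn.2) (sq_nonneg (a + b)),
        mul_nonneg (by linarith : 0 ≤ R + d) (sq_nonneg (a - b))]
  have hmean : (∑ τ : M.Tri, jac τ * m τ.1 ^ 2) ≤ 2 * D * U + 2 * R * (J + A) := by
    have e1 := sum_jac_mul_sq (M := M) m
    have e2 := sum_outer_sq_dot hM hp
    have e3 : ∑ τ, M.outerIntegral τ (fun x => (m τ.1 ^ 2 - ev (p τ) x ^ 2) *
        dot x (M.outerNormal τ)) = (∑ τ : M.Tri, M.outerIntegral τ fun x =>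
          m τ.1 ^ 2 * dot x (M.outerNormal τ)) -
        ∑ τ, M.outerIntegral τ (fun x => ev (p τ) x ^ 2 * dot x (M.outerNormal τ)) := by
      rw [← Finset.sum_sub_distrib]
      refine Finset.sum_congr rfl fun τ _ => ?_
      have i1 : EdgeIntegrable (M.va τ) (M.vb τ) fun x => m τ.1 ^ 2 * dot x (M.outerNormal τ) :=
        Continuous.edgeIntegrable (continuous_const.mul (continuous_dot _)) _ _
      have i2 : EdgeIntegrable (M.va τ) (M.vb τ) fun x =>
          ev (p τ) x ^ 2 * dot x (M.outerNormal τ) :=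
        Continuous.edgeIntegrable (((continuous_ev _).pow 2).mul (continuous_dot _)) _ _
      rw [outerIntegral, outerIntegral, outerIntegral, ← edgeIntegral_sub i1 i2]
      apply edgeIntegral_congr
      intro x _; ring
    linarith
  have hsplit : ∀ τ, (M.triIntegral τ fun x => ev (p τ) x ^ 2) ≤
      2 * (M.triIntegral τ fun x => (ev (p τ) x - m τ.1) ^ 2) + jac τ * m τ.1 ^ 2 := by
    intro τ
    have c1 : Continuous fun x => (ev (p τ) x - m τ.1) ^ 2 :=
      ((continuous_ev _).sub continuous_const).pow 2
    have c2 : Continuous fun x => 2 * (ev (p τ) x - m τ.1) ^ 2 := continuous_const.mul c1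
    have e : jac τ * m τ.1 ^ 2 = M.triIntegral τ fun _ => 2 * m τ.1 ^ 2 := by
      rw [triIntegral_const]; ring
    rw [e, triIntegral, triIntegral, triIntegral, ← integral_const_mul, ← integral_add
      (integrableOn_triangle c2 τ)
      (integrableOn_triangle continuous_const τ)]
    apply setIntegral_mono (integrableOn_triangle ((continuous_ev _).pow 2) τ)
      (integrableOn_triangle (c2.add continuous_const) τ)
    intro x
    change ev (p τ) x ^ 2 ≤ 2 * (ev (p τ) x - m τ.1) ^ 2 + 2 * m τ.1 ^ 2
    nlinarith [sq_nonneg (ev (p τ) x - 2 * m τ.1)]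
  have h1 := Finset.sum_le_sum fun τ (_ : τ ∈ Finset.univ) => hsplit τ
  rw [Finset.sum_add_distrib, ← Finset.mul_sum] at h1
  nlinarith [mul_nonneg hD0.le hJ0, mul_nonneg hD0.le hA0, mul_nonneg hR.le hU0,
    mul_nonneg (mul_nonneg (sq_nonneg R) hB.le) (add_nonneg hJ0 hA0)]

end Mesh

/-! ### Arc length, null sets and weights on the fracture. -/

namespace Fracture

/-- Unit speed on each straight piece, and the triangle inequality across the corners by induction
on the pieces. -/
theorem dist_le (F : Fracture) {x y : ℝ} (hx : x ∈ Icc 0 F.len) (hy : y ∈ Icc 0 F.len) :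
    dist (F.γ x) (F.γ y) ≤ dist x y := by
  obtain ⟨n, s, hs, h0, hn, hpoly⟩ := F.polygonal
  have key : ∀ i ≤ n, ∀ x ∈ Icc 0 (s i), ∀ y ∈ Icc 0 (s i), x ≤ y →
      dist (F.γ x) (F.γ y) ≤ y - x := by
    intro i
    induction i with
    | zero =>
      intro _ x hx y hy hxy
      rw [h0] at hx hy
      have : x = y := le_antisymm hxy (hy.2.trans hx.1)
      simp [this]
    | succ i ih =>
      intro hi x hx y hy hxy
      obtain ⟨d, hd, hseg⟩ := hpoly i hi
      have piece : ∀ u ∈ Icc (s i) (s (i + 1)), ∀ v ∈ Icc (s i) (s (i + 1)), u ≤ v →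
          dist (F.γ u) (F.γ v) ≤ v - u := by
        intro u hu v hv huv
        rw [hseg u hu, hseg v hv, dist_eq_norm]
        have : F.γ (s i) + (u - s i) • d - (F.γ (s i) + (v - s i) • d) = (u - v) • d := by
          rw [add_sub_add_left_eq_sub, ← sub_smul]; congr 1; ring
        rw [this, norm_smul, hd, mul_one, Real.norm_eq_abs, abs_sub_comm,
          abs_of_nonneg (sub_nonneg.2 huv)]
      have hsi : s i ∈ Icc (s i) (s (i + 1)) := ⟨le_rfl, hs (Nat.le_succ i)⟩
      have hsi' : s i ∈ Icc 0 (s i) := ⟨h0 ▸ hs (Nat.zero_le i), le_rfl⟩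
      rcases le_total y (s i) with h1 | h1
      · exact ih (by omega) x ⟨hx.1, hxy.trans h1⟩ y ⟨hy.1, h1⟩ hxy
      rcases le_total x (s i) with h2 | h2
      · have a1 := ih (by omega) x ⟨hx.1, h2⟩ (s i) hsi' h2
        have a2 := piece (s i) hsi y ⟨h1, hy.2⟩ h1
        linarith [dist_triangle (F.γ x) (F.γ (s i)) (F.γ y)]
      · exact piece x ⟨h2, hx.2⟩ y ⟨h1, hy.2⟩ hxy
  rw [← hn] at hx hy
  rcases le_total x y with h | h
  · rw [Real.dist_eq, abs_sub_comm, abs_of_nonneg (sub_nonneg.2 h)]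
    exact key n le_rfl x hx y hy h
  · rw [Real.dist_eq, abs_of_nonneg (sub_nonneg.2 h), dist_comm]
    exact key n le_rfl y hy x hx h

theorem lipschitzOnWith (F : Fracture) : LipschitzOnWith 1 F.γ (Icc 0 F.len) :=
  LipschitzOnWith.of_dist_le_mul fun x hx y hy => by simpa using F.dist_le hx hy

theorem continuousOn (F : Fracture) : ContinuousOn F.γ (Icc 0 F.len) :=
  F.lipschitzOnWith.continuousOn

theorem hausdorffMeasure_image_le (F : Fracture) {N : Set ℝ} (hN : N ⊆ Icc 0 F.len) :
    μH[1] (F.γ '' N) ≤ volume N := by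
  have := (F.lipschitzOnWith.mono hN).hausdorffMeasure_image_le zero_le_one
  rwa [hausdorffMeasure_real, ENNReal.coe_one, ENNReal.one_rpow, one_mul] at this

/-- Coefficients are given in the arc length parameter, edge integrals in an affine one.
One-dimensional Hausdorff measure compares the two: `γ` is 1-Lipschitz, so it maps null sets to null
sets, and `lineMap` scales the measure by the nonzero length of the edge. -/
theorem ae_lineMap (F : Fracture) {a b : Plane} (hab : a ≠ b) (hF : segment ℝ a b ⊆ F.carrier)
    {P : Plane → Prop} (hP : ∀ᵐ s ∂F.paramMeasure, P (F.γ s)) :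
    ∀ᵐ t ∂(volume.restrict (Ioc (0 : ℝ) 1)), P (AffineMap.lineMap a b t) := by
  rw [paramMeasure, ae_restrict_iff' measurableSet_Icc, ae_iff] at hP
  rw [ae_restrict_iff' measurableSet_Ioc, ae_iff]
  set N := {s | ¬(s ∈ Icc 0 F.len → P (F.γ s))} with hN
  have hNs : N ⊆ Icc 0 F.len := by
    intro s hs
    by_contra h
    exact hs fun h' => absurd h' h
  set T := {t : ℝ | ¬(t ∈ Ioc (0 : ℝ) 1 → P (AffineMap.lineMap a b t))} with hT
  have h1 : AffineMap.lineMap a b '' T ⊆ F.γ '' N := by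
    rintro _ ⟨t, ht, rfl⟩
    rw [hT, Set.mem_ofPred_eq, Classical.not_imp] at ht
    have h2 : (AffineMap.lineMap a b t : Plane) ∈ F.carrier := by
      apply hF
      rw [segment_eq_image_lineMap]
      exact ⟨t, ⟨ht.1.1.le, ht.1.2⟩, rfl⟩
    obtain ⟨s, hs, hst⟩ := h2
    refine ⟨s, ?_, hst⟩
    rw [hN, Set.mem_ofPred_eq, Classical.not_imp, hst]
    exact ⟨hs, ht.2⟩
  have h2 : μH[1] (AffineMap.lineMap a b '' T) = 0 := by
    refine measure_mono_null h1 (le_antisymm ?_ zero_le)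
    exact (F.hausdorffMeasure_image_le hNs).trans hP.le
  rw [hausdorffMeasure_lineMap_image, hausdorffMeasure_real] at h2
  have h3 : nndist a b ≠ 0 := by simpa [nndist_eq_zero] using hab
  rcases (smul_eq_zero.1 h2) with h | h
  · exact absurd h h3
  · exact h

/-- On the compact interval `γ` is a closed embedding, so a measurable representative in the
parameter extends to a measurable function on the plane, which can be composed with `lineMap`. -/
theorem aemeasurable_lineMap (F : Fracture) {a b : Plane} (hab : a ≠ b)
    (hF : segment ℝ a b ⊆ F.carrier) {w : Plane → ℝ}
    (hw : AEMeasurable (fun s => w (F.γ s)) F.paramMeasure) :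
    AEMeasurable (fun t : ℝ => w (AffineMap.lineMap a b t)) (volume.restrict (Ioc (0 : ℝ) 1)) := by
  obtain ⟨g, hg, hgw⟩ := hw
  have hemb : Topology.IsClosedEmbedding ((Icc 0 F.len).domRestrict F.γ) :=
    (continuousOn_iff_continuous_domRestrict.1 F.continuousOn).isClosedEmbedding
      (injOn_iff_injective.1 F.injOn)
  obtain ⟨g', hg', hgg⟩ := hemb.measurableEmbedding.exists_measurable_extend
    (hg.comp measurable_subtype_coe) fun _ => ⟨0⟩
  have h1 : ∀ᵐ s ∂F.paramMeasure, w (F.γ s) = g' (F.γ s) := by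
    filter_upwards [hgw, (ae_restrict_mem measurableSet_Icc : ∀ᵐ s ∂F.paramMeasure, s ∈ Icc 0 F.len)]
      with s hs hmem
    rw [hs]
    exact (congrFun hgg ⟨s, hmem⟩).symm
  refine ⟨fun t => g' (AffineMap.lineMap a b t), hg'.comp (continuous_lineMap a b).measurable, ?_⟩
  exact F.ae_lineMap (P := fun x => w x = g' x) hab hF h1

/-- A positive coefficient on the fracture: measurable and bounded above and below by positive
constants almost everywhere. -/
structure IsWeight (F : Fracture) (w : Plane → ℝ) : Prop where
  meas : AEMeasurable (fun s => w (F.γ s)) F.paramMeasure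
  bounds : ∃ c₁ c₂ : ℝ, 0 < c₁ ∧ ∀ᵐ s ∂F.paramMeasure, c₁ ≤ w (F.γ s) ∧ w (F.γ s) ≤ c₂

variable {F : Fracture}

theorem ae_mem (F : Fracture) : ∀ᵐ s ∂F.paramMeasure, s ∈ Icc 0 F.len :=
  ae_restrict_mem measurableSet_Icc

instance (F : Fracture) : NeZero F.paramMeasure := by
  refine ⟨fun h => ?_⟩
  have : F.paramMeasure univ = 0 := by rw [h]; simp
  rw [paramMeasure, Measure.restrict_apply_univ, Real.volume_Icc] at this
  simp only [sub_zero, ENNReal.ofReal_eq_zero, not_le.2 F.len_pos] at this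

/-- The parameter measure is nonzero, so the bounds hold at some point, and there the upper one
dominates the positive lower one. -/
theorem IsWeight.pos_bounds {w : Plane → ℝ} (h : F.IsWeight w) :
    ∃ c₁ c₂ : ℝ, 0 < c₁ ∧ 0 < c₂ ∧ ∀ᵐ s ∂F.paramMeasure, c₁ ≤ w (F.γ s) ∧ w (F.γ s) ≤ c₂ := by
  obtain ⟨c₁, c₂, h1, h2⟩ := h.bounds
  obtain ⟨s, hs⟩ := h2.exists
  exact ⟨c₁, c₂, h1, by linarith, h2⟩

theorem IsWeight.mul {w w' : Plane → ℝ} (h : F.IsWeight w) (h' : F.IsWeight w') :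
    F.IsWeight fun x => w x * w' x := by
  refine ⟨h.meas.mul h'.meas, ?_⟩
  obtain ⟨c₁, c₂, h1, h2, hb⟩ := h.pos_bounds
  obtain ⟨d₁, d₂, h1', h2', hb'⟩ := h'.pos_bounds
  refine ⟨c₁ * d₁, c₂ * d₂, by positivity, ?_⟩
  filter_upwards [hb, hb'] with s hs hs'
  exact ⟨mul_le_mul hs.1 hs'.1 h1'.le (h1.le.trans hs.1),
    mul_le_mul hs.2 hs'.2 (h1'.le.trans hs'.1) h2.le⟩

theorem IsWeight.inv {w : Plane → ℝ} (h : F.IsWeight w) : F.IsWeight fun x => (w x)⁻¹ := by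
  refine ⟨h.meas.inv, ?_⟩
  obtain ⟨c₁, c₂, h1, h2, hb⟩ := h.pos_bounds
  refine ⟨c₂⁻¹, c₁⁻¹, by positivity, ?_⟩
  filter_upwards [hb] with s hs
  have : 0 < w (F.γ s) := h1.trans_le hs.1
  exact ⟨by gcongr; exact hs.2, by gcongr; exact hs.1⟩

theorem isWeight_const (F : Fracture) {r : ℝ} (hr : 0 < r) : F.IsWeight fun _ => r :=
  ⟨aemeasurable_const, r, r, hr, by simp⟩

theorem IsWeight.edgeIntegrable {w f : Plane → ℝ} (h : F.IsWeight w) {a b : Plane} (hab : a ≠ b)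
    (hF : segment ℝ a b ⊆ F.carrier) (hf : Continuous f) :
    EdgeIntegrable a b fun x => w x * f x := by
  rw [EdgeIntegrable, intervalIntegrable_iff_integrableOn_Ioc_of_le zero_le_one]
  obtain ⟨c₁, c₂, h1, h2, hb⟩ := h.pos_bounds
  refine Integrable.bdd_mul (c := c₂)
    (Continuous.integrableOn_Ioc (hf.comp (continuous_lineMap a b)))
    (F.aemeasurable_lineMap hab hF h.meas).aestronglyMeasurable ?_
  filter_upwards [F.ae_lineMap (P := fun x => c₁ ≤ w x ∧ w x ≤ c₂) hab hF hb] with t ht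
  rw [Real.norm_eq_abs, abs_of_pos (h1.trans_le ht.1)]
  exact ht.2

theorem IsWeight.exists_edgeIntegral_le {w : Plane → ℝ} (h : F.IsWeight w) :
    ∃ c₁ : ℝ, 0 < c₁ ∧ ∀ {a b : Plane}, a ≠ b → segment ℝ a b ⊆ F.carrier → ∀ {f : Plane → ℝ},
      Continuous f → (∀ x, 0 ≤ f x) →
        c₁ * edgeIntegral a b f ≤ edgeIntegral a b fun x => w x * f x := by
  obtain ⟨c₁, c₂, h1, h2, hb⟩ := h.pos_bounds
  refine ⟨c₁, h1, fun {a b} hab hF {f} hf hf0 => ?_⟩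
  rw [← edgeIntegral_const_mul]
  apply mul_le_mul_of_nonneg_left _ dist_nonneg
  rw [intervalIntegral.integral_of_le zero_le_one, intervalIntegral.integral_of_le zero_le_one]
  have i1 := (Continuous.edgeIntegrable hf a b).const_mul c₁
  have i2 := h.edgeIntegrable hab hF hf
  rw [EdgeIntegrable, intervalIntegrable_iff_integrableOn_Ioc_of_le zero_le_one] at i1 i2
  apply integral_mono_ae i1 i2
  filter_upwards [F.ae_lineMap (P := fun x => c₁ ≤ w x ∧ w x ≤ c₂) hab hF hb] with t ht
  exact mul_le_mul_of_nonneg_right ht.1 (hf0 _)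

theorem IsWeight.edgeIntegral_nonneg {w : Plane → ℝ} (h : F.IsWeight w) {a b : Plane} (hab : a ≠ b)
    (hF : segment ℝ a b ⊆ F.carrier) {f : Plane → ℝ} (hf0 : ∀ x, 0 ≤ f x) :
    0 ≤ edgeIntegral a b fun x => w x * f x := by
  obtain ⟨c₁, c₂, h1, h2, hb⟩ := h.pos_bounds
  apply mul_nonneg dist_nonneg
  rw [intervalIntegral.integral_of_le zero_le_one]
  apply integral_nonneg_of_ae
  filter_upwards [F.ae_lineMap (P := fun x => c₁ ≤ w x ∧ w x ≤ c₂) hab hF hb] with t ht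
  exact mul_nonneg (h1.le.trans ht.1) (hf0 _)

end Fracture

namespace Coefficients

variable {G : Geometry} (c : Coefficients G)

theorem isWeight_ℓ : G.F.IsWeight c.ℓ := ⟨c.ℓ_meas, c.ℓ_bounds⟩

theorem isWeight_KΓ : G.F.IsWeight c.KΓ :=
  Fracture.IsWeight.mul ⟨c.κt_meas, c.κt_bounds⟩ c.isWeight_ℓ

theorem isWeight_η : G.F.IsWeight c.η :=
  c.isWeight_ℓ.mul (Fracture.IsWeight.inv ⟨c.κn_meas, c.κn_bounds⟩)

theorem isWeight_α : G.F.IsWeight c.α :=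
  c.isWeight_η.mul (G.F.isWeight_const (by linarith [c.ξ_gt]))

end Coefficients

namespace Mesh

variable {G : Geometry} {M : Mesh G}

theorem measurableSet_outerEdge (τ : M.Tri) : MeasurableSet (M.outerEdge τ) := by
  rw [outerEdge, segment_eq_image_lineMap]
  exact (isCompact_Icc.image (continuous_lineMap _ _)).isClosed.measurableSet

/-- Distinct fracture edges meet in finite sets, so their one-dimensional measures add up to at most
that of the fracture, itself at most `len` by the Lipschitz bound. -/
theorem sum_length_fractureEdges_le :
    ∑ e ∈ M.fractureEdges, dist (M.va e.1) (M.vb e.1) ≤ G.F.len := by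
  have hdisj : Set.Pairwise (M.fractureEdges : Set (M.Tri × M.Tri))
      (Function.onFun (AEDisjoint μH[1]) fun e => M.outerEdge e.1) := by
    intro e he e' he' hne
    rcases M.conforming e.1.1 e'.1.1 e.1.2 e'.1.2 with h | h
    · exfalso
      apply hne
      have h' : M.outerEdge e.1 = M.outerEdge e'.1 := h
      by_cases h1 : e.1 = e'.1
      · exact injOn_fst_fractureEdges he he' h1
      · have h2 : e.2 = e'.1 := eq_of_outerEdge_eq (ne_of_mem_fractureEdges he) h1
          (mem_fractureEdges.1 he).1.symm h'.symm
        have a1 := (mem_fractureEdges.1 he).2.2.2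
        have a2 := (mem_fractureEdges.1 he').2.2.1
        rw [h2] at a1
        exact absurd rfl (ne_of_sides a2 a1)
    · have := Measure.nullSingletonClass_hausdorff Plane (d := 1) one_pos
      refine measure_mono_null (h.trans inter_subset_left) (Set.Finite.measure_zero ?_ _)
      exact Set.toFinite _
  have h1 := measure_biUnion_finset₀ (μ := (μH[1] : Measure Plane)) hdisj fun e _ =>
    (measurableSet_outerEdge e.1).nullMeasurableSet
  have h2 : μH[1] (⋃ e ∈ M.fractureEdges, M.outerEdge e.1) ≤ ENNReal.ofReal G.F.len := by
    calc _ ≤ μH[1] G.F.carrier := measure_mono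
          (iUnion₂_subset fun e he => (mem_fractureEdges.1 he).2.1)
      _ ≤ volume (Icc 0 G.F.len) := G.F.hausdorffMeasure_image_le subset_rfl
      _ = _ := by rw [Real.volume_Icc, sub_zero]
  rw [h1] at h2
  have h3 : ∀ e : M.Tri × M.Tri, μH[1] (M.outerEdge e.1) =
      ENNReal.ofReal (dist (M.va e.1) (M.vb e.1)) := by
    intro e
    rw [outerEdge, hausdorffMeasure_segment, edist_dist]
  simp only [h3] at h2
  rw [← ENNReal.ofReal_sum_of_nonneg fun _ _ => dist_nonneg] at h2
  exact (ENNReal.ofReal_le_ofReal_iff G.F.len_pos.le).1 h2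

end Mesh

/-! ### Derivative and uniform bound in `H¹₀` of an interval. -/

namespace MemH10

variable {L : ℝ} {φ ψ : ℝ → ℝ}

theorem intervalIntegrable_of_memLp {g : ℝ → ℝ} (hg : MemLp g 2 (volume.restrict (Icc 0 L)))
    {s : ℝ} (hs : s ∈ Icc 0 L) : IntervalIntegrable g volume 0 s := by
  rw [intervalIntegrable_iff_integrableOn_Icc_of_le hs.1]
  exact IntegrableOn.mono_set (hg.integrable (by norm_num)) (Icc_subset_Icc_right hs.2)

theorem zero : MemH10 L fun _ => 0 := ⟨fun _ => 0, MemLp.zero, by simp, rfl⟩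

theorem add (hφ : MemH10 L φ) (hψ : MemH10 L ψ) : MemH10 L fun s => φ s + ψ s := by
  obtain ⟨g, hg, h1, h2⟩ := hφ
  obtain ⟨g', hg', h1', h2'⟩ := hψ
  refine ⟨fun s => g s + g' s, hg.add hg', fun s hs => ?_, by simp [h2, h2']⟩
  rw [intervalIntegral.integral_add (intervalIntegrable_of_memLp hg hs)
    (intervalIntegrable_of_memLp hg' hs), ← h1 s hs, ← h1' s hs]

theorem const_mul (hφ : MemH10 L φ) (r : ℝ) : MemH10 L fun s => r * φ s := by
  obtain ⟨g, hg, h1, h2⟩ := hφ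
  refine ⟨fun s => r * g s, hg.const_mul r, fun s hs => ?_, by simp [h2]⟩
  rw [intervalIntegral.integral_const_mul, ← h1 s hs]

theorem ae_hasDerivAt (hL : 0 < L) {g : ℝ → ℝ} (hg : MemLp g 2 (volume.restrict (Icc 0 L)))
    (h : ∀ s ∈ Icc 0 L, φ s = ∫ r in (0 : ℝ)..s, g r) :
    ∀ᵐ s ∂(volume.restrict (Icc 0 L)), HasDerivAt φ (g s) s := by
  have h1 := IntervalIntegrable.ae_hasDerivAt_integral
    (intervalIntegrable_of_memLp hg (right_mem_Icc.2 hL.le))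
  rw [ae_restrict_iff' measurableSet_Icc]
  -- The representation is known on `[0, L]` only, so the end points are discarded to have it in a
  -- neighbourhood.
  have n0 : ∀ᵐ s : ℝ, s ≠ 0 := by simp [ae_iff, measure_singleton]
  have nL : ∀ᵐ s : ℝ, s ≠ L := by simp [ae_iff, measure_singleton]
  filter_upwards [h1, n0, nL] with s hs hs0 hsL hmem
  rw [uIcc_of_le hL.le] at hs
  refine (hs hmem 0 (left_mem_Icc.2 hL.le)).congr_of_eventuallyEq ?_
  have hnb : Ioo 0 L ∈ nhds s :=
    Ioo_mem_nhds (lt_of_le_of_ne hmem.1 hs0.symm) (lt_of_le_of_ne hmem.2 hsL)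
  filter_upwards [hnb] with r hr
  exact h r ⟨hr.1.le, hr.2.le⟩

theorem hasDerivAt (hL : 0 < L) (hφ : MemH10 L φ) :
    ∀ᵐ s ∂(volume.restrict (Icc 0 L)), HasDerivAt φ (deriv φ s) s := by
  obtain ⟨g, hg, h1, -⟩ := hφ
  filter_upwards [ae_hasDerivAt hL hg h1] with s hs
  rwa [hs.deriv]

theorem memLp_deriv (hL : 0 < L) (hφ : MemH10 L φ) :
    MemLp (deriv φ) 2 (volume.restrict (Icc 0 L)) := by
  obtain ⟨g, hg, h1, -⟩ := hφ
  refine hg.ae_eq ?_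
  filter_upwards [ae_hasDerivAt hL hg h1] with s hs
  exact hs.deriv.symm

theorem eq_integral (hL : 0 < L) (hφ : MemH10 L φ) {s : ℝ} (hs : s ∈ Icc 0 L) :
    φ s = ∫ r in (0 : ℝ)..s, deriv φ r := by
  obtain ⟨g, hg, h1, -⟩ := hφ
  rw [h1 s hs, intervalIntegral.integral_of_le hs.1, intervalIntegral.integral_of_le hs.1]
  apply integral_congr_ae
  refine ae_restrict_of_ae_restrict_of_subset
    (Ioc_subset_Icc_self.trans (Icc_subset_Icc_right hs.2)) ?_
  filter_upwards [ae_hasDerivAt hL hg h1] with s hs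
  exact hs.deriv.symm

/-- Cauchy–Schwarz for the primitive starting from `0`, with `s ≤ L`. -/
theorem sq_le (hL : 0 < L) (hφ : MemH10 L φ) {s : ℝ} (hs : s ∈ Icc 0 L) :
    φ s ^ 2 ≤ L * ∫ r in Icc 0 L, deriv φ r ^ 2 := by
  have hg := memLp_deriv hL hφ
  have i2 : IntegrableOn (fun r => deriv φ r ^ 2) (Icc 0 L) := hg.integrable_sq
  have i1 : IntegrableOn (deriv φ) (Icc 0 L) := hg.integrable (by norm_num)
  have hsub : Icc 0 s ⊆ Icc 0 L := Icc_subset_Icc_right hs.2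
  rw [eq_integral hL hφ hs, intervalIntegral.integral_of_le hs.1, ← integral_Icc_eq_integral_Ioc]
  have key : (∫ r in Icc 0 s, deriv φ r) ^ 2 ≤ (∫ r in Icc 0 s, deriv φ r ^ 2) * s := by
    apply sq_le_mul_of_quadratic_nonneg
    intro t
    have j1 : IntegrableOn (fun r => t ^ 2 * deriv φ r ^ 2) (Icc 0 s) :=
      (i2.mono_set hsub).const_mul _
    have j2 : IntegrableOn (fun r => 2 * t * deriv φ r) (Icc 0 s) :=
      (i1.mono_set hsub).const_mul _
    have j3 : IntegrableOn (fun _ : ℝ => (1 : ℝ)) (Icc 0 s) := by simp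
    have e : t ^ 2 * (∫ r in Icc 0 s, deriv φ r ^ 2) - 2 * t * (∫ r in Icc 0 s, deriv φ r) + s =
        ∫ r in Icc 0 s, (t ^ 2 * deriv φ r ^ 2 - 2 * t * deriv φ r + 1) := by
      have j4 : IntegrableOn (fun r => t ^ 2 * deriv φ r ^ 2 - 2 * t * deriv φ r) (Icc 0 s) :=
        j1.sub j2
      rw [integral_add j4 j3, integral_sub j1 j2, integral_const_mul,
        integral_const_mul]
      simp [hs.1]
    rw [e]
    apply integral_nonneg
    intro r
    change 0 ≤ t ^ 2 * deriv φ r ^ 2 - 2 * t * deriv φ r + 1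
    nlinarith [sq_nonneg (t * deriv φ r - 1)]
  refine key.trans ?_
  rw [mul_comm]
  apply mul_le_mul hs.2 _ (integral_nonneg fun _ => sq_nonneg _) hL.le
  exact setIntegral_mono_set i2 (Filter.Eventually.of_forall fun _ => sq_nonneg _)
    hsub.eventuallyLE

end MemH10

/-! ### Tangential gradients and traces on the fracture. -/

namespace Fracture

variable (F : Fracture)

theorem integral_eq (g : ℝ → ℝ) : F.integral g = ∫ s, g s ∂F.paramMeasure := by
  rw [integral, intervalIntegral.integral_of_le F.len_pos.le, paramMeasure,
    integral_Icc_eq_integral_Ioc]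

variable {F}

/-- Additivity needs differentiability of both summands, which holds almost everywhere in `H¹₀`. -/
theorem tgrad_add {q q' : Plane → ℝ} (h : MemH10 F.len fun s => q (F.γ s))
    (h' : MemH10 F.len fun s => q' (F.γ s)) :
    ∀ᵐ s ∂F.paramMeasure, F.tgrad (q + q') s = F.tgrad q s + F.tgrad q' s := by
  filter_upwards [h.hasDerivAt F.len_pos, h'.hasDerivAt F.len_pos] with s hs hs'
  exact (hs.add hs').deriv

theorem tgrad_smul (r : ℝ) (q : Plane → ℝ) (s : ℝ) : F.tgrad (r • q) s = r * F.tgrad q s := by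
  simp only [tgrad, Pi.smul_apply, smul_eq_mul]
  exact deriv_const_mul_field r

theorem sq_le_integral_tgrad {q : Plane → ℝ} (h : MemH10 F.len fun s => q (F.γ s)) {x : Plane}
    (hx : x ∈ F.carrier) : q x ^ 2 ≤ F.len * F.integral fun s => F.tgrad q s ^ 2 := by
  obtain ⟨s, hs, rfl⟩ := hx
  rw [integral_eq]
  exact h.sq_le F.len_pos hs

theorem IsWeight.integrable_mul {w : Plane → ℝ} (hw : F.IsWeight w) {f : ℝ → ℝ}
    (hf : Integrable f F.paramMeasure) : Integrable (fun s => w (F.γ s) * f s) F.paramMeasure := by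
  obtain ⟨c₁, c₂, h1, h2, hb⟩ := hw.pos_bounds
  refine hf.bdd_mul (c := c₂) hw.meas.aestronglyMeasurable ?_
  filter_upwards [hb] with s hs
  rw [Real.norm_eq_abs, abs_of_pos (h1.trans_le hs.1)]
  exact hs.2

theorem memLp_tgrad {q : Plane → ℝ} (h : MemH10 F.len fun s => q (F.γ s)) :
    MemLp (F.tgrad q) 2 F.paramMeasure := h.memLp_deriv F.len_pos

theorem memLp_trace {q : Plane → ℝ} (h : MemH10 F.len fun s => q (F.γ s)) :
    MemLp (fun s => q (F.γ s)) 2 F.paramMeasure := by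
  have hc : ContinuousOn (fun s => q (F.γ s)) (Icc 0 F.len) := by
    obtain ⟨g, hg, h1, -⟩ := h
    have := intervalIntegral.continuousOn_primitive_interval
      ((intervalIntegrable_iff' (by simp)).1 (MemH10.intervalIntegrable_of_memLp hg
        (right_mem_Icc.2 F.len_pos.le)))
    rw [uIcc_of_le F.len_pos.le] at this
    exact this.congr h1
  have : IsFiniteMeasure F.paramMeasure := by unfold paramMeasure; infer_instance
  refine MemLp.of_bound (hc.aestronglyMeasurable measurableSet_Icc)
    (Real.sqrt (F.len * F.integral fun s => F.tgrad q s ^ 2)) ?_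
  filter_upwards [F.ae_mem] with s hs
  rw [Real.norm_eq_abs]
  exact Real.abs_le_sqrt (sq_le_integral_tgrad h ⟨s, hs, rfl⟩)

end Fracture

/-! ### The discrete spaces as finite-dimensional submodules. -/

namespace Mesh

variable {G : Geometry} (M : Mesh G)

/-- The space `W_h` as a submodule. -/
def WhSub (k : ℕ) : Submodule ℝ (Plane → ℝ) where
  carrier := M.Wh k
  zero_mem' := ⟨fun _ _ => rfl, MemH10.zero, fun _ _ => ⟨0, by simp, fun _ _ => by simp⟩⟩
  add_mem' := by
    rintro p q ⟨h1, h2, h3⟩ ⟨h1', h2', h3'⟩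
    refine ⟨fun x hx => by simp [h1 x hx, h1' x hx], h2.add h2', fun e he => ?_⟩
    obtain ⟨P, hP, hPx⟩ := h3 e he
    obtain ⟨Q, hQ, hQx⟩ := h3' e he
    exact ⟨P + Q, (MvPolynomial.totalDegree_add P Q).trans (max_le hP hQ),
      fun x hx => by simp [hPx x hx, hQx x hx]⟩
  smul_mem' := by
    rintro r p ⟨h1, h2, h3⟩
    refine ⟨fun x hx => by simp [h1 x hx], h2.const_mul r, fun e he => ?_⟩
    obtain ⟨P, hP, hPx⟩ := h3 e he
    exact ⟨r • P, (MvPolynomial.totalDegree_smul_le r P).trans hP, fun x hx => by simp [hPx x hx]⟩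

/-- The space `S_h` as a submodule. -/
def ShSub (k : ℕ) : Submodule ℝ M.Scalar where
  carrier := M.Sh k
  zero_mem' := ⟨fun _ => by simp, fun _ _ _ _ => by simp [jump], fun _ _ _ _ => by simp⟩
  add_mem' := by
    rintro p q ⟨h1, h2, h3⟩ ⟨h1', h2', h3'⟩
    refine ⟨fun τ => (MvPolynomial.totalDegree_add _ _).trans (max_le (h1 τ) (h1' τ)),
      fun e he x hx => ?_, fun τ hτ x hx => by simp [h3 τ hτ x hx, h3' τ hτ x hx]⟩
    have a := h2 e he x hx
    have b := h2' e he x hx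
    simp only [jump, Pi.add_apply, ev_add] at a b ⊢
    linarith
  smul_mem' := by
    rintro r p ⟨h1, h2, h3⟩
    refine ⟨fun τ => (MvPolynomial.totalDegree_smul_le _ _).trans (h1 τ),
      fun e he x hx => ?_, fun τ hτ x hx => by simp [h3 τ hτ x hx]⟩
    have a := h2 e he x hx
    simp only [jump, Pi.smul_apply, ev_smul] at a ⊢
    rw [← mul_sub, a, mul_zero]

theorem dotN_add (u v : M.Vector) (τ : M.Tri) (n x : Plane) :
    dotN (u + v) τ n x = dotN u τ n x + dotN v τ n x := by
  simp [dotN]; ring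

theorem dotN_smul (r : ℝ) (v : M.Vector) (τ : M.Tri) (n x : Plane) :
    dotN (r • v) τ n x = r * dotN v τ n x := by
  simp [dotN]; ring

/-- The space `V_h` as a submodule. -/
def VhSub (k : ℕ) : Submodule ℝ M.Vector where
  carrier := M.Vh k
  zero_mem' := ⟨fun _ _ => by simp, fun _ _ _ => by simp [dotN]⟩
  add_mem' := by
    rintro p q ⟨h1, h2⟩ ⟨h1', h2'⟩
    refine ⟨fun τ i => (MvPolynomial.totalDegree_add _ _).trans (max_le (h1 τ i) (h1' τ i)),
      fun τ x hx => ?_⟩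
    rw [dotN_add, dotN_add]
    linarith [h2 τ x hx, h2' τ x hx]
  smul_mem' := by
    rintro r p ⟨h1, h2⟩
    refine ⟨fun τ i => (MvPolynomial.totalDegree_smul_le _ _).trans (h1 τ i), fun τ x hx => ?_⟩
    rw [dotN_smul, dotN_smul, ← mul_sub, h2 τ x hx, mul_zero]

/-- The polynomials of total degree at most `k`. -/
abbrev Pk (k : ℕ) : Submodule ℝ (MvPolynomial (Fin 2) ℝ) :=
  MvPolynomial.restrictTotalDegree (Fin 2) ℝ k

instance (k : ℕ) : Module.Finite ℝ (M.ShSub k) := by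
  let f : (M.Tri → Pk k) →ₗ[ℝ] M.Scalar :=
    LinearMap.pi fun τ => (Pk k).subtype ∘ₗ LinearMap.proj τ
  refine Submodule.finiteDimensional_of_le (S₂ := LinearMap.range f) fun q hq => ?_
  exact ⟨fun τ => ⟨q τ, (MvPolynomial.mem_restrictTotalDegree _ _ _).2 (hq.1 τ)⟩, rfl⟩

instance (k : ℕ) : Module.Finite ℝ (M.VhSub k) := by
  let f : (M.Tri → Fin 2 → Pk k) →ₗ[ℝ] M.Vector :=
    LinearMap.pi fun τ => LinearMap.pi fun i =>
      (Pk k).subtype ∘ₗ LinearMap.proj i ∘ₗ LinearMap.proj τ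
  refine Submodule.finiteDimensional_of_le (S₂ := LinearMap.range f) fun q hq => ?_
  exact ⟨fun τ i => ⟨q τ i, (MvPolynomial.mem_restrictTotalDegree _ _ _).2 (hq.1 τ i)⟩, rfl⟩

variable {M}

/-- Elements of `W_h` are functions on the plane. Choosing for each fracture point one edge through
it, every such function is the image of a family of polynomials under one linear map; that map may
also produce functions that are not continuous. -/
theorem finite_WhSub (hM : M.IsStar) (k : ℕ) : Module.Finite ℝ (M.WhSub k) := by
  classical
  choose e he hx using fun (x : Plane) (hx : x ∈ G.F.carrier) =>
    exists_fractureEdge_of_mem_carrier hM hx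
  let f : (M.Tri × M.Tri → Pk k) →ₗ[ℝ] (Plane → ℝ) :=
    { toFun := fun P x => if h : x ∈ G.F.carrier then ev (P (e x h) : MvPolynomial (Fin 2) ℝ) x else 0
      map_add' := fun P Q => by
        ext x; by_cases h : x ∈ G.F.carrier <;> simp [h]
      map_smul' := fun r P => by
        ext x; by_cases h : x ∈ G.F.carrier <;> simp [h] }
  refine Submodule.finiteDimensional_of_le (S₂ := LinearMap.range f) fun q hq => ?_
  have h3 : ∀ e, ∃ P : Pk k, e ∈ M.fractureEdges → ∀ x ∈ M.outerEdge e.1,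
      q x = ev (P : MvPolynomial (Fin 2) ℝ) x := by
    intro e
    by_cases h : e ∈ M.fractureEdges
    · obtain ⟨P, hP, hPx⟩ := hq.2.2 e h
      exact ⟨⟨P, (MvPolynomial.mem_restrictTotalDegree _ _ _).2 hP⟩, fun _ => hPx⟩
    · exact ⟨0, fun h' => absurd h' h⟩
  choose P hP using h3
  refine ⟨P, ?_⟩
  ext x
  by_cases h : x ∈ G.F.carrier
  · simp only [f, LinearMap.coe_mk, AddHom.coe_mk, dif_pos h]
    exact (hP _ (he x h) x (hx x h)).symm
  · simp only [f, LinearMap.coe_mk, AddHom.coe_mk, dif_neg h]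
    exact (hq.1 x h).symm

end Mesh

/-! ### Functionals linear on a submodule, and solvability by injectivity. -/

section LinearOn

variable {X : Type*} [AddCommGroup X] [Module ℝ X] {S : Submodule ℝ X}

/-- The restriction of `f` to the submodule `S` is linear. -/
structure IsLinOn (S : Submodule ℝ X) (f : X → ℝ) : Prop where
  add : ∀ x ∈ S, ∀ y ∈ S, f (x + y) = f x + f y
  smul : ∀ (r : ℝ), ∀ x ∈ S, f (r • x) = r * f x

theorem IsLinOn.fun_add {f g : X → ℝ} (hf : IsLinOn S f) (hg : IsLinOn S g) :
    IsLinOn S fun x => f x + g x :=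
  ⟨fun x hx y hy => by rw [hf.add x hx y hy, hg.add x hx y hy]; ring,
    fun r x hx => by rw [hf.smul r x hx, hg.smul r x hx]; ring⟩

theorem IsLinOn.fun_sub {f g : X → ℝ} (hf : IsLinOn S f) (hg : IsLinOn S g) :
    IsLinOn S fun x => f x - g x :=
  ⟨fun x hx y hy => by rw [hf.add x hx y hy, hg.add x hx y hy]; ring,
    fun r x hx => by rw [hf.smul r x hx, hg.smul r x hx]; ring⟩

theorem IsLinOn.sum {ι : Type*} {s : Finset ι} {f : ι → X → ℝ} (hf : ∀ i ∈ s, IsLinOn S (f i)) :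
    IsLinOn S fun x => ∑ i ∈ s, f i x :=
  ⟨fun x hx y hy => by
      rw [← Finset.sum_add_distrib]
      exact Finset.sum_congr rfl fun i hi => (hf i hi).add x hx y hy,
    fun r x hx => by
      rw [Finset.mul_sum]
      exact Finset.sum_congr rfl fun i hi => (hf i hi).smul r x hx⟩

theorem IsLinOn.integral {α : Type*} [MeasurableSpace α] {μ : Measure α} {h : X → α → ℝ}
    (hi : ∀ x ∈ S, Integrable (h x) μ)
    (hadd : ∀ x ∈ S, ∀ y ∈ S, ∀ᵐ t ∂μ, h (x + y) t = h x t + h y t)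
    (hsmul : ∀ (r : ℝ), ∀ x ∈ S, ∀ᵐ t ∂μ, h (r • x) t = r * h x t) :
    IsLinOn S fun x => ∫ t, h x t ∂μ :=
  ⟨fun x hx y hy => by
      rw [← integral_add (hi x hx) (hi y hy)]
      exact integral_congr_ae (hadd x hx y hy),
    fun r x hx => by
      rw [← integral_const_mul]
      exact integral_congr_ae (hsmul r x hx)⟩

theorem IsLinOn.edgeIntegral {a b : Plane} {h : X → Plane → ℝ}
    (hi : ∀ x ∈ S, EdgeIntegrable a b (h x))
    (hadd : ∀ x y t, h (x + y) t = h x t + h y t) (hsmul : ∀ (r : ℝ) x t, h (r • x) t = r * h x t) :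
    IsLinOn S fun x => edgeIntegral a b (h x) :=
  ⟨fun x hx y hy => by
      rw [← edgeIntegral_add (hi x hx) (hi y hy)]
      exact edgeIntegral_congr fun t _ => hadd x y t,
    fun r x hx => by
      rw [← edgeIntegral_const_mul]
      exact edgeIntegral_congr fun t _ => hsmul r x t⟩

/-- The linear functional on `S` defined by `f`. -/
def IsLinOn.toLinearMap {f : X → ℝ} (hf : IsLinOn S f) : S →ₗ[ℝ] ℝ where
  toFun x := f x
  map_add' x y := hf.add x x.2 y y.2
  map_smul' r x := hf.smul r x x.2

/-- The form induces a map from `S` to its dual, of the same finite dimension, so injectivity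
implies bijectivity. Linearity is asked on `S` only, since outside it the integrals need not be
additive. -/
theorem existsUnique_of_isLinOn [Module.Finite ℝ S] {B : X → X → ℝ}
    (h₁ : ∀ y ∈ S, IsLinOn S fun x => B x y) (h₂ : ∀ x ∈ S, IsLinOn S (B x))
    (h₀ : ∀ x ∈ S, (∀ y ∈ S, B x y = 0) → x = 0) {f : X → ℝ} (hf : IsLinOn S f) :
    ∃! x, x ∈ S ∧ ∀ y ∈ S, B x y = f y := by
  let T : S →ₗ[ℝ] Module.Dual ℝ S :=
    { toFun := fun x => (h₂ x x.2).toLinearMap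
      map_add' := fun x y => LinearMap.ext fun z => (h₁ z z.2).add x x.2 y y.2
      map_smul' := fun r x => LinearMap.ext fun z => (h₁ z z.2).smul r x x.2 }
  have hT : ∀ x y : S, T x y = B x y := fun _ _ => rfl
  have hinj : Function.Injective T := by
    rw [injective_iff_map_eq_zero]
    intro x hx
    apply Subtype.ext
    refine h₀ x x.2 fun y hy => ?_
    exact (hT x ⟨y, hy⟩).symm.trans (by rw [hx]; rfl)
  have hsurj := (LinearMap.injective_iff_surjective_of_finrank_eq_finrank
    (Subspace.dual_finrank_eq (K := ℝ) (V := S)).symm).1 hinj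
  obtain ⟨x, hx⟩ := hsurj hf.toLinearMap
  have hxy : ∀ y ∈ S, B x y = f y := fun y hy =>
    (hT x ⟨y, hy⟩).symm.trans (by rw [hx]; rfl)
  refine ⟨x, ⟨x.2, hxy⟩, fun z hz => ?_⟩
  have : T ⟨z, hz.1⟩ = T x := by
    ext y
    exact (hz.2 y y.2).trans (hxy y y.2).symm
  exact congrArg Subtype.val (hinj this)

end LinearOn

/-! ### The bilinear and linear forms of the coupled problem. -/

namespace Mesh

variable {G : Geometry} {M : Mesh G}

theorem jump_add (p q : M.Scalar) (e : M.Tri × M.Tri) (x : Plane) :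
    jump (p + q) e x = jump p e x + jump q e x := by simp [jump]; ring

theorem jump_smul (r : ℝ) (p : M.Scalar) (e : M.Tri × M.Tri) (x : Plane) :
    jump (r • p) e x = r * jump p e x := by simp [jump]; ring

theorem avg_add (p q : M.Scalar) (e : M.Tri × M.Tri) (x : Plane) :
    avg (p + q) e x = avg p e x + avg q e x := by simp [avg]; ring

theorem avg_smul (r : ℝ) (p : M.Scalar) (e : M.Tri × M.Tri) (x : Plane) :
    avg (r • p) e x = r * avg p e x := by simp [avg]; ring

theorem jumpN_add (u v : M.Vector) (e : M.Tri × M.Tri) (x : Plane) :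
    jumpN (u + v) e x = jumpN u e x + jumpN v e x := by
  simp only [jumpN, dotN_add]; ring

theorem jumpN_smul (r : ℝ) (v : M.Vector) (e : M.Tri × M.Tri) (x : Plane) :
    jumpN (r • v) e x = r * jumpN v e x := by
  simp only [jumpN, dotN_smul]; ring

theorem avgN_add (u v : M.Vector) (e : M.Tri × M.Tri) (x : Plane) :
    avgN (u + v) e x = avgN u e x + avgN v e x := by
  simp only [avgN, dotN_add]; ring

theorem avgN_smul (r : ℝ) (v : M.Vector) (e : M.Tri × M.Tri) (x : Plane) :
    avgN (r • v) e x = r * avgN v e x := by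
  simp only [avgN, dotN_smul]; ring

theorem dvg_add (u v : M.Vector) (τ : M.Tri) (x : Plane) :
    dvg (u + v) τ x = dvg u τ x + dvg v τ x := by
  simp [dvg]; ring

theorem dvg_smul (r : ℝ) (v : M.Vector) (τ : M.Tri) (x : Plane) :
    dvg (r • v) τ x = r * dvg v τ x := by
  simp [dvg]; ring

theorem continuous_jump (p : M.Scalar) (e : M.Tri × M.Tri) : Continuous (jump p e) := by
  unfold jump; fun_prop

theorem continuous_avg (p : M.Scalar) (e : M.Tri × M.Tri) : Continuous (avg p e) := by
  unfold avg; fun_prop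

theorem continuous_jumpN (v : M.Vector) (e : M.Tri × M.Tri) : Continuous (jumpN v e) :=
  (continuous_dotN v _ _).sub (continuous_dotN v _ _)

theorem continuous_avgN (v : M.Vector) (e : M.Tri × M.Tri) : Continuous (avgN v e) :=
  ((continuous_dotN v _ _).add (continuous_dotN v _ _)).div_const 2

theorem isLinOn_bStarForm_left (S : Submodule ℝ M.Scalar) (v : M.Vector) :
    IsLinOn S fun q => bStarForm q v := by
  unfold bStarForm
  refine (((IsLinOn.sum fun e _ => ?_).fun_sub (IsLinOn.sum fun τ _ => ?_)).fun_add
    (IsLinOn.sum fun e _ => ?_)).fun_add (IsLinOn.sum fun e _ => ?_)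
  · refine IsLinOn.edgeIntegral (fun q _ => Continuous.edgeIntegrable
      ((continuous_ev _).mul (continuous_jumpN v e)) _ _) (fun p q x => ?_) fun r p x => ?_
    · simp; ring
    · simp; ring
  · refine IsLinOn.integral (fun q _ => integrableOn_triangle
      ((continuous_ev _).mul (continuous_dvg v τ)) _) (fun p _ q _ => ?_) fun r p _ => ?_
    · exact Filter.Eventually.of_forall fun x => by simp; ring
    · exact Filter.Eventually.of_forall fun x => by simp; ring
  · refine IsLinOn.edgeIntegral (fun q _ => Continuous.edgeIntegrable
      ((continuous_jump q e).mul (continuous_avgN v e)) _ _) (fun p q x => ?_) fun r p x => ?_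
    · rw [jump_add]; ring
    · rw [jump_smul]; ring
  · refine IsLinOn.edgeIntegral (fun q _ => Continuous.edgeIntegrable
      ((continuous_avg q e).mul (continuous_jumpN v e)) _ _) (fun p q x => ?_) fun r p x => ?_
    · rw [avg_add]; ring
    · rw [avg_smul]; ring

theorem isLinOn_bStarForm_right (S : Submodule ℝ M.Vector) (q : M.Scalar) :
    IsLinOn S fun v => bStarForm q v := by
  unfold bStarForm
  refine (((IsLinOn.sum fun e _ => ?_).fun_sub (IsLinOn.sum fun τ _ => ?_)).fun_add
    (IsLinOn.sum fun e _ => ?_)).fun_add (IsLinOn.sum fun e _ => ?_)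
  · refine IsLinOn.edgeIntegral (fun v _ => Continuous.edgeIntegrable
      ((continuous_ev _).mul (continuous_jumpN v e)) _ _) (fun p q x => ?_) fun r p x => ?_
    · rw [jumpN_add]; ring
    · rw [jumpN_smul]; ring
  · refine IsLinOn.integral (fun v _ => integrableOn_triangle
      ((continuous_ev _).mul (continuous_dvg v τ)) _) (fun p _ q _ => ?_) fun r p _ => ?_
    · exact Filter.Eventually.of_forall fun x => by rw [dvg_add]; ring
    · exact Filter.Eventually.of_forall fun x => by rw [dvg_smul]; ring
  · refine IsLinOn.edgeIntegral (fun v _ => Continuous.edgeIntegrable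
      ((continuous_jump q e).mul (continuous_avgN v e)) _ _) (fun p q x => ?_) fun r p x => ?_
    · rw [avgN_add]; ring
    · rw [avgN_smul]; ring
  · refine IsLinOn.edgeIntegral (fun v _ => Continuous.edgeIntegrable
      ((continuous_avg q e).mul (continuous_jumpN v e)) _ _) (fun p q x => ?_) fun r p x => ?_
    · rw [jumpN_add]; ring
    · rw [jumpN_smul]; ring

theorem isLinOn_mass (hM : M.IsStar) (c : Coefficients G) (S : Submodule ℝ M.Vector)
    (v : M.Vector) : IsLinOn S fun u => mass c u v := by
  refine IsLinOn.sum fun τ _ => ⟨fun u _ w _ => ?_, fun r u _ => ?_⟩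
  · rw [vec_add]
    exact massT_add_left hM c τ (continuous_vec u τ) (continuous_vec w τ) (continuous_vec v τ)
  · rw [vec_smul]
    exact massT_smul_left c τ r _ _

theorem mass_comm (hM : M.IsStar) (c : Coefficients G) (u v : M.Vector) :
    mass c u v = mass c v u := Finset.sum_congr rfl fun τ _ => massT_comm hM c τ _ _

/-- The form `∑ ⟨η⁻¹ [p], [q]⟩`. -/
def jumpForm (c : Coefficients G) (p q : M.Scalar) : ℝ :=
  ∑ e ∈ M.fractureEdges, M.outerIntegral e.1 fun x => 1 / c.η x * jump p e x * jump q e x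

theorem jumpForm_comm (c : Coefficients G) (p q : M.Scalar) : jumpForm c p q = jumpForm c q p :=
  Finset.sum_congr rfl fun e _ => edgeIntegral_congr fun x _ => by ring

theorem isLinOn_jumpForm (c : Coefficients G) (S : Submodule ℝ M.Scalar) (q : M.Scalar) :
    IsLinOn S fun p => jumpForm c p q := by
  refine IsLinOn.sum fun e he => IsLinOn.edgeIntegral (fun p _ => ?_) (fun p p' x => ?_)
    fun r p x => ?_
  · refine EdgeIntegrable.congr (c.isWeight_η.inv.edgeIntegrable (va_ne_vb e.1)
      (mem_fractureEdges.1 he).2.1 ((continuous_jump p e).mul (continuous_jump q e))) ?_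
    intro x _
    simp only [one_div, Pi.mul_apply]; ring
  · rw [jump_add]; ring
  · rw [jump_smul]; ring

/-- The form `∑ ⟨α⁻¹ ({p} - pΓ), {q} - qΓ⟩`. -/
def exchangeForm (c : Coefficients G) (p q : M.Scalar × (Plane → ℝ)) : ℝ :=
  ∑ e ∈ M.fractureEdges, M.outerIntegral e.1 fun x =>
    1 / c.α x * (avg p.1 e x - p.2 x) * (avg q.1 e x - q.2 x)

theorem exchangeForm_comm (c : Coefficients G) (p q : M.Scalar × (Plane → ℝ)) :
    exchangeForm c p q = exchangeForm c q p :=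
  Finset.sum_congr rfl fun e _ => edgeIntegral_congr fun x _ => by ring

theorem edgeIntegrable_exchange (c : Coefficients G) {k : ℕ} (p q : M.Scalar) {pΓ qΓ : Plane → ℝ}
    (hp : pΓ ∈ M.Wh k) (hq : qΓ ∈ M.Wh k) {e : M.Tri × M.Tri} (he : e ∈ M.fractureEdges) :
    EdgeIntegrable (M.va e.1) (M.vb e.1) fun x =>
      1 / c.α x * (avg p e x - pΓ x) * (avg q e x - qΓ x) := by
  obtain ⟨P, -, hP⟩ := hp.2.2 e he
  obtain ⟨Q, -, hQ⟩ := hq.2.2 e he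
  -- On an edge the functions of `W_h` agree with polynomials, which supply the continuity that a
  -- bounded weight needs.
  refine EdgeIntegrable.congr (c.isWeight_α.inv.edgeIntegrable (va_ne_vb e.1)
    (mem_fractureEdges.1 he).2.1 (((continuous_avg p e).sub (continuous_ev P)).mul
      ((continuous_avg q e).sub (continuous_ev Q)))) ?_
  intro x hx
  simp only [one_div, Pi.mul_apply, Pi.sub_apply]
  rw [hP x hx, hQ x hx]; ring

theorem isLinOn_exchangeForm (c : Coefficients G) (k : ℕ) (S : Submodule ℝ M.Scalar)
    {q : M.Scalar × (Plane → ℝ)} (hq : q.2 ∈ M.Wh k) :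
    IsLinOn (S.prod (M.WhSub k)) fun p => exchangeForm c p q := by
  refine IsLinOn.sum fun e he => IsLinOn.edgeIntegral (fun p hp => ?_) (fun p p' x => ?_)
    fun r p x => ?_
  · exact edgeIntegrable_exchange c p.1 q.1 hp.2 hq he
  · rw [Prod.fst_add, Prod.snd_add, avg_add, Pi.add_apply]; ring
  · rw [Prod.smul_fst, Prod.smul_snd, avg_smul, Pi.smul_apply, smul_eq_mul]; ring

/-- The form `⟨K_Γ ∇ₜ pΓ, ∇ₜ qΓ⟩`. -/
def diffusionForm (c : Coefficients G) (p q : Plane → ℝ) : ℝ :=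
  G.F.integral fun s => c.KΓ (G.F.γ s) * G.F.tgrad p s * G.F.tgrad q s

theorem diffusionForm_comm (c : Coefficients G) (p q : Plane → ℝ) :
    diffusionForm c p q = diffusionForm c q p := by
  unfold diffusionForm
  congr 1; ext s; ring

theorem isLinOn_diffusionForm (c : Coefficients G) (k : ℕ) {q : Plane → ℝ} (hq : q ∈ M.Wh k) :
    IsLinOn (M.WhSub k) fun p => diffusionForm c p q := by
  simp only [diffusionForm, Fracture.integral_eq]
  refine IsLinOn.integral (fun p hp => ?_) (fun p hp p' hp' => ?_) fun r p hp => ?_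
  · have := c.isWeight_KΓ.integrable_mul
      ((Fracture.memLp_tgrad hp.2.1).integrable_mul (Fracture.memLp_tgrad hq.2.1))
    refine this.congr (Filter.Eventually.of_forall fun s => ?_)
    simp only [Pi.mul_apply]; ring
  · filter_upwards [Fracture.tgrad_add hp.2.1 hp'.2.1] with s hs
    rw [hs]; ring
  · exact Filter.Eventually.of_forall fun s => by rw [Fracture.tgrad_smul]; ring

/-- The discrete space `V_h × S_h × W_h`. -/
def space (M : Mesh G) (k : ℕ) : Submodule ℝ (M.Vector × M.Scalar × (Plane → ℝ)) :=
  (M.VhSub k).prod ((M.ShSub k).prod (M.WhSub k))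

/-- The bilinear form of the coupled discrete problem. -/
def form (c : Coefficients G) (w w' : M.Vector × M.Scalar × (Plane → ℝ)) : ℝ :=
  mass c w.1 w'.1 + bStarForm w.2.1 w'.1 - bStarForm w'.2.1 w.1 + exchangeForm c w.2 w'.2 +
    jumpForm c w.2.1 w'.2.1 + diffusionForm c w.2.2 w'.2.2

theorem isLinOn_form_left (hM : M.IsStar) (c : Coefficients G) {k : ℕ}
    {w' : M.Vector × M.Scalar × (Plane → ℝ)} (hw' : w' ∈ M.space k) :
    IsLinOn (M.space k) fun w => form c w w' := by
  have t1 := isLinOn_mass hM c (M.VhSub k) w'.1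
  have t2 := isLinOn_bStarForm_left (M.ShSub k) w'.1
  have t3 := isLinOn_bStarForm_right (M.VhSub k) w'.2.1
  have t4 := isLinOn_exchangeForm c k (M.ShSub k) hw'.2.2
  have t5 := isLinOn_jumpForm c (M.ShSub k) w'.2.1
  have t6 := isLinOn_diffusionForm c k hw'.2.2
  refine ⟨fun x hx y hy => ?_, fun r x hx => ?_⟩
  · simp only [form, Prod.fst_add, Prod.snd_add]
    linear_combination t1.add _ hx.1 _ hy.1 + t2.add _ hx.2.1 _ hy.2.1 - t3.add _ hx.1 _ hy.1 +
      t4.add _ hx.2 _ hy.2 + t5.add _ hx.2.1 _ hy.2.1 + t6.add _ hx.2.2 _ hy.2.2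
  · simp only [form, Prod.smul_fst, Prod.smul_snd]
    linear_combination t1.smul r _ hx.1 + t2.smul r _ hx.2.1 - t3.smul r _ hx.1 +
      t4.smul r _ hx.2 + t5.smul r _ hx.2.1 + t6.smul r _ hx.2.2

theorem isLinOn_form_right (hM : M.IsStar) (c : Coefficients G) {k : ℕ}
    {w : M.Vector × M.Scalar × (Plane → ℝ)} (hw : w ∈ M.space k) :
    IsLinOn (M.space k) (form c w) := by
  have t1 := isLinOn_mass hM c (M.VhSub k) w.1
  have t2 := isLinOn_bStarForm_right (M.VhSub k) w.2.1
  have t3 := isLinOn_bStarForm_left (M.ShSub k) w.1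
  have t4 := isLinOn_exchangeForm c k (M.ShSub k) hw.2.2
  have t5 := isLinOn_jumpForm c (M.ShSub k) w.2.1
  have t6 := isLinOn_diffusionForm c k hw.2.2
  have e : form c w = fun w' => mass c w'.1 w.1 + bStarForm w.2.1 w'.1 - bStarForm w'.2.1 w.1 +
      exchangeForm c w'.2 w.2 + jumpForm c w'.2.1 w.2.1 + diffusionForm c w'.2.2 w.2.2 := by
    ext w'
    rw [form, mass_comm hM, exchangeForm_comm, jumpForm_comm, diffusionForm_comm]
  rw [e]
  refine ⟨fun x hx y hy => ?_, fun r x hx => ?_⟩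
  · simp only [Prod.fst_add, Prod.snd_add]
    linear_combination t1.add _ hx.1 _ hy.1 + t2.add _ hx.1 _ hy.1 - t3.add _ hx.2.1 _ hy.2.1 +
      t4.add _ hx.2 _ hy.2 + t5.add _ hx.2.1 _ hy.2.1 + t6.add _ hx.2.2 _ hy.2.2
  · simp only [Prod.smul_fst, Prod.smul_snd]
    linear_combination t1.smul r _ hx.1 + t2.smul r _ hx.1 - t3.smul r _ hx.2.1 +
      t4.smul r _ hx.2 + t5.smul r _ hx.2.1 + t6.smul r _ hx.2.2

theorem finite_space (hM : M.IsStar) (k : ℕ) : Module.Finite ℝ (M.space k) := by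
  have := finite_WhSub hM k
  exact Module.Finite.of_surjective
    ({ toFun := fun w => ⟨(w.1, w.2.1, w.2.2), ⟨w.1.2, w.2.1.2, w.2.2.2⟩⟩
       map_add' := fun _ _ => rfl
       map_smul' := fun _ _ => rfl } :
      (M.VhSub k × M.ShSub k × M.WhSub k) →ₗ[ℝ] M.space k)
    fun w => ⟨(⟨w.1.1, w.2.1⟩, ⟨w.1.2.1, w.2.2.1⟩, ⟨w.1.2.2, w.2.2.2⟩), rfl⟩

/-- The right-hand side of the coupled discrete problem. -/
def load (c : Coefficients G) (f fΓ : Plane → ℝ) (q : M.Scalar × (Plane → ℝ)) : ℝ :=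
  (∑ τ, M.triIntegral τ fun x => f x * ev (q.1 τ) x) +
    G.F.integral fun s => c.ℓ (G.F.γ s) * fΓ (G.F.γ s) * q.2 (G.F.γ s)

theorem memLp_ev (P : MvPolynomial (Fin 2) ℝ) (τ : M.Tri) :
    MemLp (ev P) 2 (volume.restrict (M.triangle τ)) :=
  (memLp_two_iff_integrable_sq (continuous_ev P).aestronglyMeasurable).2
    (integrableOn_triangle ((continuous_ev P).pow 2) τ)

theorem memLp_source (c : Coefficients G) {fΓ : Plane → ℝ}
    (hfΓ : MemLp (fun s => fΓ (G.F.γ s)) 2 G.F.paramMeasure) :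
    MemLp (fun s => c.ℓ (G.F.γ s) * fΓ (G.F.γ s)) 2 G.F.paramMeasure := by
  obtain ⟨c₁, c₂, h1, h2, hb⟩ := c.isWeight_ℓ.pos_bounds
  refine MemLp.of_le_mul hfΓ (c := c₂)
    (c.isWeight_ℓ.meas.aestronglyMeasurable.mul hfΓ.aestronglyMeasurable) ?_
  filter_upwards [hb] with s hs
  rw [norm_mul, Real.norm_eq_abs, abs_of_pos (h1.trans_le hs.1)]
  exact mul_le_mul_of_nonneg_right hs.2 (norm_nonneg _)

theorem isLinOn_load (hM : M.IsStar) (c : Coefficients G) (k : ℕ) {f fΓ : Plane → ℝ}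
    (hf : MemLp f 2 (volume.restrict G.bulk))
    (hfΓ : MemLp (fun s => fΓ (G.F.γ s)) 2 G.F.paramMeasure) :
    IsLinOn ((M.ShSub k).prod (M.WhSub k)) (load c f fΓ) := by
  refine IsLinOn.fun_add (IsLinOn.sum fun τ _ => ?_) ?_
  · refine IsLinOn.integral (fun q _ => ?_) (fun p _ q _ => ?_) fun r q _ => ?_
    · exact (hf.mono_measure (restrict_triangle_le hM τ)).integrable_mul (memLp_ev (q.1 τ) τ)
    · exact Filter.Eventually.of_forall fun x => by simp; ring
    · exact Filter.Eventually.of_forall fun x => by simp; ring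
  · simp only [Fracture.integral_eq]
    refine IsLinOn.integral (fun q hq => ?_) (fun p _ q _ => ?_) fun r q _ => ?_
    · exact (memLp_source c hfΓ).integrable_mul (Fracture.memLp_trace hq.2.2.1)
    · exact Filter.Eventually.of_forall fun x => by simp; ring
    · exact Filter.Eventually.of_forall fun x => by simp; ring

end Mesh

theorem IsLinOn.map_zero {X : Type*} [AddCommGroup X] [Module ℝ X] {S : Submodule ℝ X}
    {f : X → ℝ} (hf : IsLinOn S f) : f 0 = 0 := by
  have := hf.smul 0 0 S.zero_mem
  rwa [smul_zero, zero_mul] at this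

theorem Fracture.IsWeight.exists_integral_le {F : Fracture} {w : Plane → ℝ} (hw : F.IsWeight w) :
    ∃ c : ℝ, 0 < c ∧ ∀ {f : ℝ → ℝ}, Integrable f F.paramMeasure → (∀ s, 0 ≤ f s) →
      c * F.integral f ≤ F.integral fun s => w (F.γ s) * f s := by
  obtain ⟨c₁, c₂, h1, h2, hb⟩ := hw.pos_bounds
  refine ⟨c₁, h1, fun {f} hf hf0 => ?_⟩
  rw [integral_eq, integral_eq, ← integral_const_mul]
  apply integral_mono_ae (hf.const_mul _) (hw.integrable_mul hf)
  filter_upwards [hb] with s hs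
  exact mul_le_mul_of_nonneg_right hs.1 (hf0 s)

namespace Mesh

variable {G : Geometry} {M : Mesh G}

section Forms

variable {c : Coefficients G} {k : ℕ} {f fΓ : Plane → ℝ}

theorem exchangeForm_fst (p : M.Scalar × (Plane → ℝ)) (q : M.Scalar) :
    exchangeForm c p (q, 0) = ∑ e ∈ M.fractureEdges, M.outerIntegral e.1 fun x =>
      1 / c.α x * (avg p.1 e x - p.2 x) * avg q e x := by
  simp [exchangeForm]

theorem exchangeForm_snd (p : M.Scalar × (Plane → ℝ)) (q : Plane → ℝ) :
    exchangeForm c p (0, q) = -∑ e ∈ M.fractureEdges, M.outerIntegral e.1 fun x =>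
      1 / c.α x * (avg p.1 e x - p.2 x) * q x := by
  rw [exchangeForm, ← Finset.sum_neg_distrib]
  refine Finset.sum_congr rfl fun e _ => ?_
  rw [outerIntegral, outerIntegral, ← edgeIntegral_neg]
  exact edgeIntegral_congr fun x _ => by simp [avg]

theorem exchangeForm_split {p : M.Scalar × (Plane → ℝ)} (hp : p.2 ∈ M.Wh k) {q : M.Scalar}
    {qΓ : Plane → ℝ} (hq : qΓ ∈ M.Wh k) :
    exchangeForm c p (q, qΓ) = exchangeForm c p (q, 0) + exchangeForm c p (0, qΓ) := by
  rw [exchangeForm_comm c p, exchangeForm_comm c p, exchangeForm_comm c p]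
  have := (isLinOn_exchangeForm c k (⊤ : Submodule ℝ M.Scalar) hp).add (q, 0)
    ⟨trivial, (M.WhSub k).zero_mem⟩ (0, qΓ) ⟨trivial, hq⟩
  rwa [Prod.mk_add_mk, add_zero, zero_add] at this

/-- The system is recovered by testing with one nonzero component at a time; the sign of the
fracture equation is built into `exchangeForm` through `{q} - qΓ`, and adjointness exchanges `bForm`
and `bStarForm`. -/
theorem isSolution_iff (hM : M.IsStar) {w : M.Vector × M.Scalar × (Plane → ℝ)} :
    IsSolution M c k f fΓ w.1 w.2.1 w.2.2 ↔
      w ∈ M.space k ∧ ∀ w' ∈ M.space k, form c w w' = load c f fΓ w'.2 := by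
  constructor
  · intro h
    refine ⟨⟨h.u_mem, h.p_mem, h.pΓ_mem⟩, fun w' hw' => ?_⟩
    have h1 := h.darcy _ hw'.1
    have h2 := h.conservation _ hw'.2.1
    have h3 := h.fracture _ hw'.2.2
    rw [bForm_eq_bStarForm hM h.u_mem hw'.2.1] at h2
    have e := exchangeForm_split (c := c) (p := w.2) h.pΓ_mem (q := w'.2.1) hw'.2.2
    rw [exchangeForm_fst, exchangeForm_snd] at e
    rw [form, load, jumpForm, diffusionForm]
    rw [show w'.2 = (w'.2.1, w'.2.2) from rfl, e]
    linarith
  · rintro ⟨hw, h⟩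
    have z1 : mass c w.1 (0 : M.Vector) = 0 := by
      rw [mass_comm hM]; exact (isLinOn_mass hM c ⊤ w.1).map_zero
    have z2 : bStarForm w.2.1 (0 : M.Vector) = 0 := (isLinOn_bStarForm_right ⊤ w.2.1).map_zero
    have z3 : bStarForm (0 : M.Scalar) w.1 = 0 := (isLinOn_bStarForm_left ⊤ w.1).map_zero
    have z4 : jumpForm c w.2.1 (0 : M.Scalar) = 0 := by
      rw [jumpForm_comm]; exact (isLinOn_jumpForm c ⊤ w.2.1).map_zero
    have z5 : diffusionForm c w.2.2 (0 : Plane → ℝ) = 0 := by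
      rw [diffusionForm_comm]; exact (isLinOn_diffusionForm c k hw.2.2).map_zero
    have z6 : exchangeForm c w.2 (0 : M.Scalar × (Plane → ℝ)) = 0 := by
      rw [exchangeForm_comm]
      exact (isLinOn_exchangeForm c k (⊤ : Submodule ℝ M.Scalar) hw.2.2).map_zero
    refine ⟨hw.1, hw.2.1, hw.2.2, fun v hv => ?_, fun q hq => ?_, fun qΓ hqΓ => ?_⟩
    · have := h (v, 0) ⟨hv, Submodule.zero_mem _⟩
      rw [form] at this
      simp only [Prod.fst_zero, Prod.snd_zero, z3, z4, z5, z6] at this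
      rw [sub_zero, add_zero, add_zero, add_zero] at this
      rw [this]
      simp [load, triIntegral, Fracture.integral]
    · have := h (0, q, 0) ⟨Submodule.zero_mem _, hq, Submodule.zero_mem _⟩
      rw [form] at this
      simp only [z1, z2, z5, load] at this
      rw [exchangeForm_fst, jumpForm] at this
      rw [bForm_eq_bStarForm hM hw.1 hq]
      simp only [Pi.zero_apply, mul_zero, Fracture.integral, intervalIntegral.integral_zero] at this
      linarith
    · have := h (0, 0, qΓ) ⟨Submodule.zero_mem _, Submodule.zero_mem _, hqΓ⟩
      rw [form] at this
      simp only [z1, z2, z3, z4, load] at this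
      rw [exchangeForm_snd, diffusionForm] at this
      simp only [Pi.zero_apply, ev_zero, mul_zero, triIntegral, integral_zero,
        Finset.sum_const_zero] at this
      linarith

theorem mass_nonneg (hM : M.IsStar) (u : M.Vector) : 0 ≤ mass c u u :=
  Finset.sum_nonneg fun τ _ => massT_nonneg hM c τ _

theorem jumpForm_self (p : M.Scalar) : jumpForm c p p =
    ∑ e ∈ M.fractureEdges, M.outerIntegral e.1 fun x => (c.η x)⁻¹ * jump p e x ^ 2 :=
  Finset.sum_congr rfl fun e _ => edgeIntegral_congr fun x _ => by rw [one_div]; ring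

theorem exchangeForm_self (p : M.Scalar × (Plane → ℝ)) : exchangeForm c p p =
    ∑ e ∈ M.fractureEdges, M.outerIntegral e.1 fun x =>
      (c.α x)⁻¹ * (avg p.1 e x - p.2 x) ^ 2 :=
  Finset.sum_congr rfl fun e _ => edgeIntegral_congr fun x _ => by rw [one_div]; ring

theorem diffusionForm_self (p : Plane → ℝ) : diffusionForm c p p =
    G.F.integral fun s => c.KΓ (G.F.γ s) * G.F.tgrad p s ^ 2 := by
  rw [diffusionForm]; congr 1; ext s; ring

theorem jumpForm_nonneg (p : M.Scalar) : 0 ≤ jumpForm c p p := by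
  rw [jumpForm_self]
  exact Finset.sum_nonneg fun e he => c.isWeight_η.inv.edgeIntegral_nonneg (va_ne_vb e.1)
    (mem_fractureEdges.1 he).2.1 fun x => sq_nonneg _

theorem exchangeForm_nonneg (p : M.Scalar × (Plane → ℝ)) : 0 ≤ exchangeForm c p p := by
  rw [exchangeForm_self]
  exact Finset.sum_nonneg fun e he => c.isWeight_α.inv.edgeIntegral_nonneg (va_ne_vb e.1)
    (mem_fractureEdges.1 he).2.1 fun x => sq_nonneg _

theorem diffusionForm_nonneg (p : Plane → ℝ) : 0 ≤ diffusionForm c p p := by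
  obtain ⟨c₁, c₂, h1, h2, hb⟩ := c.isWeight_KΓ.pos_bounds
  rw [diffusionForm_self, Fracture.integral_eq]
  apply integral_nonneg_of_ae
  filter_upwards [hb] with s hs
  exact mul_nonneg (h1.le.trans hs.1) (sq_nonneg _)

/-- The two coupling terms are antisymmetric, so the diagonal is a sum of nonnegative terms. -/
theorem form_self (w : M.Vector × M.Scalar × (Plane → ℝ)) : form c w w =
    mass c w.1 w.1 + exchangeForm c w.2 w.2 + jumpForm c w.2.1 w.2.1 +
      diffusionForm c w.2.2 w.2.2 := by
  rw [form]; ring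

theorem energy_eq (w : M.Vector × M.Scalar × (Plane → ℝ)) : energy c w.1 w.2.1 w.2.2 =
    form c w w + ∑ τ, M.triIntegral τ fun x => ev (w.2.1 τ) x ^ 2 := by
  rw [form_self, energy, jumpForm_self, exchangeForm_self, diffusionForm_self]; ring

end Forms

/-! ### Control of the pressures by the diagonal of the form. -/

theorem exists_fracture_bound (c : Coefficients G) : ∃ C : ℝ, 0 < C ∧ ∀ (M : Mesh G) (k : ℕ),
    ∀ p ∈ M.Wh k, ∀ x ∈ G.F.carrier, p x ^ 2 ≤ C * diffusionForm c p p := by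
  obtain ⟨d, hd, h⟩ := c.isWeight_KΓ.exists_integral_le
  have hL := G.F.len_pos
  refine ⟨G.F.len * d⁻¹, by positivity, fun M k p hp x hx => ?_⟩
  have h1 := Fracture.sq_le_integral_tgrad hp.2.1 hx
  have h2 := h (Fracture.memLp_tgrad hp.2.1).integrable_sq fun s => sq_nonneg _
  rw [← diffusionForm_self] at h2
  refine h1.trans ?_
  rw [mul_assoc]
  apply mul_le_mul_of_nonneg_left _ hL.le
  rwa [le_inv_mul_iff₀ hd]

theorem exists_jump_bound (c : Coefficients G) : ∃ C : ℝ, 0 < C ∧ ∀ (M : Mesh G) (p : M.Scalar),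
    (∑ e ∈ M.fractureEdges, M.outerIntegral e.1 fun x => jump p e x ^ 2) ≤
      C * jumpForm c p p := by
  obtain ⟨d, hd, h⟩ := c.isWeight_η.inv.exists_edgeIntegral_le
  refine ⟨d⁻¹, by positivity, fun M p => ?_⟩
  rw [jumpForm_self, Finset.mul_sum]
  refine Finset.sum_le_sum fun e he => ?_
  rw [le_inv_mul_iff₀ hd]
  exact h (va_ne_vb e.1) (mem_fractureEdges.1 he).2.1 ((continuous_jump p e).pow 2)
    fun x => sq_nonneg _

/-- From `{p}² ≤ 2 ({p} - pΓ)² + 2 pΓ²`: the first part is the exchange term, and the second is a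
uniform bound times the total length of the fracture edges. -/
theorem exists_avg_bound (c : Coefficients G) : ∃ C : ℝ, 0 < C ∧ ∀ (M : Mesh G) (k : ℕ)
    (p : M.Scalar × (Plane → ℝ)), p.2 ∈ M.Wh k →
      (∑ e ∈ M.fractureEdges, M.outerIntegral e.1 fun x => avg p.1 e x ^ 2) ≤
        C * (exchangeForm c p p + diffusionForm c p.2 p.2) := by
  obtain ⟨d, hd, h⟩ := c.isWeight_α.inv.exists_edgeIntegral_le
  obtain ⟨D, hD, hΓ⟩ := exists_fracture_bound c
  have hL := G.F.len_pos
  refine ⟨2 * d⁻¹ + 2 * D * G.F.len, by positivity, fun M k p hp => ?_⟩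
  set T := diffusionForm c p.2 p.2 with hT
  have hT0 : 0 ≤ T := diffusionForm_nonneg _
  have hE0 : 0 ≤ exchangeForm c p p := exchangeForm_nonneg _
  have h1 : ∀ e ∈ M.fractureEdges, (M.outerIntegral e.1 fun x => avg p.1 e x ^ 2) ≤
      2 * d⁻¹ * (M.outerIntegral e.1 fun x => (c.α x)⁻¹ * (avg p.1 e x - p.2 x) ^ 2) +
        dist (M.va e.1) (M.vb e.1) * (2 * D * T) := by
    intro e he
    obtain ⟨P, -, hP⟩ := hp.2.2 e he
    have hF := (mem_fractureEdges.1 he).2.1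
    have c1 : Continuous fun x => (avg p.1 e x - ev P x) ^ 2 :=
      ((continuous_avg p.1 e).sub (continuous_ev P)).pow 2
    have e1 : (M.outerIntegral e.1 fun x => (c.α x)⁻¹ * (avg p.1 e x - p.2 x) ^ 2) =
        M.outerIntegral e.1 fun x => (c.α x)⁻¹ * (avg p.1 e x - ev P x) ^ 2 :=
      edgeIntegral_congr fun x hx => by rw [hP x hx]
    have e2 : dist (M.va e.1) (M.vb e.1) * (2 * D * T) =
        M.outerIntegral e.1 fun _ => 2 * D * T := by
      rw [outerIntegral, edgeIntegral]; simp
    have h2 := h (va_ne_vb e.1) hF c1 fun x => sq_nonneg _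
    rw [← le_inv_mul_iff₀ hd] at h2
    rw [e1, e2]
    have i1 : EdgeIntegrable (M.va e.1) (M.vb e.1) fun x => 2 * (avg p.1 e x - ev P x) ^ 2 :=
      Continuous.edgeIntegrable (continuous_const.mul c1) _ _
    have i2 : EdgeIntegrable (M.va e.1) (M.vb e.1) fun _ => 2 * D * T :=
      Continuous.edgeIntegrable continuous_const _ _
    have h3 : (M.outerIntegral e.1 fun x => avg p.1 e x ^ 2) ≤
        2 * (M.outerIntegral e.1 fun x => (avg p.1 e x - ev P x) ^ 2) +
          M.outerIntegral e.1 fun _ => 2 * D * T := by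
      rw [outerIntegral, outerIntegral, ← edgeIntegral_const_mul, outerIntegral,
        ← edgeIntegral_add i1 i2]
      apply edgeIntegral_mono (Continuous.edgeIntegrable ((continuous_avg p.1 e).pow 2) _ _)
        (i1.add i2)
      intro x hx
      have := hΓ M k p.2 hp x (hF hx)
      rw [hP x hx, ← hT] at this
      change avg p.1 e x ^ 2 ≤ 2 * (avg p.1 e x - ev P x) ^ 2 + 2 * D * T
      nlinarith [sq_nonneg (avg p.1 e x - 2 * ev P x)]
    refine h3.trans (add_le_add ?_ le_rfl)
    rw [mul_assoc]
    exact mul_le_mul_of_nonneg_left h2 (by norm_num)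
  refine (Finset.sum_le_sum h1).trans ?_
  rw [Finset.sum_add_distrib, ← Finset.mul_sum, ← Finset.sum_mul, ← exchangeForm_self]
  have h4 := mul_le_mul_of_nonneg_right (sum_length_fractureEdges_le (M := M))
    (by positivity : 0 ≤ 2 * D * T)
  have h5 : 0 ≤ 2 * D * G.F.len * exchangeForm c p p := by positivity
  have h6 : 0 ≤ 2 * d⁻¹ * T := by positivity
  nlinarith

/-- Control of the pressures by the energy of the discrete problem. -/
theorem exists_pressure_bound (c : Coefficients G) (k : ℕ) {ρ : ℝ} (hρ : 0 < ρ) :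
    ∃ C : ℝ, 0 < C ∧ ∀ M : Mesh G, M.AssumptionA ρ → ∀ w ∈ M.space k,
      (∀ v ∈ M.Vh k, mass c w.1 v + bStarForm w.2.1 v = 0) →
      (∑ τ, M.triIntegral τ fun x => ev (w.2.1 τ) x ^ 2) ≤ C * form c w w ∧
      ∀ x ∈ G.F.carrier, w.2.2 x ^ 2 ≤ C * form c w w := by
  obtain ⟨C₁, h₁, H₁⟩ := exists_poincare c k hρ
  obtain ⟨C₂, h₂, H₂⟩ := exists_jump_bound c
  obtain ⟨C₃, h₃, H₃⟩ := exists_avg_bound c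
  obtain ⟨C₄, h₄, H₄⟩ := exists_fracture_bound c
  -- The first summand collects the three terms of the Poincaré inequality, the second is the
  -- pointwise fracture bound.
  refine ⟨C₁ * (1 + C₂ + C₃) + C₄, by positivity, fun M hA w hw hd => ?_⟩
  have hM := hA.isStar hρ
  have a1 := H₁ M hA w.1 w.2.1 hw.2.1 hd
  have a2 := H₂ M w.2.1
  have a3 := H₃ M k w.2 hw.2.2
  have n1 : 0 ≤ mass c w.1 w.1 := mass_nonneg hM _
  have n2 : 0 ≤ jumpForm c w.2.1 w.2.1 := jumpForm_nonneg _
  have n3 : 0 ≤ exchangeForm c w.2 w.2 := exchangeForm_nonneg _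
  have n4 : 0 ≤ diffusionForm c w.2.2 w.2.2 := diffusionForm_nonneg _
  have e := form_self (c := c) w
  have f1 : mass c w.1 w.1 ≤ form c w w := by linarith
  have f2 : jumpForm c w.2.1 w.2.1 ≤ form c w w := by linarith
  have f3 : exchangeForm c w.2 w.2 + diffusionForm c w.2.2 w.2.2 ≤ form c w w := by linarith
  have f4 : diffusionForm c w.2.2 w.2.2 ≤ form c w w := by linarith
  have f0 : 0 ≤ form c w w := n1.trans f1
  constructor
  · refine a1.trans ?_
    calc _ ≤ C₁ * (form c w w + C₂ * form c w w + C₃ * form c w w) := by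
          apply mul_le_mul_of_nonneg_left _ h₁.le
          have b2 := mul_le_mul_of_nonneg_left f2 h₂.le
          have b3 := mul_le_mul_of_nonneg_left f3 h₃.le
          linarith
      _ = (C₁ * (1 + C₂ + C₃)) * form c w w := by ring
      _ ≤ _ := mul_le_mul_of_nonneg_right (by linarith) f0
  · intro x hx
    refine (H₄ M k _ hw.2.2 x hx).trans ?_
    refine (mul_le_mul_of_nonneg_left f4 h₄.le).trans ?_
    exact mul_le_mul_of_nonneg_right (by linarith [mul_pos h₁ (by positivity : 0 < 1 + C₂ + C₃)]) f0

theorem eq_zero_of_triIntegral_sq {P : MvPolynomial (Fin 2) ℝ} {τ : M.Tri}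
    (h : (M.triIntegral τ fun x => ev P x ^ 2) = 0) : P = 0 := by
  have hc := (continuous_ev P).pow 2
  have h0 : (fun x => ev P x ^ 2) =ᵐ[volume.restrict (M.triangle τ)] 0 := by
    rw [← setIntegral_eq_zero_iff_of_nonneg_ae
      (Filter.Eventually.of_forall fun x => sq_nonneg _) (integrableOn_triangle hc τ)]
    exact h
  apply eq_zero_of_ev_eq_zero isOpen_interior (interior_triangle_nonempty τ)
  refine Measure.eqOn_open_of_ae_eq (μ := volume) (g := fun _ => (0 : ℝ)) ?_ isOpen_interior
    (continuous_ev P).continuousOn continuousOn_const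
  apply ae_restrict_of_ae_restrict_of_subset interior_subset
  filter_upwards [h0] with x hx
  exact pow_eq_zero_iff (two_ne_zero) |>.1 hx

/-- Zero diagonal gives `u = 0` by positivity of `K⁻¹`; the pressures vanish through the pressure
bound, and off the fracture `pΓ` is zero by the convention in `Wh`. -/
theorem eq_zero_of_form_self {c : Coefficients G} {k : ℕ} {ρ : ℝ} (hρ : 0 < ρ)
    (hA : M.AssumptionA ρ) {w : M.Vector × M.Scalar × (Plane → ℝ)} (hw : w ∈ M.space k)
    (hd : ∀ v ∈ M.Vh k, mass c w.1 v + bStarForm w.2.1 v = 0) (h : form c w w = 0) : w = 0 := by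
  have hM := hA.isStar hρ
  obtain ⟨C, -, hC⟩ := exists_pressure_bound c k hρ
  obtain ⟨h1, h2⟩ := hC M hA w hw hd
  rw [h, mul_zero] at h1 h2
  have n1 : 0 ≤ mass c w.1 w.1 := mass_nonneg hM _
  have n2 : 0 ≤ jumpForm c w.2.1 w.2.1 := jumpForm_nonneg _
  have n3 : 0 ≤ exchangeForm c w.2 w.2 := exchangeForm_nonneg _
  have n4 : 0 ≤ diffusionForm c w.2.2 w.2.2 := diffusionForm_nonneg _
  rw [form_self] at h
  have hm : mass c w.1 w.1 = 0 := by linarith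
  refine Prod.ext ?_ (Prod.ext ?_ ?_)
  · ext1 τ
    apply eq_zero_of_massT_eq_zero hM c τ
    rw [mass_eq_sum] at hm
    exact (Finset.sum_eq_zero_iff_of_nonneg fun τ _ => massT_nonneg hM c τ _).1 hm τ
      (Finset.mem_univ _)
  · ext1 τ
    apply eq_zero_of_triIntegral_sq (τ := τ)
    have hnn : ∀ τ ∈ Finset.univ, 0 ≤ M.triIntegral τ fun x => ev (w.2.1 τ) x ^ 2 :=
      fun τ _ => integral_nonneg fun x => sq_nonneg _
    exact (Finset.sum_eq_zero_iff_of_nonneg hnn).1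
      (le_antisymm h1 (Finset.sum_nonneg hnn)) τ (Finset.mem_univ _)
  · ext x
    by_cases hx : x ∈ G.F.carrier
    · exact pow_eq_zero_iff (two_ne_zero) |>.1 (le_antisymm (h2 x hx) (sq_nonneg _))
    · exact hw.2.2.1 x hx

/-! ### Load estimate, stability and unique solvability. -/

theorem integral_mul_le {α : Type*} [MeasurableSpace α] {μ : Measure α} {f g : α → ℝ}
    (hf : MemLp f 2 μ) (hg : MemLp g 2 μ) {δ : ℝ} (hδ : 0 < δ) :
    ∫ x, f x * g x ∂μ ≤ δ⁻¹ * (∫ x, f x ^ 2 ∂μ) + δ / 4 * ∫ x, g x ^ 2 ∂μ := by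
  rw [← integral_const_mul, ← integral_const_mul, ← integral_add
    (hf.integrable_sq.const_mul _) (hg.integrable_sq.const_mul _)]
  apply integral_mono (hf.integrable_mul hg)
    ((hf.integrable_sq.const_mul _).add (hg.integrable_sq.const_mul _))
  intro x
  change f x * g x ≤ δ⁻¹ * f x ^ 2 + δ / 4 * g x ^ 2
  have h1 : 0 ≤ δ⁻¹ * (f x - δ / 2 * g x) ^ 2 := by positivity
  have h2 : δ⁻¹ * (f x - δ / 2 * g x) ^ 2 = δ⁻¹ * f x ^ 2 + δ / 4 * g x ^ 2 - f x * g x := by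
    field_simp; ring
  linarith

/-- The triangles are essentially disjoint and essentially contained in the bulk. -/
theorem sum_triIntegral_sq_le (hM : M.IsStar) {f : Plane → ℝ}
    (hf : MemLp f 2 (volume.restrict G.bulk)) :
    (∑ τ, M.triIntegral τ fun x => f x ^ 2) ≤ ∫ x in G.bulk, f x ^ 2 := by
  have hle : volume.restrict (⋃ τ, M.triangle τ) ≤ volume.restrict G.bulk := by
    apply Measure.restrict_mono_ae
    rw [ae_le_set, iUnion_sdiff]
    exact measure_iUnion_null fun τ => volume_triangle_diff_bulk hM τ
  have h := integral_iUnion_ae (μ := volume) (s := M.triangle) (f := fun x => f x ^ 2)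
    (fun τ => (measurableSet_triangle τ).nullMeasurableSet) aedisjoint_triangle
    (hf.integrable_sq.mono_measure hle)
  rw [tsum_fintype] at h
  simp only [triIntegral]
  rw [← h]
  exact integral_mono_measure hle (Filter.Eventually.of_forall fun x => sq_nonneg _)
    hf.integrable_sq

theorem load_le (hM : M.IsStar) (c : Coefficients G) {k : ℕ} {f fΓ : Plane → ℝ}
    (hf : MemLp f 2 (volume.restrict G.bulk))
    (hfΓ : MemLp (fun s => fΓ (G.F.γ s)) 2 G.F.paramMeasure) {q : M.Scalar × (Plane → ℝ)}
    (hq : q.2 ∈ M.Wh k) {δ : ℝ} (hδ : 0 < δ) :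
    load c f fΓ q ≤ δ⁻¹ * ((∫ x in G.bulk, f x ^ 2) +
        G.F.integral fun s => (c.ℓ (G.F.γ s) * fΓ (G.F.γ s)) ^ 2) +
      δ / 4 * ((∑ τ, M.triIntegral τ fun x => ev (q.1 τ) x ^ 2) +
        G.F.integral fun s => q.2 (G.F.γ s) ^ 2) := by
  have h1 : (∑ τ, M.triIntegral τ fun x => f x * ev (q.1 τ) x) ≤
      δ⁻¹ * (∑ τ, M.triIntegral τ fun x => f x ^ 2) +
        δ / 4 * ∑ τ, M.triIntegral τ fun x => ev (q.1 τ) x ^ 2 := by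
    rw [Finset.mul_sum, Finset.mul_sum, ← Finset.sum_add_distrib]
    exact Finset.sum_le_sum fun τ _ =>
      integral_mul_le (hf.mono_measure (restrict_triangle_le hM τ)) (memLp_ev (q.1 τ) τ) hδ
  have h2 := integral_mul_le (memLp_source c hfΓ) (Fracture.memLp_trace hq.2.1) hδ
  have h3 := mul_le_mul_of_nonneg_left (sum_triIntegral_sq_le hM hf) (inv_pos.2 hδ).le
  rw [load]
  simp only [Fracture.integral_eq]
  linarith

/-- The diagonal equals the load; Young's inequality splits the load into data and pressures, and
the pressures are absorbed by the pressure bound. -/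
theorem exists_stability (c : Coefficients G) (k : ℕ) {ρ : ℝ} (hρ : 0 < ρ) :
    ∃ C : ℝ, 0 < C ∧ ∀ M : Mesh G, M.AssumptionA ρ → ∀ f fΓ : Plane → ℝ,
      MemLp f 2 (volume.restrict G.bulk) → MemLp (fun s => fΓ (G.F.γ s)) 2 G.F.paramMeasure →
      ∀ w ∈ M.space k, (∀ v ∈ M.Vh k, mass c w.1 v + bStarForm w.2.1 v = 0) →
        form c w w = load c f fΓ w.2 → energy c w.1 w.2.1 w.2.2 ≤
          C * ((∫ x in G.bulk, f x ^ 2) +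
            G.F.integral fun s => (c.ℓ (G.F.γ s) * fΓ (G.F.γ s)) ^ 2) := by
  obtain ⟨C, hC, H⟩ := exists_pressure_bound c k hρ
  have hL := G.F.len_pos
  -- The squared norms of both pressures together are at most `D` times the diagonal; the factor
  -- `G.F.len` comes from integrating the pointwise bound along the fracture.
  set D := C * (1 + G.F.len) with hD
  have hD0 : 0 < D := by positivity
  refine ⟨(1 + C) * (2 * D), by positivity, fun M hA f fΓ hf hfΓ w hw hd hE => ?_⟩
  have hM := hA.isStar hρ
  obtain ⟨h1, h2⟩ := H M hA w hw hd
  have h3 : (G.F.integral fun s => w.2.2 (G.F.γ s) ^ 2) ≤ G.F.len * (C * form c w w) := by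
    have e : G.F.len * (C * form c w w) = G.F.integral fun _ => C * form c w w := by
      simp [Fracture.integral]; ring
    have : IsFiniteMeasure G.F.paramMeasure := by unfold Fracture.paramMeasure; infer_instance
    rw [e, Fracture.integral_eq, Fracture.integral_eq]
    apply integral_mono_ae (Fracture.memLp_trace hw.2.2.2.1).integrable_sq (integrable_const _)
    filter_upwards [G.F.ae_mem] with s hs
    exact h2 _ ⟨s, hs, rfl⟩
  -- With `δ = 2 / D` the pressure part is at most half of the diagonal.
  have h4 := load_le hM c hf hfΓ (q := w.2) hw.2.2 (δ := 2 * D⁻¹) (by positivity)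
  rw [← hE] at h4
  set R := (∫ x in G.bulk, f x ^ 2) +
    G.F.integral fun s => (c.ℓ (G.F.γ s) * fΓ (G.F.γ s)) ^ 2 with hR
  have h5 : 2 * D⁻¹ / 4 * ((∑ τ, M.triIntegral τ fun x => ev (w.2.1 τ) x ^ 2) +
        G.F.integral fun s => w.2.2 (G.F.γ s) ^ 2) ≤ 2 * D⁻¹ / 4 * (D * form c w w) :=
    mul_le_mul_of_nonneg_left (by rw [hD]; linarith) (by positivity)
  have h6 : 2 * D⁻¹ / 4 * (D * form c w w) = form c w w / 2 := by field_simp; norm_num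
  have h7 : (2 * D⁻¹)⁻¹ * R = D * R / 2 := by rw [mul_inv, inv_inv]; ring
  have h8 : form c w w ≤ D * R := by linarith
  have h0 : 0 ≤ form c w w := by
    rw [form_self]
    have n1 : 0 ≤ mass c w.1 w.1 := mass_nonneg hM _
    have n2 : 0 ≤ jumpForm c w.2.1 w.2.1 := jumpForm_nonneg _
    have n3 : 0 ≤ exchangeForm c w.2 w.2 := exchangeForm_nonneg _
    have n4 : 0 ≤ diffusionForm c w.2.2 w.2.2 := diffusionForm_nonneg _
    linarith
  rw [energy_eq]
  calc _ ≤ (1 + C) * form c w w := by linarith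
    _ ≤ (1 + C) * (2 * D * R) := mul_le_mul_of_nonneg_left (by linarith) (by positivity)
    _ = _ := by ring

theorem existsUnique_isSolution (c : Coefficients G) (k : ℕ) {ρ : ℝ} (hρ : 0 < ρ)
    (hA : M.AssumptionA ρ) {f fΓ : Plane → ℝ} (hf : MemLp f 2 (volume.restrict G.bulk))
    (hfΓ : MemLp (fun s => fΓ (G.F.γ s)) 2 G.F.paramMeasure) :
    ∃! w : M.Vector × M.Scalar × (Plane → ℝ), IsSolution M c k f fΓ w.1 w.2.1 w.2.2 := by
  have hM := hA.isStar hρ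
  simp only [isSolution_iff hM]
  have := finite_space hM k
  have hl := isLinOn_load hM c k hf hfΓ
  have hl' : IsLinOn (M.space k) fun w => load c f fΓ w.2 :=
    ⟨fun x hx y hy => hl.add x.2 hx.2 y.2 hy.2, fun r x hx => hl.smul r x.2 hx.2⟩
  refine existsUnique_of_isLinOn (fun y hy => isLinOn_form_left hM c hy)
    (fun x hx => isLinOn_form_right hM c hx) (fun w hw h => ?_) hl'
  have hz : ∀ w' ∈ M.space k, form c w w' = load c 0 0 w'.2 := by
    intro w' hw'
    rw [h w' hw']
    simp [load, triIntegral, Fracture.integral]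
  -- A kernel element is a solution with zero data, so it satisfies the Darcy equation that the
  -- pressure bound requires.
  exact eq_zero_of_form_self hρ hA hw ((isSolution_iff hM).2 ⟨hw, hz⟩).darcy (h w hw)

end Mesh

end FracturedFlow

end


open FracturedFlow in
/-- Well-posedness and stability of the coupled staggered DG / conforming finite element scheme. The
constant depends on the geometry, the coefficients, the order `k` and `ρ`, but neither on the mesh
nor on the sources `f`, `fΓ`. -/
theorem theorem3p1 (G : Geometry) (c : Coefficients G) (k : ℕ) (ρ : ℝ) (hρ : 0 < ρ) :
    ∃ C : ℝ, 0 < C ∧ ∀ M : Mesh G, M.AssumptionA ρ →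
      ∀ f fΓ : Plane → ℝ, MemLp f 2 (volume.restrict G.bulk) →
        MemLp (fun s => fΓ (G.F.γ s)) 2 G.F.paramMeasure →
        (∃! w : M.Vector × M.Scalar × (Plane → ℝ),
          Mesh.IsSolution M c k f fΓ w.1 w.2.1 w.2.2) ∧
        ∀ (u : M.Vector) (p : M.Scalar) (pΓ : Plane → ℝ), Mesh.IsSolution M c k f fΓ u p pΓ →
          Mesh.energy c u p pΓ ≤
            C * ((∫ x in G.bulk, f x ^ 2) +
              G.F.integral fun s => (c.ℓ (G.F.γ s) * fΓ (G.F.γ s)) ^ 2) := by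
  obtain ⟨C, hC, H⟩ := Mesh.exists_stability c k hρ
  refine ⟨C, hC, fun M hA f fΓ hf hfΓ => ⟨Mesh.existsUnique_isSolution c k hρ hA hf hfΓ,
    fun u p pΓ h => ?_⟩⟩
  have hw := (Mesh.isSolution_iff (w := (u, p, pΓ)) (hA.isStar hρ)).1 h
  exact H M hA f fΓ hf hfΓ (u, p, pΓ) hw.1 h.darcy (hw.2 _ hw.1)
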